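/- Let $p$ be a prime, $\gamma\ge 1$, and let $A=\{a(m)\}_{m\in\mathbb Z}$ be a real sequence with (1) $a(m)\ge a(m+1)$; (2) $\lim_{m\to\infty}a(m)=0$ and $\lim_{m\to-\infty}a(m)$ is positive or $+\infty$; (4) $\sum_{m\le 0}a(m)p^{\gamma m}<\infty$. We say that a $\mathbb Q_p$-valued càdlàg process $Z$ with $Z(0)=0$, adapted to a filtration $\{\mathcal F_t\}_{t\ge0}$ such that $\mathcal F_t$ is independent of $\sigma(Z(t+s)-Z(t);s\ge 0)$ for every $t$, is a Lévy process (random walk) corresponding to $A$ if the law of $Z(s+t)-Z(s)$ is, for all $s,t\ge 0$, the rotation-invariant probability $\mu_t$ on $\mathbb Q_p$ with $$\mu_t(\|z\|_p\le p^m)=\Bigl(1-\tfrac1p\Bigr)\sum_{i\ge 0}p^{-i}\exp\Bigl(-t\,\frac{p\,a(m+i)-a(m+i+1)}{p-1}\Bigr)\qquad(m\in\mathbb Z),$$ i.e. the Lévy measure is rotation invariant and gives mass $a(m)$ to $\{\|z\|_p>p^m\}$. Let $Z$ be such a process on a probability space $(\Omega,\mathcal F,P_0)$ and let $\Lambda=\sum_{s:\Delta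 Z(s)\ne0}\delta_{(s,\Delta Z(s))}$ be the Poisson random measure of its jumps $\Delta Z(s)=Z(s)-Z(s-)$. For $M\in\mathbb Z$ let $a(M;m)=a(m)$ if $m<M$ and $a(M;m)=0$ if $m\ge M$, $A(M)=\{a(M;m)\}_{m\in\mathbb Z}$, and let $f_M(z)=p^mz$ if $\|z\|_p=p^{m+M}$ for some integer $m\ge0$, $f_M(z)=z$ otherwise. For $T>0$ let $\mathcal L^\gamma$ be the set of predictable $\mathbb Q_p$-valued processes $\phi$ with $E_0[\int_0^T\|\phi(t)\|_p^\gamma dt]<\infty$. A simple process is $\phi=g1_{\{0\}}+\sum_{i=0}^{n-1}f_i1_{(t_i,t_{i+1}]}$ with $0=t_0<\dots<t_n=T$ and essentially bounded $g$, $f_i$, measurable with respect to $\mathcal F_0$, $\mathcal F_{t_i}$; for it, $\int_0^t\phi\,dX=\sum_if_i(X(t_{i+1}\wedge t)-X(t_i\wedge t))$. For $\phi\in\mathcal L^\gamma$, a stochastic integral $\int_0^t\phi\,dX$, $0\le t\le T$, is a càdlàg process $Y$ on $[0,T]$ with $E_0[\sup_{t\le T}\|Y(t)-\int_0^t\phi_n\,dX\|_p^\gamma]\to0$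 for some simple $\phi_n$ with $E_0[\int_0^T\|\phi_n-\phi\|_p^\gamma dt]\to0$. Then the following hold. (i) For every $M\in\mathbb Z$, $A(M)$ satisfies (1), (2) and (3) $\sum_{m\in\mathbb Z}a(M;m)p^{\gamma m}<\infty$; the integral $Z(M;t)=\int_{\mathbb Q_p}\int_0^tf_M(z)\,\Lambda(ds,dz)$ converges unconditionally in $\mathbb Q_p$, and $\{Z(M;t)\}_{t\ge0}$ is a random walk corresponding to $A(M)$ (with respect to $\{\mathcal F_t\}$). Let $T>0$. For all $M\in\mathbb Z$ and $\phi\in\mathcal L^\gamma$ the integral $\int_0^t\phi(s)\,dZ(M;s)$, $0\le t\le T$, exists and is unique up to indistinguishability, and there are events $\Omega(M;T)$, $M=0,1,2,\dots$, with $\lim_{M\to\infty}P_0(\Omega(M;T))=1$ such that: (ii) for every $\phi\in\mathcal L^\gamma$, all $M\ge 0$ and $k\ge1$, a.s. on $\Omega(M;T)$, $\int_0^t\phi(s)\,dZ(M;s)=\int_0^t\phi(s)\,dZ(M+k;s)$ for all $t\in[0,T]$; (iii) for every sequence $\{\phi(M;\cdot)\}_{M\ge0}\subset\mathcal L^\gamma$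 such that, for all $M\ge0$, $k\ge1$ and $t\in[0,T]$, $\phi(M;t)=\phi(M+k;t)$ a.s. on $\Omega(M;T)$, one has for all $M\ge0$ and $k\ge1$, a.s. on $\Omega(M;T)$, $\int_0^t\phi(M;s)\,dZ(M;s)=\int_0^t\phi(M+k;s)\,dZ(M+k;s)$ for all $t\in[0,T]$. Consequently the stochastic integral with respect to $Z$ is defined: if $\phi$ is predictable and there are $\phi(M;\cdot)\in\mathcal L^\gamma$, $M\ge1$, such that $\phi(t)=\phi(M;t)$ a.s. on $\Omega(M;T)$ for all $t\in[0,T]$ and $M\ge1$, then there is a càdlàg process $Y$ on $[0,T]$, adapted to $\{\mathcal F_t\}$ up to null sets and unique up to indistinguishability, such that for every $M\ge1$, a.s. on $\Omega(M;T)$, $Y(t)=\int_0^t\phi(M;s)\,dZ(M;s)$ for all $t\in[0,T]$. This covers the $\alpha$-stable process for $0<\alpha<\gamma$: its sequence $a(m)=\frac{1-p^{-1}}{1-p^{-\alpha-1}}p^{-\alpha m}$ satisfies (1), (2) and (4). -/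

import Mathlib

open MeasureTheory ProbabilityTheory Filter Topology
open scoped NNReal ENNReal

/-- `ℚ_p` carries its Borel σ-algebra. -/
noncomputable instance Padic.instMeasurableSpaceBorel (p : ℕ) [Fact p.Prime] : MeasurableSpace ℚ_[p] :=
  borel ℚ_[p]

instance Padic.instBorelSpaceBorel (p : ℕ) [Fact p.Prime] : BorelSpace ℚ_[p] := ⟨rfl⟩

namespace PadicLevy

noncomputable section

/-! ### Rate sequences -/

/-- The sequence `a(m)`, `m ∈ ℤ`, is non-increasing, tends to `0` at `+∞`, and its limit at `-∞`
is positive or `+∞`. -/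
structure IsRateSequence (a : ℤ → ℝ) : Prop where
  antitone : Antitone a
  tendsto_atTop : Tendsto a atTop (𝓝 0)
  limit_atBot : (∃ l : ℝ, 0 < l ∧ Tendsto a atBot (𝓝 l)) ∨ Tendsto a atBot atTop

/-- `∑_{m ∈ ℤ} a(m) p^{γ m} < ∞`. -/
def SummableMoment (p : ℕ) (γ : ℝ) (a : ℤ → ℝ) : Prop :=
  Summable fun m : ℤ => a m * (p : ℝ) ^ (γ * (m : ℝ))

/-- `∑_{m ≤ 0} a(m) p^{γ m} < ∞`. -/
def SummableSmallMoment (p : ℕ) (γ : ℝ) (a : ℤ → ℝ) : Prop :=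
  Summable fun n : ℕ => a (-(n : ℤ)) * (p : ℝ) ^ (-(γ * (n : ℝ)))

/-- The truncated sequence `A(M)`: `a(M; m) = a(m)` for `m < M` and `0` for `m ≥ M`. -/
def truncSeq (a : ℤ → ℝ) (M : ℤ) : ℤ → ℝ := fun m => if m < M then a m else 0

/-- The sequence of the `α`-stable process. -/
def stableSeq (p : ℕ) (α : ℝ) : ℤ → ℝ := fun m =>
  (1 - (p : ℝ)⁻¹) / (1 - (p : ℝ) ^ (-α - 1)) * (p : ℝ) ^ (-(α * (m : ℝ)))

/-! ### The Lévy process determined by a sequence -/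

/-- The probability that the process determined by `a` is, at time `t`, in the ball of radius `p^m`
about its starting point. (`(p a(k) - a(k+1)) / (p - 1)` is the value on `‖ξ‖ = p^{-k}` of the
characteristic exponent of the rotation invariant Lévy measure giving mass `a(k)` to
`{‖z‖ > p^k}`; thus `a(k)` is the rate of leaving a ball of radius `p^k`.) -/
def centeredBallMass (p : ℕ) (a : ℤ → ℝ) (t : ℝ) (m : ℤ) : ℝ :=
  (1 - (p : ℝ)⁻¹) * ∑' i : ℕ,
    ((p : ℝ)⁻¹) ^ i * Real.exp (-t * (((p : ℝ) * a (m + i) - a (m + i + 1)) / ((p : ℝ) - 1)))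

/-- The mass given by the time-`t` transition probability from `0` to the ball of centre `x` and
radius `p^m`. If the ball does not contain `0`, then `‖x‖ = p^k` with `k > m`, and the mass of the
sphere of radius `p^k` is shared equally by its `p^{k-m} - p^{k-m-1}` balls of radius `p^m`. -/
def ballMass (p : ℕ) [Fact p.Prime] (a : ℤ → ℝ) (t : ℝ) (x : ℚ_[p]) (m : ℤ) : ℝ :=
  if ‖x‖ ≤ (p : ℝ) ^ m then centeredBallMass p a t m
  else
    (centeredBallMass p a t (-x.valuation) - centeredBallMass p a t (-x.valuation - 1)) /
      ((p : ℝ) ^ (-x.valuation - m) - (p : ℝ) ^ (-x.valuation - m - 1))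

variable {p : ℕ} [Fact p.Prime] {Ω : Type*} {mΩ : MeasurableSpace Ω}

/-- Right continuous with left limits. -/
def IsCadlag (ζ : ℝ≥0 → ℚ_[p]) : Prop :=
  ∀ t, ContinuousWithinAt ζ (Set.Ici t) t ∧ ∃ l, Tendsto ζ (𝓝[<] t) (𝓝 l)

/-- `Z` is a Lévy process (a random walk) on `ℚ_p` corresponding to `a`, started at `0`, relative to
the filtration `𝓕`: it is càdlàg and adapted, `𝓕 t` is independent of
`σ(Z(t+s) - Z(t) ; s ≥ 0)`, and the law of `Z(s+t) - Z(s)` is the transition probability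
determined by `a`. -/
structure IsLevyProcess (a : ℤ → ℝ) (𝓕 : Filtration ℝ≥0 mΩ) (P : Measure Ω)
    (Z : ℝ≥0 → Ω → ℚ_[p]) : Prop where
  zero : ∀ ω, Z 0 ω = 0
  cadlag : ∀ ω, IsCadlag fun t => Z t ω
  adapted : ∀ t, Measurable[𝓕 t] (Z t)
  indep : ∀ t, Indep (𝓕 t)
    (⨆ s : ℝ≥0, MeasurableSpace.comap (fun ω => Z (t + s) ω - Z t ω) inferInstance) P
  law : ∀ (s t : ℝ≥0) (x : ℚ_[p]) (m : ℤ),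
    P.real {ω | Z (s + t) ω - Z s ω ∈ Metric.closedBall x ((p : ℝ) ^ m)} = ballMass p a t x m

/-! ### The Poisson random measure of the jumps and the truncated processes -/

/-- The jump `ζ(s) - ζ(s-)` (it is `0` at `s = 0`). -/
def jump (ζ : ℝ≥0 → ℚ_[p]) (s : ℝ≥0) : ℚ_[p] := ζ s - Function.leftLim ζ s

/-- The measure `Λ = ∑_{s : Δζ(s) ≠ 0} δ_{(s, Δζ(s))}` on `[0, ∞) × ℚ_p`. -/
def jumpMeasure (ζ : ℝ≥0 → ℚ_[p]) : Measure (ℝ≥0 × ℚ_[p]) :=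
  Measure.sum fun s : {s : ℝ≥0 // jump ζ s ≠ 0} => Measure.dirac ((s : ℝ≥0), jump ζ s)

/-- The contribution of the atom `x = (s, z)` to the integral of `f` over `[0, t] × ℚ_p` with
respect to an integer-valued, purely atomic measure `Λ`. -/
def atomTerm (Λ : Measure (ℝ≥0 × ℚ_[p])) (f : ℚ_[p] → ℚ_[p]) (t : ℝ≥0)
    (x : ℝ≥0 × ℚ_[p]) : ℚ_[p] :=
  if x.1 ≤ t then ⌊Λ.real {x}⌋₊ • f x.2 else 0

/-- `∫_{ℚ_p} ∫_0^t f(z) Λ(ds, dz)` converges (in `ℚ_p`, unconditionally). -/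
def JumpIntegrable (Λ : Measure (ℝ≥0 × ℚ_[p])) (f : ℚ_[p] → ℚ_[p]) (t : ℝ≥0) : Prop :=
  Summable (atomTerm Λ f t)

/-- `∫_{ℚ_p} ∫_0^t f(z) Λ(ds, dz)` for an integer-valued, purely atomic measure `Λ`. -/
def jumpIntegral (Λ : Measure (ℝ≥0 × ℚ_[p])) (f : ℚ_[p] → ℚ_[p]) (t : ℝ≥0) : ℚ_[p] :=
  ∑' x, atomTerm Λ f t x

/-- `f_M(z) = p^m z` if `‖z‖ = p^{m+M}` with an integer `m ≥ 0`, and `f_M(z) = z` otherwise. -/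
def truncFun (p : ℕ) [Fact p.Prime] (M : ℤ) (z : ℚ_[p]) : ℚ_[p] :=
  (p : ℚ_[p]) ^ (-z.valuation - M).toNat * z

theorem truncFun_of_norm_eq (M : ℤ) (z : ℚ_[p]) (m : ℕ) (h : ‖z‖ = (p : ℝ) ^ ((m : ℤ) + M)) :
    truncFun p M z = (p : ℚ_[p]) ^ m * z := by
  have hp : (1 : ℝ) < p := by exact_mod_cast (Fact.out : p.Prime).one_lt
  have hz : z ≠ 0 := by
    rintro rfl
    rw [norm_zero] at h
    exact absurd h (zpow_pos (by linarith) _).ne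
  rw [Padic.norm_eq_zpow_neg_valuation hz] at h
  have h2 := zpow_right_injective₀ (by linarith) hp.ne' h
  have h3 : (-z.valuation - M).toNat = m := by
    omega
  rw [truncFun, h3]

theorem truncFun_of_forall_ne (M : ℤ) (z : ℚ_[p])
    (h : ∀ m : ℕ, ‖z‖ ≠ (p : ℝ) ^ ((m : ℤ) + M)) : truncFun p M z = z := by
  rcases eq_or_ne z 0 with rfl | hz
  · simp [truncFun]
  · have h3 : (-z.valuation - M).toNat = 0 := by
      by_contra hne
      apply h (-z.valuation - M).toNat
      rw [Padic.norm_eq_zpow_neg_valuation hz]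
      congr 1
      omega
    rw [truncFun, h3, pow_zero, one_mul]

/-- `Z(M; t) = ∫_{ℚ_p} ∫_0^t f_M(z) Λ(ds, dz)`, where `Λ` is the Poisson random measure of the
jumps of `Z`. -/
def truncProcess (Z : ℝ≥0 → Ω → ℚ_[p]) (M : ℤ) : ℝ≥0 → Ω → ℚ_[p] := fun t ω =>
  jumpIntegral (jumpMeasure fun s => Z s ω) (truncFun p M) t

/-! ### Stochastic integrals -/

/-- `E[∫_0^T ‖φ(t)‖^γ dt]`. -/
def energy (P : Measure Ω) (γ : ℝ) (T : ℝ≥0) (φ : ℝ≥0 → Ω → ℚ_[p]) : ℝ≥0∞ :=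
  ∫⁻ ω, ∫⁻ t in Set.Ioc (0 : ℝ) T, ‖φ t.toNNReal ω‖ₑ ^ γ ∂volume ∂P

/-- The class `𝓛^γ` of (`𝓕`-adapted) predictable processes with `E[∫_0^T ‖φ(t)‖^γ dt] < ∞`. -/
def MemL (𝓕 : Filtration ℝ≥0 mΩ) (P : Measure Ω) (γ : ℝ) (T : ℝ≥0)
    (φ : ℝ≥0 → Ω → ℚ_[p]) : Prop :=
  IsStronglyPredictable 𝓕 φ ∧ energy P γ T φ < ∞

/-- The data of a simple process `g 1_{{0}} + ∑_{i < n} f_i 1_{(t_i, t_{i+1}]}` with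
`0 = t_0 < ⋯ < t_n = T`, where `f_i` is `𝓕 t_i`-measurable and essentially bounded. -/
structure SimpleIntegrand (p : ℕ) [Fact p.Prime] (𝓕 : Filtration ℝ≥0 mΩ) (P : Measure Ω)
    (T : ℝ≥0) where
  n : ℕ
  time : ℕ → ℝ≥0
  time_zero : time 0 = 0
  time_last : time n = T
  time_lt : ∀ i < n, time i < time (i + 1)
  g : Ω → ℚ_[p]
  f : ℕ → Ω → ℚ_[p]
  measurable_g : Measurable[𝓕 0] g
  measurable_f : ∀ i < n, Measurable[𝓕 (time i)] (f i)
  bounded_g : ∃ C : ℝ, ∀ᵐ ω ∂P, ‖g ω‖ ≤ C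
  bounded_f : ∀ i < n, ∃ C : ℝ, ∀ᵐ ω ∂P, ‖f i ω‖ ≤ C

variable {𝓕 : Filtration ℝ≥0 mΩ} {P : Measure Ω} {T : ℝ≥0}

/-- The process `g 1_{{0}} + ∑_{i < n} f_i 1_{(t_i, t_{i+1}]}`. -/
def SimpleIntegrand.process (φ : SimpleIntegrand p 𝓕 P T) : ℝ≥0 → Ω → ℚ_[p] := fun t ω =>
  Set.indicator {0} (fun _ => φ.g ω) t +
    ∑ i ∈ Finset.range φ.n,
      Set.indicator (Set.Ioc (φ.time i) (φ.time (i + 1))) (fun _ => φ.f i ω) t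

/-- `∫_0^t φ dX = ∑_i f_i (X(t_{i+1} ∧ t) - X(t_i ∧ t))` for a simple process. -/
def SimpleIntegrand.integral (φ : SimpleIntegrand p 𝓕 P T) (X : ℝ≥0 → Ω → ℚ_[p]) :
    ℝ≥0 → Ω → ℚ_[p] := fun t ω =>
  ∑ i ∈ Finset.range φ.n, φ.f i ω * (X (min (φ.time (i + 1)) t) ω - X (min (φ.time i) t) ω)

/-- `Y` is (a version of) the stochastic integral `∫_0^t φ dX`, `0 ≤ t ≤ T`: its paths on `[0, T]`
are càdlàg and, for some simple `φ_n` converging to `φ` in `𝓛^γ`,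
`E[sup_{t ≤ T} ‖Y(t) - ∫_0^t φ_n dX‖^γ] → 0`. -/
def IsStochIntegral (𝓕 : Filtration ℝ≥0 mΩ) (P : Measure Ω) (γ : ℝ) (T : ℝ≥0)
    (X φ Y : ℝ≥0 → Ω → ℚ_[p]) : Prop :=
  (∀ t ≤ T, Measurable (Y t)) ∧
  (∀ ω, IsCadlag fun t => Y (min t T) ω) ∧
  ∃ φn : ℕ → SimpleIntegrand p 𝓕 P T,
    Tendsto (fun n => energy P γ T fun t ω => (φn n).process t ω - φ t ω) atTop (𝓝 0) ∧
    Tendsto (fun n => ∫⁻ ω, ⨆ t ∈ Set.Iic T, ‖Y t ω - (φn n).integral X t ω‖ₑ ^ γ ∂P)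
      atTop (𝓝 0)

/-- `Y` is a process `∫_0^t φ dZ`, `0 ≤ t ≤ T`, obtained from processes `φ(M; ·)`, `M ≥ 1`, and
events `Ω(M)`: it has càdlàg paths on `[0, T]`, is adapted to `𝓕` up to null sets, and agrees with
`∫_0^t φ(M; s) dZ(M; s)` a.s. on `Ω(M)` for all `M ≥ 1`. -/
def IsLocalizedIntegral (𝓕 : Filtration ℝ≥0 mΩ) (P : Measure Ω) (γ : ℝ) (T : ℝ≥0)
    (Z : ℝ≥0 → Ω → ℚ_[p]) (E : ℕ → Set Ω) (φM : ℕ → ℝ≥0 → Ω → ℚ_[p])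
    (Y : ℝ≥0 → Ω → ℚ_[p]) : Prop :=
  (∀ t ≤ T, AEStronglyMeasurable[𝓕 t] (Y t) P) ∧
  (∀ ω, IsCadlag fun t => Y (min t T) ω) ∧
  ∀ M : ℕ, 1 ≤ M → ∀ I, IsStochIntegral 𝓕 P γ T (truncProcess Z M) (φM M) I →
    ∀ᵐ ω ∂P, ω ∈ E M → ∀ t ≤ T, Y t ω = I t ω

end

end PadicLevy

/-!
The proof is pathwise and rests on one feature of `ℚ_p`: a family that exceeds each positive level
only finitely often is summable. A càdlàg path has, on bounded intervals, finitely many jumps above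
each level, so its jumps can be summed, and, as the increments along fine partitions are uniformly
close to the sums of the jumps, the path is the sum of its jumps
(`IsCadlag.sub_eq_cumSum_sub`). The same holds for the image of the jumps under a map that fixes `0`
and does not increase distances, such as `f_M`. Hence `Z(M)` is a limit of sums of truncated
increments of `Z`, which are i.i.d. and rotation invariant. A rotation invariant law is determined
by its spherical transform (`RotInvariant.closedBall_eq_ballMass`), which turns such sums into
powers, and the rate `a(m)` of leaving a ball of radius `p^m` gives the limit of these powers. This
is `IsLevyProcess.trunc`.

Let `X` be a Lévy process whose sequence satisfies `∑ a(m) p^{γ m} < ∞`. The `γ`-variation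
`∑ ‖ΔX(s)‖^γ` over a time interval has finite mean, proportional to the length of the interval, so a
Dynkin argument yields the compensation formula
`E ∑_{s ≤ T} h(s) ‖ΔX(s)‖^γ = c E ∫_0^T h(s) ds` for predictable `h ≥ 0`
(`IsLevyProcess.compensation`). With `h = ‖φ‖^γ` it shows that `∑_{s ≤ t} φ(s) ΔX(s)` converges a.s.
for `φ ∈ 𝓛^γ`. For simple `φ` this sum is the elementary integral, and since the `γ`-th power of an
ultrametric norm is subadditive over infinite sums, the supremum over `t` of the distance between
two such sums is at most `(∑ ‖φ(s) - φ'(s)‖^γ ‖ΔX(s)‖^γ)^{1/γ}`. Simple processes being dense in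
`𝓛^γ` (`MemL.exists_simple`), the stochastic integral exists and every version of it is the sum
`∑_{s ≤ t} φ(s) ΔX(s)` (`IsLevyProcess.exists_stochIntegral`, `IsLevyProcess.stochIntegral_eq`).

For `Ω(M; T)` one takes the event that `Z` stays in the ball of radius `p^M` during `[0, T]`
(`ballEvent`). There the jumps of `Z(M)`, of `Z(M + k)` and of `Z` coincide, so for one integrand the
sums coincide. For integrands that agree on the event at each fixed time only, they have to agree at
the random jump times as well. Let `A_s` be the event that they differ at time `s` and that `Z` has
stayed in the ball before `s`. The event that `Z` then remains in the ball until `T` has positive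
probability and is independent of `𝓕_s`, so `P(A_s) = 0`; the compensation formula for the indicator
of the predictable set of the `A_s` shows that a.s. there is no jump in it
(`IsLevyProcess.ae_eq_of_jump_ne_zero`). The integral with respect to `Z` is obtained by pasting
along the increasing events `ballEvent`, whose union is everything.
-/

namespace PadicLevy

noncomputable section

/-! ### Sums over jump times -/

section Pathwise

variable {p : ℕ} [Fact p.Prime]

/-- The sum `∑_{s ≤ t} g(s)` over all times `s ≤ t`; meaningful when `g` is `Sparse`. -/
def cumSum (g : ℝ≥0 → ℚ_[p]) (t : ℝ≥0) : ℚ_[p] := ∑' s, (Set.Iic t).indicator g s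

/-- On bounded time intervals, `g` exceeds any positive level only finitely often. In `ℚ_p` this
is what makes `g` unconditionally summable over bounded time intervals. -/
def Sparse (g : ℝ≥0 → ℚ_[p]) : Prop :=
  ∀ t, ∀ ε > (0 : ℝ), {s : ℝ≥0 | s ≤ t ∧ ε < ‖g s‖}.Finite

variable {g : ℝ≥0 → ℚ_[p]}

theorem Sparse.mono {f : ℝ≥0 → ℚ_[p]} (hg : Sparse g) (h : ∀ s, ‖f s‖ ≤ ‖g s‖) : Sparse f :=
  fun t ε hε => (hg t ε hε).subset fun s hs => ⟨hs.1, hs.2.trans_le (h s)⟩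

theorem Sparse.summable (hg : Sparse g) {S : Set ℝ≥0} {t : ℝ≥0} (hS : S ⊆ Set.Iic t) :
    Summable (S.indicator g) := by
  apply NonarchimedeanAddGroup.summable_of_tendsto_cofinite_zero
  rw [Metric.tendsto_nhds]
  intro ε hε
  refine ((hg t (ε / 2) (by linarith)).subset ?_)
  intro s hs
  simp only [Set.mem_compl_iff, Set.mem_ofPred_eq, dist_zero_right, not_lt] at hs
  by_cases hsS : s ∈ S
  · rw [Set.indicator_of_mem hsS] at hs
    exact ⟨hS hsS, by linarith⟩
  · rw [Set.indicator_of_notMem hsS, norm_zero] at hs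
    linarith

theorem Sparse.cumSum_sub (hg : Sparse g) {u v : ℝ≥0} (huv : u ≤ v) :
    cumSum g v - cumSum g u = ∑' s, (Set.Ioc u v).indicator g s := by
  rw [cumSum, cumSum, ← (hg.summable subset_rfl).tsum_sub (hg.summable subset_rfl)]
  congr 1
  ext s
  by_cases h1 : s ≤ u
  · simp [Set.indicator, h1, h1.trans huv]
  · simp [Set.indicator, h1, not_le.1 h1]

theorem Sparse.norm_cumSum_sub_le (hg : Sparse g) {u v : ℝ≥0} (huv : u ≤ v) {ε : ℝ} (hε : 0 ≤ ε)
    (h : ∀ s ∈ Set.Ioc u v, ‖g s‖ ≤ ε) : ‖cumSum g v - cumSum g u‖ ≤ ε := by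
  rw [hg.cumSum_sub huv]
  refine IsUltrametricDist.norm_tsum_le_of_forall_le_of_nonneg hε fun s => ?_
  by_cases hs : s ∈ Set.Ioc u v
  · rw [Set.indicator_of_mem hs]; exact h s hs
  · rw [Set.indicator_of_notMem hs, norm_zero]; exact hε

theorem Sparse.norm_cumSum_sub_sub_le (hg : Sparse g) {u v r : ℝ≥0} (hr : r ∈ Set.Ioc u v) {ε : ℝ}
    (hε : 0 ≤ ε) (h : ∀ s ∈ Set.Ioc u v, s ≠ r → ‖g s‖ ≤ ε) :
    ‖cumSum g v - cumSum g u - g r‖ ≤ ε := by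
  have h1 : g r = ∑' s, ({r} : Set ℝ≥0).indicator g s := by
    rw [tsum_eq_single r]
    · simp
    · intro s hs; simp [hs]
  have h2 : Summable (({r} : Set ℝ≥0).indicator g) :=
    hg.summable (t := r) (by simp)
  rw [hg.cumSum_sub (hr.1.le.trans hr.2), h1,
    ← (hg.summable (S := Set.Ioc u v) (t := v) fun s hs => hs.2).tsum_sub h2]
  refine IsUltrametricDist.norm_tsum_le_of_forall_le_of_nonneg hε fun s => ?_
  by_cases hsr : s = r
  · subst hsr; simp [hr, hε]
  · by_cases hs : s ∈ Set.Ioc u v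
    · simpa [Set.indicator_of_mem hs, hsr] using h s hs hsr
    · simp [Set.indicator_of_notMem hs, hsr, hε]

theorem Sparse.eventually_le (hg : Sparse g) (r : ℝ≥0) {ε : ℝ} (hε : 0 < ε) :
    ∀ᶠ s in 𝓝 r, s ≠ r → ‖g s‖ ≤ ε := by
  have h1 : ({s : ℝ≥0 | s ≤ r + 1 ∧ ε < ‖g s‖} \ {r})ᶜ ∈ 𝓝 r :=
    ((hg (r + 1) ε hε).sdiff).isClosed.isOpen_compl.mem_nhds (by simp)
  have h2 : Set.Iic (r + 1) ∈ 𝓝 r := Iic_mem_nhds (by simp)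
  filter_upwards [h1, h2] with s h1 h2 hs
  by_contra h
  exact h1 ⟨⟨h2, not_le.1 h⟩, hs⟩

/-- Near a time `r`, the increments of `∑_{s ≤ t} g(s)` not crossing `r` are small, and those
crossing `r` are close to `g(r)`. -/
theorem Sparse.exists_nhds (hg : Sparse g) (r : ℝ≥0) {ε : ℝ} (hε : 0 < ε) :
    ∃ δ > 0, ∀ u ∈ Metric.ball r δ, ∀ v ∈ Metric.ball r δ, u ≤ v →
      ((v < r ∨ r ≤ u) → ‖cumSum g v - cumSum g u‖ ≤ ε) ∧
      (r ∈ Set.Ioc u v → ‖cumSum g v - cumSum g u - g r‖ ≤ ε) := by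
  obtain ⟨δ, hδ, h⟩ := Metric.eventually_nhds_iff_ball.1 (hg.eventually_le r hε)
  have hconv : ∀ u ∈ Metric.ball r δ, ∀ v ∈ Metric.ball r δ, ∀ s ∈ Set.Ioc u v,
      s ∈ Metric.ball r δ := by
    intro u hu v hv s hs
    have h1 : (u : ℝ) < s := hs.1
    have h2 : (s : ℝ) ≤ v := hs.2
    simp only [Metric.mem_ball, NNReal.dist_eq, abs_lt] at hu hv ⊢
    constructor <;> linarith [hu.1, hv.2]
  refine ⟨δ, hδ, fun u hu v hv huv => ⟨fun hr => ?_, fun hr => ?_⟩⟩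
  · refine hg.norm_cumSum_sub_le huv hε.le fun s hs => h s (hconv u hu v hv s hs) ?_
    rintro rfl
    rcases hr with hr | hr
    · exact absurd hs.2 (not_le.2 hr)
    · exact absurd hs.1 (not_lt.2 hr)
  · exact hg.norm_cumSum_sub_sub_le hr hε.le fun s hs hsr => h s (hconv u hu v hv s hs) hsr

theorem Sparse.tendsto_left (hg : Sparse g) (r : ℝ≥0) :
    Tendsto (cumSum g) (𝓝[<] r) (𝓝 (cumSum g r - g r)) := by
  rw [Metric.tendsto_nhds]
  intro ε hε
  obtain ⟨δ, hδ, h⟩ := hg.exists_nhds r (half_pos hε)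
  filter_upwards [nhdsWithin_le_nhds (Metric.ball_mem_nhds r hδ), self_mem_nhdsWithin]
    with u hu hur
  have := (h u hu r (Metric.mem_ball_self hδ) (le_of_lt hur)).2 ⟨hur, le_rfl⟩
  rw [dist_comm, dist_eq_norm,
    show cumSum g r - g r - cumSum g u = cumSum g r - cumSum g u - g r by ring]
  linarith

theorem Sparse.isCadlag (hg : Sparse g) : IsCadlag (cumSum g) := by
  intro r
  constructor
  · rw [Metric.continuousWithinAt_iff']
    intro ε hε
    obtain ⟨δ, hδ, h⟩ := hg.exists_nhds r (half_pos hε)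
    filter_upwards [nhdsWithin_le_nhds (Metric.ball_mem_nhds r hδ), self_mem_nhdsWithin]
      with v hv hrv
    have := (h r (Metric.mem_ball_self hδ) v hv hrv).1 (Or.inr le_rfl)
    rw [dist_eq_norm]; linarith
  · exact ⟨_, hg.tendsto_left r⟩

theorem jump_zero (ζ : ℝ≥0 → ℚ_[p]) : jump ζ 0 = 0 := by
  rw [jump, leftLim_eq_of_isBot (fun _ => zero_le), sub_self]

theorem norm_sub_le_max (x y : ℚ_[p]) : ‖x - y‖ ≤ max ‖x‖ ‖y‖ := by
  simpa [sub_eq_add_neg] using IsUltrametricDist.norm_add_le_max x (-y)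

theorem nhdsLT_neBot {r : ℝ≥0} (hr : 0 < r) : (𝓝[<] r).NeBot :=
  nhdsLT_neBot_of_exists_lt ⟨0, hr⟩

theorem Sparse.jump_cumSum (hg : Sparse g) (h0 : g 0 = 0) (r : ℝ≥0) : jump (cumSum g) r = g r := by
  rcases eq_or_lt_of_le (zero_le : 0 ≤ r) with rfl | hr
  · rw [jump_zero, h0]
  · have := nhdsLT_neBot hr
    rw [jump, leftLim_eq_of_tendsto (hg.tendsto_left r)]
    ring

theorem cumSum_zero (h0 : g 0 = 0) : cumSum g 0 = 0 := by
  rw [cumSum, ← tsum_zero (α := ℚ_[p]) (β := ℝ≥0)]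
  congr 1
  ext s
  by_cases hs : s = 0
  · simp [hs, h0]
  · simp [hs]

/-! ### Increments of càdlàg paths -/

variable {ζ : ℝ≥0 → ℚ_[p]}

theorem IsCadlag.tendsto_left (hζ : IsCadlag ζ) {r : ℝ≥0} (hr : 0 < r) :
    Tendsto ζ (𝓝[<] r) (𝓝 (ζ r - jump ζ r)) := by
  obtain ⟨l, hl⟩ := (hζ r).2
  have := nhdsLT_neBot hr
  rw [jump, leftLim_eq_of_tendsto hl]
  simpa using hl

theorem norm_sub_le_of_le {x y z : ℚ_[p]} {ε : ℝ} (h1 : ‖x - y‖ ≤ ε) (h2 : ‖z - y‖ ≤ ε) :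
    ‖x - z‖ ≤ ε := by
  rw [show x - z = (x - y) - (z - y) by ring]
  exact (norm_sub_le_max _ _).trans (max_le h1 h2)

/-- Near a time `r`, the increments of a càdlàg path not crossing `r` are small, and those
crossing `r` are close to the jump at `r`. -/
theorem IsCadlag.exists_nhds (hζ : IsCadlag ζ) (r : ℝ≥0) {ε : ℝ} (hε : 0 < ε) :
    ∃ δ > 0, ∀ u ∈ Metric.ball r δ, ∀ v ∈ Metric.ball r δ, u ≤ v →
      ((v < r ∨ r ≤ u) → ‖ζ v - ζ u‖ ≤ ε) ∧ (r ∈ Set.Ioc u v → ‖ζ v - ζ u - jump ζ r‖ ≤ ε) := by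
  have hR := (hζ r).1
  rw [Metric.continuousWithinAt_iff] at hR
  obtain ⟨δ₁, hδ₁, h₁⟩ := hR ε hε
  have hL : ∃ δ > 0, ∀ u ∈ Metric.ball r δ, u < r → ‖ζ u - (ζ r - jump ζ r)‖ ≤ ε := by
    rcases eq_or_lt_of_le (zero_le : 0 ≤ r) with rfl | hr
    · exact ⟨1, one_pos, fun u _ hu => absurd hu (not_lt.2 zero_le)⟩
    · have := (Metric.tendsto_nhdsWithin_nhds.1 (hζ.tendsto_left hr)) ε hε
      obtain ⟨δ, hδ, h⟩ := this
      exact ⟨δ, hδ, fun u hu hur => by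
        simpa [dist_eq_norm] using (h hur (Metric.mem_ball.1 hu)).le⟩
  obtain ⟨δ₂, hδ₂, h₂⟩ := hL
  have hR' : ∀ v ∈ Metric.ball r δ₁, r ≤ v → ‖ζ v - ζ r‖ ≤ ε := fun v hv hrv => by
    simpa [dist_eq_norm] using (h₁ hrv (Metric.mem_ball.1 hv)).le
  refine ⟨min δ₁ δ₂, lt_min hδ₁ hδ₂, fun u hu v hv huv => ?_⟩
  have hu1 := Metric.ball_subset_ball (min_le_left _ _) hu
  have hu2 := Metric.ball_subset_ball (min_le_right _ _) hu
  have hv1 := Metric.ball_subset_ball (min_le_left _ _) hv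
  have hv2 := Metric.ball_subset_ball (min_le_right _ _) hv
  refine ⟨?_, fun hr => ?_⟩
  · rintro (hr | hr)
    · exact norm_sub_le_of_le (h₂ v hv2 hr) (h₂ u hu2 (huv.trans_lt hr))
    · exact norm_sub_le_of_le (hR' v hv1 (hr.trans huv)) (hR' u hu1 hr)
  · rw [show ζ v - ζ u - jump ζ r = (ζ v - ζ r) - (ζ u - (ζ r - jump ζ r)) by ring]
    exact (norm_sub_le_max _ _).trans (max_le (hR' v hv1 hr.2) (h₂ u hu2 hr.1))

theorem norm_jump_le (hζ : IsCadlag ζ) {s : ℝ≥0} {ε : ℝ} (hε : 0 ≤ ε)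
    (h : ∀ᶠ u in 𝓝[<] s, ‖ζ s - ζ u‖ ≤ ε) : ‖jump ζ s‖ ≤ ε := by
  rcases eq_or_lt_of_le (zero_le : 0 ≤ s) with rfl | hs
  · rw [jump_zero, norm_zero]; exact hε
  · have := nhdsLT_neBot hs
    have h1 : Tendsto (fun u => ‖ζ s - ζ u‖) (𝓝[<] s) (𝓝 ‖jump ζ s‖) := by
      simpa using ((hζ.tendsto_left hs).const_sub (ζ s)).norm
    exact le_of_tendsto h1 h

/-- Infinitely many jumps of size `> ε` in `[0, t]` would accumulate, against the existence of
one-sided limits. -/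
theorem IsCadlag.sparse_jump (hζ : IsCadlag ζ) : Sparse (jump ζ) := by
  intro t ε hε
  by_contra hinf
  obtain ⟨r, -, hr⟩ := Set.Infinite.exists_accPt_of_subset_isCompact hinf
    (isCompact_Icc (a := (0 : ℝ≥0)) (b := t)) fun s hs => ⟨zero_le, hs.1⟩
  rw [accPt_iff_frequently] at hr
  obtain ⟨δ, hδ, h⟩ := hζ.exists_nhds r hε
  obtain ⟨s, ⟨hsr, hs⟩, hsb⟩ := (hr.and_eventually (Metric.ball_mem_nhds r hδ)).exists
  refine absurd hs.2 (not_lt.2 (norm_jump_le hζ hε.le ?_))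
  have h1 : ∀ᶠ u in 𝓝[<] s, u ∈ Metric.ball r δ :=
    nhdsWithin_le_nhds (Metric.isOpen_ball.mem_nhds hsb)
  rcases lt_or_gt_of_ne hsr with hlt | hgt
  · filter_upwards [h1, self_mem_nhdsWithin] with u hu hus
    exact (h u hu s hsb (le_of_lt hus)).1 (Or.inl hlt)
  · filter_upwards [h1, self_mem_nhdsWithin, nhdsWithin_le_nhds (Ioi_mem_nhds hgt)]
      with u hu hus hru
    exact (h u hu s hsb (le_of_lt hus)).1 (Or.inr (le_of_lt hru))

/-- A map of `ℚ_p` that fixes `0` and does not increase distances. -/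
structure IsShort (F : ℚ_[p] → ℚ_[p]) : Prop where
  zero : F 0 = 0
  norm_sub_le : ∀ x y, ‖F x - F y‖ ≤ ‖x - y‖

theorem IsShort.norm_le {F : ℚ_[p] → ℚ_[p]} (hF : IsShort F) (x : ℚ_[p]) : ‖F x‖ ≤ ‖x‖ := by
  simpa [hF.zero] using hF.norm_sub_le x 0

theorem isShort_id : IsShort (id : ℚ_[p] → ℚ_[p]) := ⟨rfl, fun _ _ => le_rfl⟩

theorem IsShort.continuous {F : ℚ_[p] → ℚ_[p]} (hF : IsShort F) : Continuous F :=
  (LipschitzWith.of_dist_le_mul (K := 1) fun x y => by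
    simpa [dist_eq_norm] using hF.norm_sub_le x y).continuous

theorem IsCadlag.sparse_comp_jump (hζ : IsCadlag ζ) {F : ℚ_[p] → ℚ_[p]} (hF : IsShort F) :
    Sparse fun s => F (jump ζ s) :=
  hζ.sparse_jump.mono fun _ => hF.norm_le _

/-- Over short intervals, `F` of the increment of a càdlàg path is uniformly close to the sum of
`F` over the jumps. The Lebesgue number lemma reduces this to a neighbourhood of one time `r`,
where both quantities are within `ε` of `0` or of `F(Δζ(r))`. -/
theorem IsCadlag.exists_uniform (hζ : IsCadlag ζ) {F : ℚ_[p] → ℚ_[p]} (hF : IsShort F) (t : ℝ≥0)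
    {ε : ℝ} (hε : 0 < ε) :
    ∃ δ > (0 : ℝ), ∀ u v : ℝ≥0, u ≤ v → v ≤ t → (v : ℝ) - u < δ →
      ‖F (ζ v - ζ u) - (cumSum (fun s => F (jump ζ s)) v - cumSum (fun s => F (jump ζ s)) u)‖
        ≤ ε := by
  have hg := hζ.sparse_comp_jump hF
  have hloc : ∀ r : ℝ≥0, ∃ δ > 0, ∀ u ∈ Metric.ball r δ, ∀ v ∈ Metric.ball r δ, u ≤ v →
      ‖F (ζ v - ζ u) - (cumSum (fun s => F (jump ζ s)) v - cumSum (fun s => F (jump ζ s)) u)‖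
        ≤ ε := by
    intro r
    obtain ⟨δ₁, hδ₁, h₁⟩ := hζ.exists_nhds r hε
    obtain ⟨δ₂, hδ₂, h₂⟩ := hg.exists_nhds r hε
    refine ⟨min δ₁ δ₂, lt_min hδ₁ hδ₂, fun u hu v hv huv => ?_⟩
    have h₁ := h₁ u (Metric.ball_subset_ball (min_le_left _ _) hu) v
      (Metric.ball_subset_ball (min_le_left _ _) hv) huv
    have h₂ := h₂ u (Metric.ball_subset_ball (min_le_right _ _) hu) v
      (Metric.ball_subset_ball (min_le_right _ _) hv) huv
    by_cases hr : v < r ∨ r ≤ u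
    · exact (norm_sub_le_max _ _).trans
        (max_le ((hF.norm_le _).trans (h₁.1 hr)) (h₂.1 hr))
    · push Not at hr
      exact norm_sub_le_of_le ((hF.norm_sub_le _ _).trans (h₁.2 ⟨hr.2, hr.1⟩))
        (h₂.2 ⟨hr.2, hr.1⟩)
  choose d hd h using hloc
  obtain ⟨δ, hδ, hδ'⟩ := lebesgue_number_lemma_of_metric (isCompact_Icc (a := (0 : ℝ≥0)) (b := t))
    (c := fun r => Metric.ball r (d r)) (fun r => Metric.isOpen_ball)
    (fun r _ => Set.mem_iUnion.2 ⟨r, Metric.mem_ball_self (hd r)⟩)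
  refine ⟨δ, hδ, fun u v huv hvt hlt => ?_⟩
  obtain ⟨r, hr⟩ := hδ' u ⟨zero_le, huv.trans hvt⟩
  refine h r u (hr (Metric.mem_ball_self hδ)) v (hr ?_) huv
  rw [Metric.mem_ball, NNReal.dist_eq, abs_lt]
  have : (u : ℝ) ≤ v := huv
  constructor <;> linarith

/-- The `i`-th point of the partition of `[u, u + h]` into `n` intervals of equal length. -/
def grid (u h : ℝ≥0) (n i : ℕ) : ℝ≥0 := u + h * (i / n)

theorem grid_zero (u h : ℝ≥0) (n : ℕ) : grid u h n 0 = u := by simp [grid]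

theorem grid_self (u h : ℝ≥0) {n : ℕ} (hn : n ≠ 0) : grid u h n n = u + h := by
  have : (n : ℝ≥0) ≠ 0 := by exact_mod_cast hn
  simp [grid, this]

theorem grid_succ (u h : ℝ≥0) (n i : ℕ) : grid u h n (i + 1) = grid u h n i + h / n := by
  simp only [grid, Nat.cast_add, Nat.cast_one]
  rw [add_div, mul_add, add_assoc]
  congr 2
  rw [mul_one_div]

theorem grid_mono (u h : ℝ≥0) (n : ℕ) : Monotone (grid u h n) := by
  refine monotone_nat_of_le_succ fun i => ?_
  rw [grid_succ]; exact le_self_add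

theorem le_grid (u h : ℝ≥0) (n i : ℕ) : u ≤ grid u h n i := le_self_add

theorem grid_le (u h : ℝ≥0) {n i : ℕ} (hi : i ≤ n) : grid u h n i ≤ u + h := by
  rcases eq_or_ne n 0 with rfl | hn
  · simp [grid]
  · exact (grid_mono u h n hi).trans (grid_self u h hn).le

/-- The increment over the `i`-th interval of the partition of `[u, u + h]` into `n` intervals. -/
def gridIncr (ζ : ℝ≥0 → ℚ_[p]) (u h : ℝ≥0) (n i : ℕ) : ℚ_[p] :=
  ζ (grid u h n (i + 1)) - ζ (grid u h n i)

theorem sum_gridIncr (ζ : ℝ≥0 → ℚ_[p]) (u h : ℝ≥0) {n : ℕ} (hn : n ≠ 0) :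
    ∑ i ∈ Finset.range n, gridIncr ζ u h n i = ζ (u + h) - ζ u := by
  have := Finset.sum_range_sub (fun i => ζ (grid u h n i)) n
  rw [grid_self u h hn, grid_zero] at this
  exact this

/-- The sum of `F` over the jumps in an interval is the limit of the sums of `F` over the
increments along finer and finer partitions. -/
theorem IsCadlag.tendsto_sum_gridIncr (hζ : IsCadlag ζ) {F : ℚ_[p] → ℚ_[p]} (hF : IsShort F)
    (u h : ℝ≥0) :
    Tendsto (fun n => ∑ i ∈ Finset.range n, F (gridIncr ζ u h n i)) atTop
      (𝓝 (cumSum (fun s => F (jump ζ s)) (u + h) - cumSum (fun s => F (jump ζ s)) u)) := by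
  rw [Metric.tendsto_atTop']
  intro ε hε
  obtain ⟨δ, hδ, H⟩ := hζ.exists_uniform hF (u + h) (half_pos hε)
  obtain ⟨N, hN⟩ := exists_nat_gt (h / δ : ℝ)
  refine ⟨N, fun n hn => ?_⟩
  have hn0 : n ≠ 0 := by omega
  have hn' : (0 : ℝ) < n := by exact_mod_cast Nat.pos_of_ne_zero hn0
  rw [← sum_gridIncr (cumSum fun s => F (jump ζ s)) u h hn0, dist_eq_norm, ← Finset.sum_sub_distrib]
  refine (IsUltrametricDist.norm_sum_le_of_forall_le_of_nonneg (half_pos hε).le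
    fun i hi => ?_).trans_lt (half_lt_self hε)
  refine H _ _ (grid_mono u h n (Nat.le_succ i)) (grid_le u h (Finset.mem_range.1 hi)) ?_
  rw [grid_succ]
  push_cast
  have h1 : (h / δ : ℝ) < n := hN.trans (by exact_mod_cast hn)
  rw [div_lt_iff₀ hδ] at h1
  rw [add_sub_cancel_left, div_lt_iff₀ hn']
  linarith

/-- `ℚ_p` is totally disconnected, so a càdlàg path moves only by its jumps. -/
theorem IsCadlag.sub_eq_cumSum_sub (hζ : IsCadlag ζ) {u v : ℝ≥0} (huv : u ≤ v) :
    ζ v - ζ u = cumSum (jump ζ) v - cumSum (jump ζ) u := by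
  obtain ⟨h, rfl⟩ := exists_add_of_le huv
  refine tendsto_nhds_unique ?_ (hζ.tendsto_sum_gridIncr isShort_id u h)
  refine tendsto_const_nhds.congr' ?_
  filter_upwards [eventually_ne_atTop 0] with n hn
  exact (sum_gridIncr ζ u h hn).symm

/-! ### The truncated path as a sum over jumps -/

open scoped Classical in
theorem jumpMeasure_singleton (ζ : ℝ≥0 → ℚ_[p]) (x : ℝ≥0 × ℚ_[p]) :
    jumpMeasure ζ {x} = if jump ζ x.1 = x.2 ∧ x.2 ≠ 0 then 1 else 0 := by
  rw [jumpMeasure, Measure.sum_apply _ (measurableSet_singleton x)]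
  simp_rw [Measure.dirac_apply' _ (measurableSet_singleton x)]
  split_ifs with h
  · rw [tsum_eq_single ⟨x.1, by rw [h.1]; exact h.2⟩]
    · simp [h.1]
    · intro s hs
      refine Set.indicator_of_notMem ?_ _
      rintro rfl
      exact hs rfl
  · refine ENNReal.tsum_eq_zero.2 fun s => Set.indicator_of_notMem ?_ _
    rintro rfl
    exact h ⟨rfl, s.2⟩

theorem atomTerm_graph (ζ : ℝ≥0 → ℚ_[p]) {F : ℚ_[p] → ℚ_[p]} (hF : F 0 = 0) (t s : ℝ≥0) :
    atomTerm (jumpMeasure ζ) F t (s, jump ζ s) =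
      (Set.Iic t).indicator (fun s => F (jump ζ s)) s := by
  rw [atomTerm, measureReal_def, jumpMeasure_singleton]
  by_cases h : jump ζ s = 0
  · simp [h, hF, Set.indicator]
  · simp [h, Set.indicator]

theorem atomTerm_eq_zero (ζ : ℝ≥0 → ℚ_[p]) (F : ℚ_[p] → ℚ_[p]) (t : ℝ≥0) {x : ℝ≥0 × ℚ_[p]}
    (hx : x ∉ Set.range fun s => (s, jump ζ s)) : atomTerm (jumpMeasure ζ) F t x = 0 := by
  have : jump ζ x.1 ≠ x.2 := fun h => hx ⟨x.1, Prod.ext rfl h⟩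
  rw [atomTerm, measureReal_def, jumpMeasure_singleton]
  simp [this]

theorem graph_injective (ζ : ℝ≥0 → ℚ_[p]) : Function.Injective fun s => (s, jump ζ s) :=
  fun _ _ h => congrArg Prod.fst h

theorem IsCadlag.jumpIntegrable (hζ : IsCadlag ζ) {F : ℚ_[p] → ℚ_[p]} (hF : IsShort F) (t : ℝ≥0) :
    JumpIntegrable (jumpMeasure ζ) F t := by
  rw [JumpIntegrable, ← (graph_injective ζ).summable_iff fun x hx => atomTerm_eq_zero ζ F t hx]
  convert (hζ.sparse_comp_jump hF).summable (subset_refl (Set.Iic t)) using 1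
  ext s
  exact atomTerm_graph ζ hF.zero t s

theorem jumpIntegral_eq_cumSum (ζ : ℝ≥0 → ℚ_[p]) {F : ℚ_[p] → ℚ_[p]} (hF : IsShort F) (t : ℝ≥0) :
    jumpIntegral (jumpMeasure ζ) F t = cumSum (fun s => F (jump ζ s)) t := by
  rw [jumpIntegral, cumSum, ← (graph_injective ζ).tsum_eq]
  · congr 1
    ext s
    exact atomTerm_graph ζ hF.zero t s
  · intro x hx
    by_contra h
    exact hx (atomTerm_eq_zero ζ F t h)

end Pathwise

/-! ### Rate sequences and ball masses -/

section Rates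

theorem SummableSmallMoment.trunc {p : ℕ} {γ : ℝ} {a : ℤ → ℝ}
    (ha : SummableSmallMoment p γ a) (M : ℤ) :
    SummableMoment p γ (truncSeq a M) := by
  apply Summable.of_nat_of_neg
  · refine summable_of_ne_finset_zero (s := Finset.range M.toNat) fun n hn => ?_
    have : ¬ (n : ℤ) < M := by simp at hn; omega
    simp [truncSeq, this]
  · rw [← summable_nat_add_iff (-M).toNat.succ]
    refine ((summable_nat_add_iff (-M).toNat.succ).2 ha).congr fun n => ?_
    have : -((n + (-M).toNat.succ : ℕ) : ℤ) < M := by push_cast; omega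
    rw [truncSeq, if_pos this]
    push_cast
    ring_nf

variable {p : ℕ} [hp : Fact p.Prime] {a : ℤ → ℝ}

theorem one_lt_prime : (1 : ℝ) < p := by exact_mod_cast hp.out.one_lt

theorem prime_pos : (0 : ℝ) < p := one_pos.trans one_lt_prime

theorem inv_prime_lt_one : ((p : ℝ)⁻¹) < 1 := inv_lt_one_of_one_lt₀ one_lt_prime

theorem inv_prime_nonneg : (0 : ℝ) ≤ (p : ℝ)⁻¹ := inv_nonneg.2 prime_pos.le

theorem IsRateSequence.nonneg (ha : IsRateSequence a) (m : ℤ) : 0 ≤ a m :=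
  ha.antitone.le_of_tendsto ha.tendsto_atTop m

theorem IsRateSequence.trunc (ha : IsRateSequence a) (M : ℤ) :
    IsRateSequence (truncSeq a M) where
  antitone := by
    intro m n hmn
    unfold truncSeq
    split_ifs with h1 h2
    · exact ha.antitone hmn
    · omega
    · exact ha.nonneg m
    · exact le_rfl
  tendsto_atTop := by
    refine tendsto_const_nhds.congr' ?_
    filter_upwards [eventually_ge_atTop M] with m hm
    simp [truncSeq, hm]
  limit_atBot := by
    have h : a =ᶠ[atBot] truncSeq a M := by
      filter_upwards [eventually_lt_atBot M] with m hm
      simp [truncSeq, hm]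
    rcases ha.limit_atBot with ⟨l, hl, h'⟩ | h'
    · exact Or.inl ⟨l, hl, h'.congr' h⟩
    · exact Or.inr (h'.congr' h)

theorem isRateSequence_stableSeq {α : ℝ} (hα : 0 < α) : IsRateSequence (stableSeq p α) := by
  have hp1 : (1 : ℝ) < p := one_lt_prime
  have hc : 0 < (1 - (p : ℝ)⁻¹) / (1 - (p : ℝ) ^ (-α - 1)) := by
    apply div_pos
    · linarith [inv_prime_lt_one (p := p)]
    · linarith [Real.rpow_lt_one_of_one_lt_of_neg hp1 (show -α - 1 < 0 by linarith)]
  have hlog : 0 < Real.log p := Real.log_pos hp1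
  have hrw : ∀ m : ℤ, (p : ℝ) ^ (-(α * (m : ℝ))) = Real.exp (-(Real.log p * α * m)) := fun m => by
    rw [Real.rpow_def_of_pos (prime_pos (p := p))]; ring_nf
  refine ⟨fun m n hmn => ?_, ?_, Or.inr ?_⟩
  · refine mul_le_mul_of_nonneg_left ?_ hc.le
    refine Real.rpow_le_rpow_of_exponent_le hp1.le (neg_le_neg ?_)
    exact mul_le_mul_of_nonneg_left (by exact_mod_cast hmn) hα.le
  · unfold stableSeq
    simp_rw [hrw]
    rw [← mul_zero ((1 - (p : ℝ)⁻¹) / (1 - (p : ℝ) ^ (-α - 1)))]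
    refine (Real.tendsto_exp_neg_atTop_nhds_zero.comp ?_).const_mul _
    exact tendsto_intCast_atTop_atTop.const_mul_atTop (by positivity)
  · unfold stableSeq
    simp_rw [hrw]
    refine Tendsto.const_mul_atTop hc (Real.tendsto_exp_atTop.comp ?_)
    refine tendsto_neg_atBot_atTop.comp ?_
    exact (tendsto_intCast_atBot_iff.2 tendsto_id).const_mul_atBot (by positivity)

theorem summableSmallMoment_stableSeq {α γ : ℝ} (hαγ : α < γ) :
    SummableSmallMoment p γ (stableSeq p α) := by
  unfold SummableSmallMoment stableSeq
  simp_rw [mul_assoc]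
  refine Summable.mul_left _ ?_
  have hp1 : (1 : ℝ) < p := one_lt_prime
  refine (summable_geometric_of_lt_one (r := (p : ℝ) ^ (α - γ)) (by positivity)
    (Real.rpow_lt_one_of_one_lt_of_neg hp1 (by linarith))).congr fun n => ?_
  rw [← Real.rpow_natCast, ← Real.rpow_mul (prime_pos (p := p)).le,
    ← Real.rpow_add (prime_pos (p := p))]
  congr 1
  push_cast
  ring

/-- The value on `‖ξ‖ = p^{-k}` of the characteristic exponent of the process determined by `a`. -/
def rateExp (p : ℕ) (a : ℤ → ℝ) (k : ℤ) : ℝ := ((p : ℝ) * a k - a (k + 1)) / ((p : ℝ) - 1)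

theorem summable_geom_mul {H : ℤ → ℝ} {m : ℤ} {C : ℝ} (hH : ∀ k, m ≤ k → |H k| ≤ C) :
    Summable fun i : ℕ => ((p : ℝ)⁻¹) ^ i * H (m + i) := by
  refine Summable.of_norm_bounded
    ((summable_geometric_of_lt_one (inv_prime_nonneg (p := p)) inv_prime_lt_one).mul_right C)
    fun i => ?_
  rw [norm_mul, norm_pow, Real.norm_of_nonneg inv_prime_nonneg]
  exact mul_le_mul_of_nonneg_left (hH _ (by omega)) (pow_nonneg inv_prime_nonneg i)

theorem inv_geom_identity : (1 - (p : ℝ)⁻¹) * ∑' i : ℕ, ((p : ℝ)⁻¹) ^ i = 1 := by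
  rw [tsum_geometric_of_lt_one inv_prime_nonneg inv_prime_lt_one]
  exact mul_inv_cancel₀ (by linarith [inv_prime_lt_one (p := p)])

/-- A bounded function of the radius is recovered from its spherical transform
`k ↦ (p H(k) - H(k+1)) / (p - 1)` by a telescoping geometric sum. -/
theorem geom_sum_transform {H : ℤ → ℝ} {m : ℤ} {C : ℝ} (hH : ∀ k, m ≤ k → |H k| ≤ C) :
    (1 - (p : ℝ)⁻¹) * ∑' i : ℕ, ((p : ℝ)⁻¹) ^ i * rateExp p H (m + i) = H m := by
  have hp1 : (p : ℝ) - 1 ≠ 0 := by linarith [one_lt_prime (p := p)]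
  have hp0 : (p : ℝ) ≠ 0 := prime_pos.ne'
  have hs := summable_geom_mul (p := p) hH
  have hs1 := (summable_nat_add_iff 1).2 hs
  have h := hs.tsum_eq_zero_add
  rw [← tsum_mul_left]
  have : ∀ i : ℕ, (1 - (p : ℝ)⁻¹) * (((p : ℝ)⁻¹) ^ i * rateExp p H (m + i)) =
      ((p : ℝ)⁻¹) ^ i * H (m + i) - ((p : ℝ)⁻¹) ^ (i + 1) * H (m + (i + 1 : ℕ)) := fun i => by
    rw [rateExp, pow_succ]
    push_cast
    rw [← add_assoc]
    field_simp
  simp_rw [this]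
  rw [hs.tsum_sub hs1, h]
  simp

theorem IsRateSequence.abs_le (ha : IsRateSequence a) {m k : ℤ} (hk : m ≤ k) : |a k| ≤ a m := by
  rw [abs_of_nonneg (ha.nonneg k)]; exact ha.antitone hk

theorem IsRateSequence.rateExp_nonneg (ha : IsRateSequence a) (k : ℤ) : 0 ≤ rateExp p a k := by
  have hp1 : (1 : ℝ) < p := one_lt_prime
  refine div_nonneg ?_ (by linarith)
  have := ha.antitone (show k ≤ k + 1 by omega)
  nlinarith [ha.nonneg k]

theorem IsRateSequence.rateExp_le (ha : IsRateSequence a) {m k : ℤ} (hk : m ≤ k) :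
    rateExp p a k ≤ p * a m / (p - 1) := by
  have hp1 : (1 : ℝ) < p := one_lt_prime
  refine div_le_div_of_nonneg_right ?_ (by linarith)
  have := ha.antitone hk
  nlinarith [ha.nonneg (k + 1)]

theorem IsRateSequence.abs_exp_le (ha : IsRateSequence a) {t : ℝ} (ht : 0 ≤ t) (k : ℤ) :
    |Real.exp (-t * rateExp p a k)| ≤ 1 := by
  rw [Real.abs_exp, Real.exp_le_one_iff]
  nlinarith [ha.rateExp_nonneg (p := p) k]

theorem IsRateSequence.centeredBallMass_transform (ha : IsRateSequence a) {t : ℝ} (ht : 0 ≤ t)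
    (k : ℤ) :
    rateExp p (centeredBallMass p a t) k = Real.exp (-t * rateExp p a k) := by
  have hp1 : (p : ℝ) - 1 ≠ 0 := by linarith [one_lt_prime (p := p)]
  have hp0 : (p : ℝ) ≠ 0 := prime_pos.ne'
  have hs := summable_geom_mul (p := p) (H := fun k => Real.exp (-t * rateExp p a k)) (m := k)
    fun j _ => ha.abs_exp_le ht j
  have h : centeredBallMass p a t k = (1 - (p : ℝ)⁻¹) * Real.exp (-t * rateExp p a k) +
      (p : ℝ)⁻¹ * centeredBallMass p a t (k + 1) := by
    have h1 := hs.tsum_eq_zero_add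
    have h2 : centeredBallMass p a t k =
        (1 - (p : ℝ)⁻¹) * ∑' i : ℕ, ((p : ℝ)⁻¹) ^ i * Real.exp (-t * rateExp p a (k + i)) := rfl
    have h3 : centeredBallMass p a t (k + 1) = (1 - (p : ℝ)⁻¹) *
        ∑' i : ℕ, ((p : ℝ)⁻¹) ^ i * Real.exp (-t * rateExp p a (k + 1 + i)) := rfl
    rw [h2, h1, h3, mul_left_comm, ← tsum_mul_left (a := (p : ℝ)⁻¹)]
    simp only [pow_zero, one_mul, Nat.cast_zero, add_zero]
    rw [mul_add]
    congr 3
    ext i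
    rw [pow_succ, Nat.cast_succ, show k + ((i : ℤ) + 1) = k + 1 + i by ring]
    ring
  rw [rateExp, h]
  field_simp
  ring

theorem IsRateSequence.one_sub_centeredBallMass (ha : IsRateSequence a) {t : ℝ} (ht : 0 ≤ t)
    (m : ℤ) : 1 - centeredBallMass p a t m = (1 - (p : ℝ)⁻¹) *
      ∑' i : ℕ, (((p : ℝ)⁻¹) ^ i - ((p : ℝ)⁻¹) ^ i * Real.exp (-t * rateExp p a (m + i))) := by
  have hs := summable_geom_mul (p := p) (H := fun k => Real.exp (-t * rateExp p a k)) (m := m)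
    fun j _ => ha.abs_exp_le ht j
  have hg := summable_geometric_of_lt_one (inv_prime_nonneg (p := p)) inv_prime_lt_one
  rw [hg.tsum_sub hs, mul_sub, inv_geom_identity]
  rfl

/-- An upper bound for the escape probability `1 - μ_t(‖z‖ ≤ p^m)`, from `1 - e^{-x} ≤ x`. -/
theorem IsRateSequence.one_sub_centeredBallMass_le (ha : IsRateSequence a) {t : ℝ} (ht : 0 ≤ t)
    (m : ℤ) :
    1 - centeredBallMass p a t m ≤ t * a m := by
  have hb : ∀ k, m ≤ k → |rateExp p a k| ≤ p * a m / (p - 1) := fun k hk => by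
    rw [abs_of_nonneg (ha.rateExp_nonneg k)]; exact ha.rateExp_le hk
  have hs := summable_geom_mul (p := p) (H := fun k => Real.exp (-t * rateExp p a k)) (m := m)
    fun j _ => ha.abs_exp_le ht j
  have hs' := summable_geom_mul (p := p) hb
  rw [← geom_sum_transform (p := p) (H := a) (m := m) fun k hk => ha.abs_le hk,
    ha.one_sub_centeredBallMass ht, mul_left_comm, ← tsum_mul_left (a := t)]
  have hg := summable_geometric_of_lt_one (inv_prime_nonneg (p := p)) inv_prime_lt_one
  refine mul_le_mul_of_nonneg_left ?_ (by linarith [inv_prime_lt_one (p := p)])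
  refine (hg.sub hs).tsum_le_tsum (fun i => ?_) (hs'.mul_left t)
  have h1 := Real.add_one_le_exp (-t * rateExp p a (m + i))
  have h2 := pow_nonneg (inv_prime_nonneg (p := p)) i
  nlinarith

/-- A lower bound for the escape probability, from `x / (1 + x) ≤ 1 - e^{-x}`. -/
theorem IsRateSequence.le_one_sub_centeredBallMass (ha : IsRateSequence a) {t : ℝ} (ht : 0 ≤ t)
    (m : ℤ) :
    t * a m / (1 + t * (p * a m / (p - 1))) ≤ 1 - centeredBallMass p a t m := by
  have hb : ∀ k, m ≤ k → |rateExp p a k| ≤ p * a m / (p - 1) := fun k hk => by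
    rw [abs_of_nonneg (ha.rateExp_nonneg k)]; exact ha.rateExp_le hk
  have hs := summable_geom_mul (p := p) (H := fun k => Real.exp (-t * rateExp p a k)) (m := m)
    fun j _ => ha.abs_exp_le ht j
  have hs' := summable_geom_mul (p := p) hb
  set B := p * a m / (p - 1) with hB
  rw [mul_comm, mul_div_assoc,
    ← geom_sum_transform (p := p) (H := a) (m := m) fun k hk => ha.abs_le hk,
    ha.one_sub_centeredBallMass ht, mul_assoc, ← tsum_mul_right]
  have hg := summable_geometric_of_lt_one (inv_prime_nonneg (p := p)) inv_prime_lt_one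
  refine mul_le_mul_of_nonneg_left ?_ (by linarith [inv_prime_lt_one (p := p)])
  refine (hs'.mul_right _).tsum_le_tsum (fun i => ?_) (hg.sub hs)
  rw [mul_assoc, ← mul_one_sub]
  refine mul_le_mul_of_nonneg_left ?_ (pow_nonneg inv_prime_nonneg i)
  set x := rateExp p a (m + i)
  have hx0 : 0 ≤ x := ha.rateExp_nonneg _
  have hxB : x ≤ B := ha.rateExp_le (by omega)
  have h1 := Real.add_one_le_exp (t * x)
  have h2 : Real.exp (-t * x) = (Real.exp (t * x))⁻¹ := by rw [neg_mul, Real.exp_neg]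
  have htx : 0 ≤ t * x := mul_nonneg ht hx0
  have h3 : Real.exp (-t * x) ≤ (1 + t * x)⁻¹ := by
    rw [h2]; exact inv_anti₀ (by linarith) (by linarith)
  have h4 : x * (t / (1 + t * B)) ≤ 1 - (1 + t * x)⁻¹ := by
    rw [show 1 - (1 + t * x)⁻¹ = x * (t / (1 + t * x)) by field_simp; ring]
    refine mul_le_mul_of_nonneg_left ?_ hx0
    exact div_le_div_of_nonneg_left ht (by linarith)
      (by linarith [mul_le_mul_of_nonneg_left hxB ht])
  linarith

theorem IsRateSequence.exp_le_centeredBallMass (ha : IsRateSequence a) {t : ℝ} (ht : 0 ≤ t)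
    (m : ℤ) :
    Real.exp (-t * (p * a m / (p - 1))) ≤ centeredBallMass p a t m := by
  have hs := summable_geom_mul (p := p) (H := fun k => Real.exp (-t * rateExp p a k)) (m := m)
    fun j _ => ha.abs_exp_le ht j
  have hg := summable_geometric_of_lt_one (inv_prime_nonneg (p := p)) inv_prime_lt_one
  set B := p * a m / (p - 1)
  rw [← one_mul (Real.exp _), show (1 : ℝ) * Real.exp (-t * B) =
    (1 - (p : ℝ)⁻¹) * (∑' i : ℕ, ((p : ℝ)⁻¹) ^ i) * Real.exp (-t * B) by rw [inv_geom_identity],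
    mul_assoc, ← tsum_mul_right]
  refine mul_le_mul_of_nonneg_left ?_ (by linarith [inv_prime_lt_one (p := p)])
  refine (hg.mul_right _).tsum_le_tsum (fun i => ?_) hs
  refine mul_le_mul_of_nonneg_left (Real.exp_le_exp.2 ?_) (pow_nonneg inv_prime_nonneg i)
  have := ha.rateExp_le (p := p) (show m ≤ m + i by omega)
  change _ ≤ -t * rateExp p a (m + i)
  nlinarith

/-- The rate of leaving a ball of radius `p^m` is `a(m)`. -/
theorem IsRateSequence.tendsto_mul_one_sub_centeredBallMass (ha : IsRateSequence a) {t : ℝ}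
    (ht : 0 ≤ t) (m : ℤ) :
    Tendsto (fun n : ℕ => n * (1 - centeredBallMass p a (t / n) m)) atTop (𝓝 (t * a m)) := by
  have h0 : Tendsto (fun n : ℕ => t * a m / (1 + t / n * (p * a m / (p - 1)))) atTop
      (𝓝 (t * a m / (1 + 0 * (p * a m / (p - 1))))) := by
    refine tendsto_const_nhds.div (tendsto_const_nhds.add
      ((tendsto_const_div_atTop_nhds_zero_nat t).mul_const _)) (by simp)
  rw [zero_mul, add_zero, div_one] at h0
  refine tendsto_of_tendsto_of_tendsto_of_le_of_le' h0 tendsto_const_nhds ?_ ?_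
  · filter_upwards [eventually_gt_atTop 0] with n hn
    have hn' : (0 : ℝ) < n := by exact_mod_cast hn
    have := mul_le_mul_of_nonneg_left
      (ha.le_one_sub_centeredBallMass (p := p) (t := t / n) (by positivity) m) hn'.le
    refine le_trans (le_of_eq ?_) this
    generalize 1 + t / n * (p * a m / (p - 1)) = X
    rw [← mul_div_assoc, ← mul_assoc, mul_div_cancel₀ _ hn'.ne']
  · filter_upwards [eventually_gt_atTop 0] with n hn
    have hn' : (0 : ℝ) < n := by exact_mod_cast hn
    have := mul_le_mul_of_nonneg_left
      (ha.one_sub_centeredBallMass_le (p := p) (t := t / n) (by positivity) m) hn'.le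
    refine this.trans (le_of_eq ?_)
    rw [← mul_assoc, mul_div_cancel₀ _ hn'.ne']

end Rates

/-! ### The truncation map -/

section Trunc

variable {p : ℕ} [hp : Fact p.Prime]

theorem norm_prime_pow (n : ℕ) : ‖(p : ℚ_[p]) ^ n‖ = (p : ℝ) ^ (-(n : ℤ)) := by
  rw [norm_pow, Padic.norm_p, zpow_neg, zpow_natCast, inv_pow]

theorem truncFun_eq_self {M : ℤ} {z : ℚ_[p]} (hz : ‖z‖ ≤ (p : ℝ) ^ M) : truncFun p M z = z := by
  rcases eq_or_ne z 0 with rfl | h0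
  · simp [truncFun]
  · rw [Padic.norm_eq_zpow_neg_valuation h0, zpow_le_zpow_iff_right₀ one_lt_prime] at hz
    rw [truncFun, show (-z.valuation - M).toNat = 0 by omega, pow_zero, one_mul]

theorem norm_truncFun {M : ℤ} {z : ℚ_[p]} (hz : (p : ℝ) ^ M ≤ ‖z‖) :
    ‖truncFun p M z‖ = (p : ℝ) ^ M := by
  have h0 : z ≠ 0 := by
    rintro rfl
    rw [norm_zero] at hz
    exact absurd hz (not_le.2 (zpow_pos prime_pos _))
  rw [Padic.norm_eq_zpow_neg_valuation h0, zpow_le_zpow_iff_right₀ one_lt_prime] at hz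
  rw [truncFun, norm_mul, norm_prime_pow, Padic.norm_eq_zpow_neg_valuation h0,
    ← zpow_add₀ prime_pos.ne']
  congr 1
  omega

theorem norm_truncFun_le_self (M : ℤ) (z : ℚ_[p]) : ‖truncFun p M z‖ ≤ ‖z‖ := by
  rcases le_total ‖z‖ ((p : ℝ) ^ M) with h | h
  · rw [truncFun_eq_self h]
  · rw [norm_truncFun h]; exact h

theorem norm_truncFun_le_iff (M k : ℤ) (z : ℚ_[p]) :
    ‖truncFun p M z‖ ≤ (p : ℝ) ^ k ↔ ‖z‖ ≤ (p : ℝ) ^ k ∨ M ≤ k := by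
  have hp1 : (1 : ℝ) < p := one_lt_prime
  rcases le_total ‖z‖ ((p : ℝ) ^ M) with h | h
  · rw [truncFun_eq_self h]
    refine ⟨Or.inl, fun h' => h'.elim id fun h' => h.trans (zpow_le_zpow_right₀ hp1.le h')⟩
  · rw [norm_truncFun h, zpow_le_zpow_iff_right₀ hp1]
    refine ⟨Or.inr, fun h' => h'.elim (fun h' => ?_) id⟩
    exact (zpow_le_zpow_iff_right₀ hp1).1 (h.trans h')

theorem valuation_eq_of_norm_eq {x y : ℚ_[p]} (hx : x ≠ 0) (h : ‖x‖ = ‖y‖) :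
    x.valuation = y.valuation := by
  have hy : y ≠ 0 := by rw [← norm_pos_iff, ← h]; exact norm_pos_iff.2 hx
  rw [Padic.norm_eq_zpow_neg_valuation hx, Padic.norm_eq_zpow_neg_valuation hy] at h
  have := zpow_right_injective₀ prime_pos one_lt_prime.ne' h
  omega

theorem truncFun_mul (M : ℤ) {u : ℚ_[p]} (hu : ‖u‖ = 1) (z : ℚ_[p]) :
    truncFun p M (u * z) = u * truncFun p M z := by
  rcases eq_or_ne z 0 with rfl | h0
  · simp [truncFun]
  · rw [truncFun, truncFun, valuation_eq_of_norm_eq h0 (y := u * z) (by simp [hu])]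
    ring

theorem isShort_truncFun (M : ℤ) : IsShort (truncFun p M) where
  zero := by simp [truncFun]
  norm_sub_le x y := by
    rcases lt_or_ge ‖x - y‖ ‖x‖ with h | h
    · have hxy : ‖x‖ = ‖y‖ := by
        have h1 : ‖-(x - y)‖ ≠ ‖x‖ := by rw [norm_neg]; exact h.ne
        have h2 := IsUltrametricDist.norm_add_eq_max_of_norm_ne_norm h1
        rw [norm_neg, max_eq_right h.le] at h2
        rw [← h2]
        congr 1
        ring
      have h0 : x ≠ 0 := by
        rintro rfl
        rw [norm_zero] at h
        exact absurd h (not_lt.2 (norm_nonneg _))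
      rw [truncFun, truncFun, valuation_eq_of_norm_eq h0 hxy, ← mul_sub, norm_mul, norm_prime_pow]
      refine mul_le_of_le_one_left (norm_nonneg _) ?_
      rw [zpow_neg, zpow_natCast]
      exact inv_le_one_of_one_le₀ (one_le_pow₀ one_lt_prime.le)
    · have hy : ‖y‖ ≤ ‖x - y‖ := by
        have := norm_sub_le_max x (x - y)
        rw [sub_sub_cancel, max_eq_right h] at this
        exact this
      exact (norm_sub_le_max _ _).trans (max_le ((norm_truncFun_le_self M x).trans h)
        ((norm_truncFun_le_self M y).trans hy))

end Trunc

/-! ### Rotation invariant probabilities on `ℚ_p` and their spherical transform -/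

section RotationInvariant

variable {p : ℕ} [hp : Fact p.Prime]

theorem borel_eq_generateFrom_closedBall :
    (inferInstance : MeasurableSpace ℚ_[p]) = MeasurableSpace.generateFrom
      {S | ∃ (x : ℚ_[p]) (m : ℤ), S = Metric.closedBall x ((p : ℝ) ^ m)} := by
  refine TopologicalSpace.IsTopologicalBasis.borel_eq_generateFrom
    (TopologicalSpace.isTopologicalBasis_of_isOpen_of_nhds ?_ ?_)
  · rintro _ ⟨x, m, rfl⟩
    exact IsUltrametricDist.isOpen_closedBall x (zpow_pos prime_pos m).ne'
  · intro x U hx hU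
    obtain ⟨ε, hε, h⟩ := Metric.isOpen_iff.1 hU x hx
    obtain ⟨n, hn⟩ := exists_pow_lt_of_lt_one hε (inv_prime_lt_one (p := p))
    refine ⟨_, ⟨x, -(n : ℤ), rfl⟩, Metric.mem_closedBall_self (zpow_pos prime_pos _).le, ?_⟩
    refine (Metric.closedBall_subset_ball ?_).trans h
    rwa [zpow_neg, zpow_natCast, ← inv_pow]

theorem isPiSystem_closedBall :
    IsPiSystem {S | ∃ (x : ℚ_[p]) (m : ℤ), S = Metric.closedBall x ((p : ℝ) ^ m)} := by
  rintro _ ⟨x, m, rfl⟩ _ ⟨y, n, rfl⟩ hne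
  rcases IsUltrametricDist.closedBall_subset_trichotomy x y ((p : ℝ) ^ m) ((p : ℝ) ^ n) with
    h | h | h
  · exact ⟨x, m, Set.inter_eq_left.2 h⟩
  · exact ⟨y, n, Set.inter_eq_right.2 h⟩
  · exact absurd (Set.disjoint_iff_inter_eq_empty.1 h) hne.ne_empty

theorem measure_ext_of_closedBall {μ ν : Measure ℚ_[p]} [IsProbabilityMeasure μ]
    [IsProbabilityMeasure ν] (h : ∀ (x : ℚ_[p]) (m : ℤ),
      μ.real (Metric.closedBall x ((p : ℝ) ^ m)) = ν.real (Metric.closedBall x ((p : ℝ) ^ m))) :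
    μ = ν := by
  refine ext_of_generate_finite _ borel_eq_generateFrom_closedBall isPiSystem_closedBall ?_
    (by simp)
  rintro _ ⟨x, m, rfl⟩
  exact (measureReal_eq_measureReal_iff).1 (h x m)

/-- Invariance under multiplication by the units of `ℤ_p`. -/
def RotInvariant (μ : Measure ℚ_[p]) : Prop :=
  ∀ u : ℚ_[p], ‖u‖ = 1 → μ.map (fun x => u * x) = μ

theorem preimage_mul_closedBall {u : ℚ_[p]} (hu : ‖u‖ = 1) (x : ℚ_[p]) (r : ℝ) :
    (fun y => u * y) ⁻¹' Metric.closedBall x r = Metric.closedBall (u⁻¹ * x) r := by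
  have hu0 : u ≠ 0 := by rintro rfl; simp at hu
  ext y
  simp only [Set.mem_preimage, Metric.mem_closedBall, dist_eq_norm]
  rw [show u * y - x = u * (y - u⁻¹ * x) by field_simp, norm_mul, hu, one_mul]

theorem rotInvariant_of_closedBall {μ : Measure ℚ_[p]} [IsProbabilityMeasure μ]
    (h : ∀ (x y : ℚ_[p]) (m : ℤ), ‖x‖ = ‖y‖ →
      μ.real (Metric.closedBall x ((p : ℝ) ^ m)) = μ.real (Metric.closedBall y ((p : ℝ) ^ m))) :
    RotInvariant μ := by
  intro u hu
  have hm : Measurable fun x : ℚ_[p] => u * x := (continuous_const_mul u).measurable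
  have := Measure.isProbabilityMeasure_map (μ := μ) hm.aemeasurable
  refine measure_ext_of_closedBall fun x m => ?_
  rw [map_measureReal_apply hm measurableSet_closedBall, preimage_mul_closedBall hu]
  exact h _ _ _ (by simp [hu])

theorem RotInvariant.closedBall_eq {μ : Measure ℚ_[p]} (hμ : RotInvariant μ) {x y : ℚ_[p]}
    (hxy : ‖x‖ = ‖y‖) (r : ℝ) :
    μ.real (Metric.closedBall x r) = μ.real (Metric.closedBall y r) := by
  rcases eq_or_ne y 0 with rfl | hy
  · rw [norm_zero, norm_eq_zero] at hxy; rw [hxy]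
  have hx : x ≠ 0 := by rw [← norm_pos_iff, hxy]; exact norm_pos_iff.2 hy
  have hu : ‖x / y‖ = 1 := by rw [norm_div, hxy, div_self (norm_ne_zero_iff.2 hy)]
  have hm : Measurable fun z : ℚ_[p] => x / y * z := (continuous_const_mul _).measurable
  conv_lhs => rw [← hμ _ hu]
  rw [map_measureReal_apply hm measurableSet_closedBall, preimage_mul_closedBall hu]
  congr 2
  field_simp

theorem RotInvariant.integral_mul {μ : Measure ℚ_[p]} (hμ : RotInvariant μ) {u : ℚ_[p]}
    (hu : ‖u‖ = 1) {f : ℚ_[p] → ℝ} (hf : Measurable f) : ∫ y, f (u * y) ∂μ = ∫ y, f y ∂μ := by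
  have hm : Measurable fun z : ℚ_[p] => u * z := (continuous_const_mul _).measurable
  conv_rhs => rw [← hμ u hu]
  rw [integral_map hm.aemeasurable hf.aestronglyMeasurable]

theorem RotInvariant.conv {μ ν : Measure ℚ_[p]} [IsProbabilityMeasure μ] [IsProbabilityMeasure ν]
    (hμ : RotInvariant μ) (hν : RotInvariant ν) : RotInvariant (μ ∗ ν) := by
  intro u hu
  have hm : Measurable (AddMonoidHom.mulLeft u) := (continuous_const_mul u).measurable
  have h := Measure.map_conv_addMonoidHom (μ := μ) (ν := ν) (AddMonoidHom.mulLeft u) hm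
  have e : ⇑(AddMonoidHom.mulLeft u) = fun x => u * x := rfl
  rw [e, hμ u hu, hν u hu] at h
  exact h

theorem norm_natCast_unit {j : ℕ} (h0 : j ≠ 0) (hj : j < p) : ‖(j : ℚ_[p])‖ = 1 :=
  Padic.norm_natCast_eq_one_iff.2 (hp.out.coprime_iff_not_dvd.2 fun h =>
    absurd (Nat.le_of_dvd (by omega) h) (by omega))

theorem existsUnique_norm_add_lt_one {z : ℚ_[p]} (hz : ‖z‖ ≤ 1) :
    ∃! j : ℕ, j < p ∧ ‖z + j‖ < 1 := by
  obtain ⟨w, hw⟩ : ∃ w : ℤ_[p], (w : ℚ_[p]) = -z := ⟨⟨-z, by simpa using hz⟩, rfl⟩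
  obtain ⟨j, ⟨hj, hjm⟩, huniq⟩ := PadicInt.existsUnique_mem_range w
  have key : ∀ n : ℕ, w - n ∈ IsLocalRing.maximalIdeal ℤ_[p] ↔ ‖z + n‖ < 1 := fun n => by
    rw [IsLocalRing.mem_maximalIdeal, PadicInt.mem_nonunits, PadicInt.norm_def, PadicInt.coe_sub,
      hw, PadicInt.coe_natCast, ← norm_neg, neg_sub, sub_neg_eq_add, add_comm]
  exact ⟨j, ⟨hj, (key j).1 hjm⟩, fun y hy => huniq y ⟨hy.1, (key y).2 hy.2⟩⟩

/-- The indicator function of the ball of radius `p^m` about `0`. -/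
def ballInd (p : ℕ) [Fact p.Prime] (m : ℤ) (x : ℚ_[p]) : ℝ := if ‖x‖ ≤ (p : ℝ) ^ m then 1 else 0

/-- A ball of radius `p^{m+1}` is the disjoint union of `p` balls of radius `p^m`. -/
theorem sum_ballInd {m : ℤ} {c : ℚ_[p]} (hc : ‖c‖ = (p : ℝ) ^ (m + 1)) (x : ℚ_[p]) :
    ∑ j ∈ Finset.range p, ballInd p m (x + j * c) = ballInd p (m + 1) x := by
  have hc0 : c ≠ 0 := by rw [← norm_pos_iff, hc]; exact zpow_pos prime_pos _
  by_cases hx : ‖x‖ ≤ (p : ℝ) ^ (m + 1)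
  · have hz : ‖x / c‖ ≤ 1 := by
      rw [norm_div, hc]; exact div_le_one_of_le₀ hx (zpow_pos prime_pos _).le
    have key : ∀ n : ℕ, ‖x + n * c‖ ≤ (p : ℝ) ^ m ↔ ‖x / c + n‖ < 1 := fun n => by
      rw [Padic.norm_le_pow_iff_norm_lt_pow_add_one, ← hc,
        show x + n * c = (x / c + n) * c by field_simp, norm_mul]
      exact mul_lt_iff_lt_one_left (norm_pos_iff.2 hc0)
    obtain ⟨j, ⟨hj, hj1⟩, huniq⟩ := existsUnique_norm_add_lt_one hz
    rw [Finset.sum_eq_single_of_mem j (Finset.mem_range.2 hj)]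
    · rw [ballInd, if_pos ((key j).2 hj1), ballInd, if_pos hx]
    · intro i hi hij
      rw [ballInd, if_neg fun h => hij (huniq i ⟨Finset.mem_range.1 hi, (key i).1 h⟩)]
  · rw [ballInd, if_neg hx]
    refine Finset.sum_eq_zero fun j _ => ?_
    rw [ballInd, if_neg]
    intro h
    apply hx
    have hjc : ‖(j : ℚ_[p]) * c‖ ≤ (p : ℝ) ^ (m + 1) := by
      rw [norm_mul, hc]
      exact mul_le_of_le_one_left (zpow_pos prime_pos _).le
        (by simpa using Padic.norm_int_le_one (p := p) (j : ℤ))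
    have := norm_sub_le_max (x + (j : ℚ_[p]) * c) (j * c)
    rw [add_sub_cancel_right] at this
    exact this.trans (max_le (h.trans (zpow_le_zpow_right₀ one_lt_prime.le (by omega))) hjc)

theorem ballInd_eq_indicator (m : ℤ) :
    ballInd p m = (Metric.closedBall (0 : ℚ_[p]) ((p : ℝ) ^ m)).indicator 1 := by
  ext x
  simp [ballInd, Set.indicator]

theorem continuous_ballInd (m : ℤ) : Continuous (ballInd p m) := by
  rw [ballInd_eq_indicator]
  refine IsClopen.continuous_indicator ⟨Metric.isClosed_closedBall, ?_⟩ continuous_one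
  exact IsUltrametricDist.isOpen_closedBall _ (zpow_pos prime_pos m).ne'

theorem measurable_ballInd (m : ℤ) : Measurable (ballInd p m) := (continuous_ballInd m).measurable

theorem abs_ballInd_le (m : ℤ) (x : ℚ_[p]) : |ballInd p m x| ≤ 1 := by
  rw [ballInd]; split_ifs <;> simp

theorem integrable_ballInd (μ : Measure ℚ_[p]) [IsFiniteMeasure μ] (m : ℤ) (x : ℚ_[p]) :
    Integrable (fun y => ballInd p m (x + y)) μ :=
  Integrable.of_bound ((measurable_ballInd m).comp (measurable_const_add x)).aestronglyMeasurable 1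
    (Eventually.of_forall fun _ => abs_ballInd_le m _)

theorem integral_ballInd (μ : Measure ℚ_[p]) [IsFiniteMeasure μ] (m : ℤ) (x : ℚ_[p]) :
    ∫ y, ballInd p m (y - x) ∂μ = μ.real (Metric.closedBall x ((p : ℝ) ^ m)) := by
  rw [← integral_indicator_one measurableSet_closedBall]
  simp [ballInd, Set.indicator, dist_eq_norm]

/-- The spherical function `x ↦ ∫ χ(ξ x) dξ`, the average being over the sphere `‖ξ‖ = p^{-k}` and
`χ` the standard character: it is `1` if `‖x‖ ≤ p^k`, `-1/(p-1)` if `‖x‖ = p^{k+1}` and `0`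
otherwise. Its integral replaces the characteristic function for rotation invariant laws. -/
def sphKernel (p : ℕ) [Fact p.Prime] (k : ℤ) (x : ℚ_[p]) : ℝ := rateExp p (fun j => ballInd p j x) k

theorem sphKernel_congr {k : ℤ} {x y : ℚ_[p]} (h : ‖x‖ = ‖y‖) :
    sphKernel p k x = sphKernel p k y := by simp [sphKernel, rateExp, ballInd, h]

theorem sphKernel_eq_one {k : ℤ} {x : ℚ_[p]} (hx : ‖x‖ ≤ (p : ℝ) ^ k) : sphKernel p k x = 1 := by
  have hp1 : (p : ℝ) - 1 ≠ 0 := by linarith [one_lt_prime (p := p)]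
  rw [sphKernel, rateExp, ballInd, ballInd, if_pos hx,
    if_pos (hx.trans (zpow_le_zpow_right₀ one_lt_prime.le (by omega))), mul_one, div_self hp1]

theorem sphKernel_eq_zero {k : ℤ} {x : ℚ_[p]} (hx : (p : ℝ) ^ (k + 1) < ‖x‖) :
    sphKernel p k x = 0 := by
  have h : (p : ℝ) ^ k < ‖x‖ := lt_of_le_of_lt (zpow_le_zpow_right₀ one_lt_prime.le (by omega)) hx
  rw [sphKernel, rateExp, ballInd, ballInd, if_neg (not_le.2 hx), if_neg (not_le.2 h)]
  simp

theorem sphKernel_sphere {k : ℤ} {x : ℚ_[p]} (hx : ‖x‖ = (p : ℝ) ^ (k + 1)) :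
    sphKernel p k x = -1 / (p - 1) := by
  have h : (p : ℝ) ^ k < ‖x‖ := by
    rw [hx]; exact (zpow_lt_zpow_iff_right₀ one_lt_prime).2 (by omega)
  rw [sphKernel, rateExp, ballInd, ballInd, if_pos hx.le, if_neg (not_le.2 h)]
  simp

theorem ballInd_add {m : ℤ} (x : ℚ_[p]) {c : ℚ_[p]} (hc : ‖c‖ ≤ (p : ℝ) ^ m) :
    ballInd p m (x + c) = ballInd p m x := by
  have : ‖x + c‖ ≤ (p : ℝ) ^ m ↔ ‖x‖ ≤ (p : ℝ) ^ m := by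
    refine ⟨fun h => ?_, fun h => (IsUltrametricDist.norm_add_le_max _ _).trans (max_le h hc)⟩
    have := norm_sub_le_max (x + c) c
    rw [add_sub_cancel_right] at this
    exact this.trans (max_le h hc)
  simp only [ballInd, this]

theorem sphKernel_add {k : ℤ} (x : ℚ_[p]) {c : ℚ_[p]} (hc : ‖c‖ ≤ (p : ℝ) ^ k) :
    sphKernel p k (x + c) = sphKernel p k x := by
  rw [sphKernel, sphKernel, rateExp, rateExp, ballInd_add x hc,
    ballInd_add x (hc.trans (zpow_le_zpow_right₀ one_lt_prime.le (by omega)))]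

theorem sum_sphKernel {k : ℤ} {c : ℚ_[p]} (hc : ‖c‖ = (p : ℝ) ^ (k + 1)) (x : ℚ_[p]) :
    ∑ j ∈ Finset.range p, sphKernel p k (x + j * c) = 0 := by
  have h : ∀ j : ℕ, ballInd p (k + 1) (x + j * c) = ballInd p (k + 1) x := fun j => by
    refine ballInd_add x ?_
    rw [norm_mul, hc]
    exact mul_le_of_le_one_left (zpow_pos prime_pos _).le
      (by simpa using Padic.norm_int_le_one (p := p) (j : ℤ))
  simp only [sphKernel, rateExp, h]
  rw [← Finset.sum_div, Finset.sum_sub_distrib, ← Finset.mul_sum, sum_ballInd hc]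
  simp

theorem continuous_sphKernel (k : ℤ) : Continuous (sphKernel p k) :=
  ((continuous_const.mul (continuous_ballInd k)).sub (continuous_ballInd (k + 1))).div_const _

theorem measurable_sphKernel (k : ℤ) : Measurable (sphKernel p k) :=
  (continuous_sphKernel k).measurable

theorem abs_sphKernel_le (k : ℤ) (x : ℚ_[p]) : |sphKernel p k x| ≤ (p + 1) / (p - 1) := by
  have hp1 : (0 : ℝ) < p - 1 := by linarith [one_lt_prime (p := p)]
  rw [sphKernel, rateExp, abs_div, abs_of_pos hp1]
  refine div_le_div_of_nonneg_right ((abs_sub _ _).trans ?_) hp1.le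
  rw [abs_mul, Nat.abs_cast]
  exact add_le_add (mul_le_of_le_one_right (Nat.cast_nonneg _) (abs_ballInd_le _ _))
    (abs_ballInd_le _ _)

theorem integrable_sphKernel (μ : Measure ℚ_[p]) [IsFiniteMeasure μ] (k : ℤ) (x : ℚ_[p]) :
    Integrable (fun y => sphKernel p k (x + y)) μ :=
  (((integrable_ballInd μ k x).const_mul _).sub (integrable_ballInd μ (k + 1) x)).div_const _

/-- The spherical transform of a probability `μ`: the integral of the spherical function. For
rotation invariant `μ` it is the value of the characteristic function on the sphere `‖ξ‖ = p^{-k}`. -/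
def sphTransform (μ : Measure ℚ_[p]) (k : ℤ) : ℝ := ∫ y, sphKernel p k y ∂μ

theorem sphTransform_eq (μ : Measure ℚ_[p]) [IsFiniteMeasure μ] (k : ℤ) :
    sphTransform μ k = rateExp p (fun j => μ.real (Metric.closedBall 0 ((p : ℝ) ^ j))) k := by
  have h : ∀ m, Integrable (fun y => ballInd p m y) μ := fun m => by
    simpa using integrable_ballInd μ m 0
  have h' : ∀ m, ∫ y, ballInd p m y ∂μ = μ.real (Metric.closedBall 0 ((p : ℝ) ^ m)) := fun m => by
    simpa using integral_ballInd μ m 0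
  simp only [sphTransform, sphKernel, rateExp]
  rw [integral_div, integral_sub ((h k).const_mul _) (h (k + 1)), integral_const_mul, h', h']

/-- The averaging property of the spherical functions. For `‖x‖ ≥ p^{k+1}`, rotation invariance
makes the integral the same for all the translates of `x` occurring in `sum_sphKernel`. -/
theorem RotInvariant.integral_sphKernel_add {μ : Measure ℚ_[p]} [IsProbabilityMeasure μ]
    (hμ : RotInvariant μ) (k : ℤ) (x : ℚ_[p]) :
    ∫ y, sphKernel p k (x + y) ∂μ = sphKernel p k x * sphTransform μ k := by
  have hp1 : (p : ℝ) - 1 ≠ 0 := by linarith [one_lt_prime (p := p)]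
  have hmeas : ∀ x : ℚ_[p], Measurable fun y => sphKernel p k (x + y) := fun x =>
    (measurable_sphKernel k).comp (measurable_const_add x)
  rcases lt_trichotomy ‖x‖ ((p : ℝ) ^ (k + 1)) with hx | hx | hx
  · have hx' := (Padic.norm_le_pow_iff_norm_lt_pow_add_one x k).2 hx
    rw [sphKernel_eq_one hx', one_mul, sphTransform]
    congr 1
    ext y
    rw [add_comm, sphKernel_add y hx']
  · have h1 : ∑ j ∈ Finset.range p, ∫ y, sphKernel p k (j * x + y) ∂μ = 0 := by
      rw [← integral_finsetSum _ fun j _ => integrable_sphKernel μ k _]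
      simp_rw [add_comm _ (_ : ℚ_[p]), sum_sphKernel hx]
      simp
    have h2 : ∀ j ∈ Finset.range (p - 1), ∫ y, sphKernel p k ((j + 1 : ℕ) * x + y) ∂μ =
        ∫ y, sphKernel p k (x + y) ∂μ := fun j hj => by
      have hj' : ‖((j + 1 : ℕ) : ℚ_[p])‖ = 1 :=
        norm_natCast_unit (Nat.succ_ne_zero j) (by have := Finset.mem_range.1 hj; omega)
      rw [← hμ.integral_mul hj' (hmeas _)]
      congr 1
      ext y
      rw [← mul_add]
      exact sphKernel_congr (by rw [norm_mul, hj', one_mul])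
    rw [show Finset.range p = Finset.range (p - 1 + 1) by rw [Nat.sub_add_cancel hp.out.one_le],
      Finset.sum_range_succ', Finset.sum_congr rfl h2, Finset.sum_const, Finset.card_range,
      nsmul_eq_mul, Nat.cast_sub hp.out.one_le, Nat.cast_one, Nat.cast_zero] at h1
    simp only [zero_mul, zero_add] at h1
    rw [sphKernel_sphere hx, sphTransform]
    field_simp
    linarith
  · rw [sphKernel_eq_zero hx, zero_mul]
    obtain ⟨c, hc⟩ : ∃ c : ℚ_[p], ‖c‖ = (p : ℝ) ^ (k + 1) :=
      ⟨(p : ℚ_[p]) ^ (-(k + 1)), by rw [Padic.norm_p_zpow, neg_neg]⟩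
    have hx0 : x ≠ 0 := by
      rw [← norm_pos_iff]; exact (zpow_pos prime_pos _).trans hx
    have h1 : ∑ j ∈ Finset.range p, ∫ y, sphKernel p k ((x + j * c) + y) ∂μ = 0 := by
      rw [← integral_finsetSum _ fun j _ => integrable_sphKernel μ k _]
      simp_rw [add_right_comm x _ (_ : ℚ_[p]), sum_sphKernel hc]
      simp
    have h2 : ∀ j ∈ Finset.range p, ∫ y, sphKernel p k ((x + j * c) + y) ∂μ =
        ∫ y, sphKernel p k (x + y) ∂μ := fun j _ => by
      have hjc : ‖(j : ℚ_[p]) * c‖ < ‖x‖ := by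
        refine lt_of_le_of_lt ?_ hx
        rw [norm_mul, hc]
        exact mul_le_of_le_one_left (zpow_pos prime_pos _).le
          (by simpa using Padic.norm_int_le_one (p := p) (j : ℤ))
      have hu : ‖(x + j * c) / x‖ = 1 := by
        rw [norm_div, IsUltrametricDist.norm_add_eq_max_of_norm_ne_norm hjc.ne',
          max_eq_left hjc.le, div_self (norm_ne_zero_iff.2 hx0)]
      rw [← hμ.integral_mul hu (hmeas _)]
      congr 1
      ext y
      rw [show x + j * c + (x + j * c) / x * y = (x + j * c) / x * (x + y) by field_simp]
      exact sphKernel_congr (by rw [norm_mul, hu, one_mul])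
    rw [Finset.sum_congr rfl h2, Finset.sum_const, Finset.card_range, nsmul_eq_mul] at h1
    exact (mul_eq_zero.1 h1).resolve_left prime_pos.ne'

theorem RotInvariant.sphTransform_conv {μ ν : Measure ℚ_[p]} [IsProbabilityMeasure μ]
    [IsProbabilityMeasure ν] (hν : RotInvariant ν) (k : ℤ) :
    sphTransform (μ ∗ ν) k = sphTransform μ k * sphTransform ν k := by
  rw [sphTransform, integral_conv (by simpa using integrable_sphKernel (μ ∗ ν) k 0)]
  simp_rw [hν.integral_sphKernel_add]
  rw [integral_mul_const]
  rfl

theorem measureReal_closedBall_succ {μ : Measure ℚ_[p]} [IsProbabilityMeasure μ]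
    (m : ℤ) {c : ℚ_[p]} (hc : ‖c‖ = (p : ℝ) ^ (m + 1)) (x : ℚ_[p]) :
    μ.real (Metric.closedBall x ((p : ℝ) ^ (m + 1))) =
      ∑ j ∈ Finset.range p, μ.real (Metric.closedBall (x - j * c) ((p : ℝ) ^ m)) := by
  simp_rw [← integral_ballInd]
  rw [← integral_finsetSum _ fun j _ => by
    simpa [sub_eq_neg_add] using integrable_ballInd μ m (-(x - j * c))]
  congr 1
  ext y
  rw [← sum_ballInd hc]
  refine Finset.sum_congr rfl fun j _ => ?_
  congr 1
  ring

/-- A rotation invariant probability is determined by its spherical transform. -/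
theorem RotInvariant.closedBall_eq_ballMass {a : ℤ → ℝ} {t : ℝ} {μ : Measure ℚ_[p]}
    [IsProbabilityMeasure μ] (hμ : RotInvariant μ)
    (h : ∀ k, sphTransform μ k = Real.exp (-t * rateExp p a k)) (x : ℚ_[p]) (m : ℤ) :
    μ.real (Metric.closedBall x ((p : ℝ) ^ m)) = ballMass p a t x m := by
  have hp1 : (p : ℝ) - 1 ≠ 0 := by linarith [one_lt_prime (p := p)]
  have h0 : ∀ k, μ.real (Metric.closedBall 0 ((p : ℝ) ^ k)) = centeredBallMass p a t k := by
    intro k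
    rw [← geom_sum_transform (p := p) (H := fun j => μ.real (Metric.closedBall 0 ((p : ℝ) ^ j)))
      (m := k) (C := 1) fun j _ => by
        rw [abs_of_nonneg measureReal_nonneg]; exact measureReal_le_one]
    simp_rw [← sphTransform_eq, h]
    rfl
  rw [ballMass]
  split_ifs with hx
  · rw [← h0]
    congr 1
    exact IsUltrametricDist.closedBall_eq_of_mem (by simpa [dist_eq_norm] using hx)
  · have hx0 : x ≠ 0 := by
      rintro rfl
      rw [norm_zero] at hx
      exact hx (zpow_pos prime_pos _).le
    set k := -x.valuation with hk
    have hxk : ‖x‖ = (p : ℝ) ^ k := Padic.norm_eq_zpow_neg_valuation hx0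
    have hmk : m < k := by
      rw [hxk, zpow_le_zpow_iff_right₀ one_lt_prime] at hx
      omega
    rw [← h0, ← h0]
    -- the balls of radius `p^{k-1-n}` in the sphere of radius `p^k`, by induction on `n`
    have key : ∀ n : ℕ, (p : ℝ) ^ n * (p - 1) *
        μ.real (Metric.closedBall x ((p : ℝ) ^ (k - 1 - n))) =
        μ.real (Metric.closedBall 0 ((p : ℝ) ^ k)) -
          μ.real (Metric.closedBall 0 ((p : ℝ) ^ (k - 1))) := by
      intro n
      induction n with
      | zero =>
        have h1 := measureReal_closedBall_succ (μ := μ) (k - 1) (c := x)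
          (by rw [hxk, sub_add_cancel]) 0
        rw [sub_add_cancel,
          show Finset.range p = Finset.range (p - 1 + 1) by rw [Nat.sub_add_cancel hp.out.one_le],
          Finset.sum_range_succ', Finset.sum_congr rfl fun j hj =>
            hμ.closedBall_eq (y := x) (x := 0 - (j + 1 : ℕ) * x) (by
              rw [zero_sub, norm_neg, norm_mul, norm_natCast_unit (Nat.succ_ne_zero j)
                (by have := Finset.mem_range.1 hj; omega), one_mul]) _,
          Finset.sum_const, Finset.card_range, nsmul_eq_mul, Nat.cast_sub hp.out.one_le] at h1
        rw [h1]
        simp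
      | succ n ih =>
        rw [← ih]
        obtain ⟨c, hc⟩ : ∃ c : ℚ_[p], ‖c‖ = (p : ℝ) ^ (k - 1 - (n + 1 : ℕ) + 1) :=
          ⟨(p : ℚ_[p]) ^ (-(k - 1 - (n + 1 : ℕ) + 1)), by rw [Padic.norm_p_zpow, neg_neg]⟩
        have h1 := measureReal_closedBall_succ (μ := μ) (k - 1 - (n + 1 : ℕ)) hc x
        rw [Finset.sum_congr rfl fun (j : ℕ) _ => hμ.closedBall_eq (y := x)
          (x := x - (j : ℚ_[p]) * c) (by
            have hjc : ‖(j : ℚ_[p]) * c‖ < ‖x‖ := by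
              rw [norm_mul, hc]
              refine (mul_le_of_le_one_left (zpow_pos prime_pos _).le
                (by simpa using Padic.norm_int_le_one (p := p) (j : ℤ))).trans_lt ?_
              rw [hxk, zpow_lt_zpow_iff_right₀ one_lt_prime]
              push_cast
              omega
            rw [sub_eq_add_neg, IsUltrametricDist.norm_add_eq_max_of_norm_ne_norm
              (by rw [norm_neg]; exact hjc.ne'), norm_neg, max_eq_left hjc.le]) _,
          Finset.sum_const, Finset.card_range, nsmul_eq_mul,
          show k - 1 - ((n + 1 : ℕ) : ℤ) + 1 = k - 1 - n by push_cast; ring] at h1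
        rw [h1, pow_succ]
        ring
    obtain ⟨n, hn⟩ : ∃ n : ℕ, m = k - 1 - n := ⟨(k - 1 - m).toNat, by omega⟩
    have h1 := key n
    have h2 : (p : ℝ) ^ (k - m) - (p : ℝ) ^ (k - m - 1) = (p : ℝ) ^ n * (p - 1) := by
      rw [show k - m = n + 1 by omega, show (n : ℤ) + 1 - 1 = n by omega,
        zpow_add_one₀ prime_pos.ne', zpow_natCast]
      ring
    rw [h2, ← h1, hn, mul_div_cancel_left₀]
    exact mul_ne_zero (pow_pos prime_pos n).ne' hp1

theorem ballMass_congr {a : ℤ → ℝ} {t : ℝ} {x y : ℚ_[p]} (h : ‖x‖ = ‖y‖) (m : ℤ) :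
    ballMass p a t x m = ballMass p a t y m := by
  have : x.valuation = y.valuation := by
    rcases eq_or_ne x 0 with rfl | hx
    · rw [norm_zero, eq_comm, norm_eq_zero] at h; rw [h]
    · exact valuation_eq_of_norm_eq hx h
  simp only [ballMass, h, this]

end RotationInvariant

/-! ### Increments of a Lévy process -/

section Levy

variable {p : ℕ} [hp : Fact p.Prime] {Ω : Type*} {mΩ : MeasurableSpace Ω} {P : Measure Ω}
  {𝓕 : Filtration ℝ≥0 mΩ} {Z : ℝ≥0 → Ω → ℚ_[p]} {a : ℤ → ℝ}

/-- The σ-algebra `σ(Z(t+s) - Z(t) ; s ≥ 0)` of the increments after time `t`. -/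
@[reducible] def future (Z : ℝ≥0 → Ω → ℚ_[p]) (t : ℝ≥0) : MeasurableSpace Ω :=
  ⨆ s : ℝ≥0, MeasurableSpace.comap (fun ω => Z (t + s) ω - Z t ω) inferInstance

theorem measurable_future {t u v : ℝ≥0} (htu : t ≤ u) (htv : t ≤ v) :
    Measurable[future Z t] fun ω => Z v ω - Z u ω := by
  have h : ∀ w, t ≤ w → Measurable[future Z t] fun ω => Z w ω - Z t ω := fun w hw => by
    obtain ⟨s, rfl⟩ := exists_add_of_le hw
    exact (comap_measurable _).mono (le_iSup (fun s : ℝ≥0 =>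
      MeasurableSpace.comap (fun ω => Z (t + s) ω - Z t ω) inferInstance) s) le_rfl
  convert (h v htv).sub (h u htu) using 1
  ext ω
  simp

theorem IsLevyProcess.measurable (hZ : IsLevyProcess a 𝓕 P Z) (t : ℝ≥0) : Measurable (Z t) :=
  (hZ.adapted t).mono (𝓕.le t) le_rfl

theorem IsLevyProcess.measurable_le (hZ : IsLevyProcess a 𝓕 P Z) {s t : ℝ≥0} (h : s ≤ t) :
    Measurable[𝓕 t] (Z s) :=
  (hZ.adapted s).mono (𝓕.mono h) le_rfl

theorem IsLevyProcess.future_le (hZ : IsLevyProcess a 𝓕 P Z) (t : ℝ≥0) : future Z t ≤ mΩ :=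
  iSup_le fun s => ((hZ.measurable (t + s)).sub (hZ.measurable t)).comap_le

theorem IsLevyProcess.measureReal_norm_le (hZ : IsLevyProcess a 𝓕 P Z) (s t : ℝ≥0) (m : ℤ) :
    P.real {ω | ‖Z (s + t) ω - Z s ω‖ ≤ (p : ℝ) ^ m} = centeredBallMass p a t m := by
  have := hZ.law s t 0 m
  rw [ballMass, if_pos (by rw [norm_zero]; exact (zpow_pos prime_pos _).le)] at this
  simpa using this

theorem IsLevyProcess.measurable_gridIncr (hZ : IsLevyProcess a 𝓕 P Z) (u h : ℝ≥0) (n i : ℕ) :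
    Measurable[𝓕 (grid u h n (i + 1))] fun ω => gridIncr (fun t => Z t ω) u h n i :=
  (hZ.adapted _).sub (hZ.measurable_le (grid_mono u h n (Nat.le_succ i)))

theorem truncProcess_eq_cumSum (Z : ℝ≥0 → Ω → ℚ_[p]) (M : ℤ) (t : ℝ≥0) (ω : Ω) :
    truncProcess Z M t ω = cumSum (fun s => truncFun p M (jump (fun s => Z s ω) s)) t :=
  jumpIntegral_eq_cumSum _ (isShort_truncFun M) t

theorem IsLevyProcess.tendsto_truncProcess (hZ : IsLevyProcess a 𝓕 P Z) (M : ℤ) (s t : ℝ≥0)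
    (ω : Ω) : Tendsto (fun n => ∑ i ∈ Finset.range n,
        truncFun p M (gridIncr (fun t => Z t ω) s t n i)) atTop
      (𝓝 (truncProcess Z M (s + t) ω - truncProcess Z M s ω)) := by
  rw [truncProcess_eq_cumSum, truncProcess_eq_cumSum]
  exact (hZ.cadlag ω).tendsto_sum_gridIncr (isShort_truncFun M) s t

theorem IsLevyProcess.jump_truncProcess (hZ : IsLevyProcess a 𝓕 P Z) (M : ℤ) (ω : Ω) (s : ℝ≥0) :
    jump (fun t => truncProcess Z M t ω) s = truncFun p M (jump (fun t => Z t ω) s) := by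
  simp_rw [truncProcess_eq_cumSum]
  refine Sparse.jump_cumSum ((hZ.cadlag ω).sparse_comp_jump (isShort_truncFun M)) ?_ s
  rw [jump_zero, (isShort_truncFun M).zero]

theorem IsLevyProcess.map_closedBall (hZ : IsLevyProcess a 𝓕 P Z) (s t : ℝ≥0) (x : ℚ_[p]) (m : ℤ) :
    (P.map fun ω => Z (s + t) ω - Z s ω).real (Metric.closedBall x ((p : ℝ) ^ m)) =
      ballMass p a t x m := by
  have hm : Measurable fun ω => Z (s + t) ω - Z s ω := (hZ.measurable _).sub (hZ.measurable _)
  rw [map_measureReal_apply hm measurableSet_closedBall]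
  exact hZ.law s t x m

variable [IsProbabilityMeasure P]

theorem IsLevyProcess.isProbabilityMeasure_map (hZ : IsLevyProcess a 𝓕 P Z) (s t : ℝ≥0) :
    IsProbabilityMeasure (P.map fun ω => Z t ω - Z s ω) :=
  Measure.isProbabilityMeasure_map ((hZ.measurable t).sub (hZ.measurable s)).aemeasurable

theorem IsLevyProcess.map_eq (hZ : IsLevyProcess a 𝓕 P Z) (s s' t : ℝ≥0) :
    (P.map fun ω => Z (s + t) ω - Z s ω) = P.map fun ω => Z (s' + t) ω - Z s' ω := by
  have := hZ.isProbabilityMeasure_map s (s + t)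
  have := hZ.isProbabilityMeasure_map s' (s' + t)
  exact measure_ext_of_closedBall fun x m => by rw [hZ.map_closedBall, hZ.map_closedBall]

theorem IsLevyProcess.rotInvariant (hZ : IsLevyProcess a 𝓕 P Z) (s t : ℝ≥0) :
    RotInvariant (P.map fun ω => Z (s + t) ω - Z s ω) := by
  have := hZ.isProbabilityMeasure_map s (s + t)
  exact rotInvariant_of_closedBall fun x y m h => by
    rw [hZ.map_closedBall, hZ.map_closedBall, ballMass_congr h]

theorem IsLevyProcess.measure_lt_norm_le (hZ : IsLevyProcess a 𝓕 P Z) (ha : IsRateSequence a)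
    (s t : ℝ≥0) (m : ℤ) :
    P {ω | (p : ℝ) ^ m < ‖Z (s + t) ω - Z s ω‖} ≤ ENNReal.ofReal (t * a m) := by
  have hm : MeasurableSet {ω | ‖Z (s + t) ω - Z s ω‖ ≤ (p : ℝ) ^ m} :=
    measurableSet_le ((hZ.measurable _).sub (hZ.measurable _)).norm measurable_const
  have h1 := hZ.measureReal_norm_le s t m
  have h2 : {ω | (p : ℝ) ^ m < ‖Z (s + t) ω - Z s ω‖} =
      {ω | ‖Z (s + t) ω - Z s ω‖ ≤ (p : ℝ) ^ m}ᶜ := by ext ω; simp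
  rw [← ofReal_measureReal (μ := P), h2, probReal_compl_eq_one_sub hm, h1]
  exact ENNReal.ofReal_le_ofReal (ha.one_sub_centeredBallMass_le t.2 m)

theorem IsLevyProcess.map_gridIncr (hZ : IsLevyProcess a 𝓕 P Z) (u h : ℝ≥0) (n i : ℕ) :
    (P.map fun ω => gridIncr (fun t => Z t ω) u h n i) =
      P.map fun ω => Z (0 + h / n) ω - Z 0 ω := by
  simp only [gridIncr, grid_succ]
  exact hZ.map_eq _ _ _

/-- Sums of i.i.d. rotation invariant terms: the spherical transform of a sum of `F` over the first
`j` increments along a partition is the `j`-th power of that of one term. -/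
theorem IsLevyProcess.sum_gridIncr_transform (hZ : IsLevyProcess a 𝓕 P Z) {F : ℚ_[p] → ℚ_[p]}
    (hF : Measurable F) (hFu : ∀ u z, ‖u‖ = 1 → F (u * z) = u * F z) (u h : ℝ≥0) (n j : ℕ) :
    (Measurable[𝓕 (grid u h n j)] fun ω =>
      ∑ i ∈ Finset.range j, F (gridIncr (fun t => Z t ω) u h n i)) ∧
    RotInvariant (P.map fun ω => ∑ i ∈ Finset.range j, F (gridIncr (fun t => Z t ω) u h n i)) ∧
    ∀ k, sphTransform
      (P.map fun ω => ∑ i ∈ Finset.range j, F (gridIncr (fun t => Z t ω) u h n i)) k =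
        sphTransform ((P.map fun ω => Z (0 + h / n) ω - Z 0 ω).map F) k ^ j := by
  induction j with
  | zero =>
    simp only [Finset.range_zero, Finset.sum_empty, Measure.map_const, measure_univ, one_smul]
    refine ⟨measurable_const, fun v _ => ?_, fun k => ?_⟩
    · rw [Measure.map_dirac' (continuous_const_mul v).measurable, mul_zero]
    · rw [sphTransform, integral_dirac, sphKernel_eq_one (by
        rw [norm_zero]; exact (zpow_pos prime_pos _).le), pow_zero]
  | succ j ih =>
    obtain ⟨hm, hrot, htr⟩ := ih
    set S := fun ω => ∑ i ∈ Finset.range j, F (gridIncr (fun t => Z t ω) u h n i) with hS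
    set Y := fun ω => F (gridIncr (fun t => Z t ω) u h n j) with hY
    have hsum : (fun ω => ∑ i ∈ Finset.range (j + 1), F (gridIncr (fun t => Z t ω) u h n i)) =
        S + Y := by
      ext ω; simp [hS, hY, Finset.sum_range_succ]
    have hle := 𝓕.mono (grid_mono u h n (Nat.le_succ j))
    have hSm : Measurable S := hm.mono (𝓕.le _) le_rfl
    have hYm' : Measurable[𝓕 (grid u h n (j + 1))] Y := hF.comp (hZ.measurable_gridIncr u h n j)
    have hYm : Measurable Y := hYm'.mono (𝓕.le _) le_rfl
    have hIncrM : Measurable fun ω => gridIncr (fun t => Z t ω) u h n j :=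
      (hZ.measurable_gridIncr u h n j).mono (𝓕.le _) le_rfl
    have hind : IndepFun S Y P := by
      rw [IndepFun_iff_Indep]
      refine indep_of_indep_of_le_left (indep_of_indep_of_le_right (hZ.indep (grid u h n j)) ?_)
        hm.comap_le
      refine Measurable.comap_le (hF.comp ?_)
      exact measurable_future le_rfl (grid_mono u h n (Nat.le_succ j))
    have hYlaw : P.map Y = (P.map fun ω => Z (0 + h / n) ω - Z 0 ω).map F := by
      rw [← hZ.map_gridIncr u h n j, Measure.map_map hF hIncrM]
      rfl
    have := Measure.isProbabilityMeasure_map (μ := P) hSm.aemeasurable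
    have := Measure.isProbabilityMeasure_map (μ := P) hYm.aemeasurable
    have hYrot : RotInvariant (P.map Y) := by
      intro v hv
      have hvm : Measurable fun x : ℚ_[p] => v * x := (continuous_const_mul v).measurable
      rw [hYlaw, Measure.map_map hvm hF]
      conv_rhs => rw [← hZ.rotInvariant 0 (h / n) v hv, Measure.map_map hF hvm]
      congr 1
      ext z
      exact (hFu v z hv).symm
    rw [hsum]
    refine ⟨(hm.mono hle le_rfl).add hYm', ?_, fun k => ?_⟩
    · rw [hind.map_add_eq_map_conv_map hSm hYm]
      exact hrot.conv hYrot
    · rw [hind.map_add_eq_map_conv_map hSm hYm, hYrot.sphTransform_conv, htr, pow_succ, hYlaw]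

/-- The probability that all increments along a partition lie in a given ball is bounded below,
uniformly in the partition. -/
theorem IsLevyProcess.exp_le_measureReal_gridIncr_le (hZ : IsLevyProcess a 𝓕 P Z)
    (ha : IsRateSequence a) (u h : ℝ≥0) (m : ℤ) {n : ℕ} (hn : n ≠ 0) :
    Real.exp (-h * (p * a m / (p - 1))) ≤
      P.real {ω | ∀ i < n, ‖gridIncr (fun t => Z t ω) u h n i‖ ≤ (p : ℝ) ^ m} := by
  have key : ∀ j, MeasurableSet[𝓕 (grid u h n j)]
      {ω | ∀ i < j, ‖gridIncr (fun t => Z t ω) u h n i‖ ≤ (p : ℝ) ^ m} ∧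
      P.real {ω | ∀ i < j, ‖gridIncr (fun t => Z t ω) u h n i‖ ≤ (p : ℝ) ^ m} =
        centeredBallMass p a (h / n) m ^ j := by
    intro j
    induction j with
    | zero => simp
    | succ j ih =>
      have hset : {ω | ∀ i < j + 1, ‖gridIncr (fun t => Z t ω) u h n i‖ ≤ (p : ℝ) ^ m} =
          {ω | ∀ i < j, ‖gridIncr (fun t => Z t ω) u h n i‖ ≤ (p : ℝ) ^ m} ∩
          {ω | ‖gridIncr (fun t => Z t ω) u h n j‖ ≤ (p : ℝ) ^ m} := by
        ext ω
        simp only [Set.mem_ofPred_eq, Set.mem_inter_iff, Nat.forall_lt_succ_right]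
      have hball : {ω | ‖gridIncr (fun t => Z t ω) u h n j‖ ≤ (p : ℝ) ^ m} =
          (fun ω => gridIncr (fun t => Z t ω) u h n j) ⁻¹'
            Metric.closedBall 0 ((p : ℝ) ^ m) := by ext ω; simp
      have hfut : MeasurableSet[future Z (grid u h n j)]
          {ω | ‖gridIncr (fun t => Z t ω) u h n j‖ ≤ (p : ℝ) ^ m} := by
        rw [hball]
        exact measurable_future (Z := Z) le_rfl (grid_mono u h n (Nat.le_succ j))
          measurableSet_closedBall
      refine ⟨?_, ?_⟩
      · rw [hset]
        refine MeasurableSet.inter (𝓕.mono (grid_mono u h n (Nat.le_succ j)) _ ih.1) ?_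
        rw [hball]
        exact hZ.measurable_gridIncr u h n j measurableSet_closedBall
      · have hi := (Indep_iff _ _ _).1 (hZ.indep (grid u h n j)) _ _ ih.1 hfut
        have hl := hZ.measureReal_norm_le (grid u h n j) (h / n) m
        rw [← grid_succ] at hl
        rw [hset, measureReal_def, hi, ENNReal.toReal_mul, ← measureReal_def, ← measureReal_def,
          ih.2, pow_succ]
        congr 1
  rw [(key n).2]
  have hn' : (n : ℝ) ≠ 0 := by exact_mod_cast hn
  have h1 := ha.exp_le_centeredBallMass (p := p) (t := (h : ℝ) / n) (by positivity) m
  refine le_trans (le_of_eq ?_) (pow_le_pow_left₀ (Real.exp_pos _).le h1 n)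
  rw [← Real.exp_nat_mul]
  congr 1
  field_simp

/-! ### The truncated processes are Lévy processes -/

/-- For one increment over a short time, truncation only affects the transform at `k = M - 1` and
beyond; at `k = M - 1` the small time asymptotics of the escape probability gives the limit. -/
theorem IsRateSequence.tendsto_transform_pow (ha : IsRateSequence a) (M k : ℤ) {t : ℝ}
    (ht : 0 ≤ t) :
    Tendsto (fun n : ℕ =>
      rateExp p (fun j => if M ≤ j then 1 else centeredBallMass p a (t / n) j) k ^ n) atTop
      (𝓝 (Real.exp (-t * rateExp p (truncSeq a M) k))) := by
  have hp1 : (p : ℝ) - 1 ≠ 0 := by linarith [one_lt_prime (p := p)]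
  rcases lt_trichotomy (k + 1) M with h | h | h
  · have h1 : rateExp p (truncSeq a M) k = rateExp p a k := by
      simp [rateExp, truncSeq, h, show k < M by omega]
    rw [h1]
    refine tendsto_const_nhds.congr' ?_
    filter_upwards [eventually_ne_atTop 0] with n hn
    have hn' : (n : ℝ) ≠ 0 := by exact_mod_cast hn
    have h2 : rateExp p (fun j => if M ≤ j then 1 else centeredBallMass p a (t / n) j) k =
        rateExp p (centeredBallMass p a (t / n)) k := by
      simp [rateExp, not_le.2 h, show ¬ M ≤ k by omega]
    rw [h2, ha.centeredBallMass_transform (by positivity), ← Real.exp_nat_mul]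
    congr 1
    field_simp
  · have h1 : rateExp p (truncSeq a M) k = p * a k / (p - 1) := by
      simp [rateExp, truncSeq, h, show k < M by omega]
    have h2 : ∀ n : ℕ,
        rateExp p (fun j => if M ≤ j then 1 else centeredBallMass p a (t / n) j) k =
        1 + -(p / (p - 1)) * (1 - centeredBallMass p a (t / n) k) := fun n => by
      simp only [rateExp, h, le_refl, if_true, show ¬ M ≤ k by omega, if_false]
      field_simp
      ring
    simp_rw [h2, h1]
    refine Real.tendsto_one_add_pow_exp_of_tendsto ?_
    have := (ha.tendsto_mul_one_sub_centeredBallMass (p := p) ht k).const_mul (-(p / (p - 1) : ℝ))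
    convert this using 2
    · ring
    · ring
  · have h1 : rateExp p (truncSeq a M) k = 0 := by
      simp [rateExp, truncSeq, show ¬ k + 1 < M by omega, show ¬ k < M by omega]
    have h2 : ∀ n : ℕ,
        rateExp p (fun j => if M ≤ j then 1 else centeredBallMass p a (t / n) j) k = 1 := by
      intro n
      simp [rateExp, show M ≤ k + 1 by omega, show M ≤ k by omega, hp1]
    simp_rw [h2, h1]
    simp

theorem IsLevyProcess.sphTransform_truncFun (hZ : IsLevyProcess a 𝓕 P Z) (M k : ℤ) (t : ℝ≥0) :
    sphTransform ((P.map fun ω => Z (0 + t) ω - Z 0 ω).map (truncFun p M)) k =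
      rateExp p (fun j => if M ≤ j then 1 else centeredBallMass p a t j) k := by
  have hFm : Measurable (truncFun p M) := (isShort_truncFun M).continuous.measurable
  have hm : Measurable fun ω => Z (0 + t) ω - Z 0 ω := (hZ.measurable _).sub (hZ.measurable _)
  have := hZ.isProbabilityMeasure_map 0 (0 + t)
  have := Measure.isProbabilityMeasure_map (μ := P.map fun ω => Z (0 + t) ω - Z 0 ω)
    hFm.aemeasurable
  rw [sphTransform_eq]
  congr 1
  ext j
  rw [Measure.map_map hFm hm,
    map_measureReal_apply (hFm.comp hm) measurableSet_closedBall]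
  have hset : (truncFun p M ∘ fun ω => Z (0 + t) ω - Z 0 ω) ⁻¹'
      Metric.closedBall 0 ((p : ℝ) ^ j) =
      {ω | ‖Z (0 + t) ω - Z 0 ω‖ ≤ (p : ℝ) ^ j ∨ M ≤ j} := by
    ext ω
    rw [Set.mem_preimage, mem_closedBall_zero_iff, Function.comp_apply, norm_truncFun_le_iff]
    rfl
  rw [hset]
  split_ifs with h
  · simp [h]
  · rw [← hZ.measureReal_norm_le 0 t j]
    congr 1
    ext ω
    simp [h]

theorem tendsto_integral_comp {S : ℕ → Ω → ℚ_[p]} {W : Ω → ℚ_[p]} (hS : ∀ n, Measurable (S n))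
    (hlim : ∀ ω, Tendsto (fun n => S n ω) atTop (𝓝 (W ω))) {f : ℚ_[p] → ℝ} (hf : Continuous f)
    {C : ℝ} (hC : ∀ x, |f x| ≤ C) :
    Tendsto (fun n => ∫ ω, f (S n ω) ∂P) atTop (𝓝 (∫ ω, f (W ω) ∂P)) :=
  tendsto_integral_of_dominated_convergence (fun _ => C)
    (fun n => (hf.measurable.comp (hS n)).aestronglyMeasurable) (integrable_const C)
    (fun _ => Eventually.of_forall fun _ => hC _)
    (Eventually.of_forall fun ω => (hf.tendsto _).comp (hlim ω))

theorem rotInvariant_of_tendsto {S : ℕ → Ω → ℚ_[p]} {W : Ω → ℚ_[p]} (hS : ∀ n, Measurable (S n))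
    (hlim : ∀ ω, Tendsto (fun n => S n ω) atTop (𝓝 (W ω)))
    (h : ∀ n, RotInvariant (P.map (S n))) : RotInvariant (P.map W) := by
  have hW : Measurable W := measurable_of_tendsto_metrizable hS (tendsto_pi_nhds.2 hlim)
  have := Measure.isProbabilityMeasure_map (μ := P) hW.aemeasurable
  refine rotInvariant_of_closedBall fun x y m hxy => ?_
  have key : ∀ z : ℚ_[p], Tendsto (fun n => (P.map (S n)).real (Metric.closedBall z ((p : ℝ) ^ m)))
      atTop (𝓝 ((P.map W).real (Metric.closedBall z ((p : ℝ) ^ m)))) := fun z => by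
    have h1 := tendsto_integral_comp (P := P) hS hlim (f := fun v => ballInd p m (v - z))
      ((continuous_ballInd m).comp (continuous_sub_right z)) (fun v => abs_ballInd_le m _)
    have hb : Measurable fun v : ℚ_[p] => ballInd p m (v - z) :=
      (measurable_ballInd m).comp (measurable_sub_const z)
    have h2 : ∀ V : Ω → ℚ_[p], Measurable V → ∫ ω, ballInd p m (V ω - z) ∂P =
        (P.map V).real (Metric.closedBall z ((p : ℝ) ^ m)) := fun V hV => by
      have := Measure.isProbabilityMeasure_map (μ := P) hV.aemeasurable
      rw [← integral_ballInd, integral_map hV.aemeasurable hb.aestronglyMeasurable]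
    simp_rw [h2 W hW, fun n => h2 (S n) (hS n)] at h1
    exact h1
  refine tendsto_nhds_unique (key x) ((key y).congr fun n => ?_)
  exact (h n).closedBall_eq hxy.symm _

/-- The truncated process is a Lévy process for the truncated sequence. Its increments are limits of
sums of i.i.d. truncated increments of `Z` along partitions; this gives independence of the past,
rotation invariance, and, through the spherical transform, the law. -/
theorem IsLevyProcess.trunc (hZ : IsLevyProcess a 𝓕 P Z) (ha : IsRateSequence a) (M : ℤ) :
    IsLevyProcess (truncSeq a M) 𝓕 P (truncProcess Z M) where
  zero ω := by
    rw [truncProcess_eq_cumSum, cumSum_zero]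
    rw [jump_zero, (isShort_truncFun M).zero]
  cadlag ω := by
    simp_rw [truncProcess_eq_cumSum]
    exact ((hZ.cadlag ω).sparse_comp_jump (isShort_truncFun M)).isCadlag
  adapted t := by
    have hFm : Measurable (truncFun p M) := (isShort_truncFun M).continuous.measurable
    have h : Measurable[𝓕 t] fun ω =>
        truncProcess Z M (0 + t) ω - truncProcess Z M 0 ω := by
      refine @measurable_of_tendsto_metrizable _ _ (𝓕 t) _ _ _ _ (fun n ω => ∑ i ∈ Finset.range n,
        truncFun p M (gridIncr (fun t => Z t ω) 0 t n i)) _ (fun n => ?_)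
        (tendsto_pi_nhds.2 fun ω => hZ.tendsto_truncProcess M 0 t ω)
      refine Finset.measurable_fun_sum _ fun i hi => hFm.comp ?_
      refine (hZ.measurable_gridIncr 0 t n i).mono (𝓕.mono ?_) le_rfl
      simpa using grid_le 0 t (Finset.mem_range.1 hi)
    convert h using 2 with ω
    rw [zero_add, truncProcess_eq_cumSum, truncProcess_eq_cumSum, cumSum_zero, sub_zero]
    rw [jump_zero, (isShort_truncFun M).zero]
  indep t := by
    refine indep_of_indep_of_le_right (hZ.indep t) (iSup_le fun s => Measurable.comap_le ?_)
    have hFm : Measurable (truncFun p M) := (isShort_truncFun M).continuous.measurable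
    refine @measurable_of_tendsto_metrizable _ _ (future Z t) _ _ _ _ (fun n ω =>
      ∑ i ∈ Finset.range n, truncFun p M (gridIncr (fun t => Z t ω) t s n i)) _ (fun n => ?_)
      (tendsto_pi_nhds.2 fun ω => hZ.tendsto_truncProcess M t s ω)
    exact Finset.measurable_fun_sum _ fun i _ => hFm.comp
      (measurable_future (le_grid t s n i) (le_grid t s n (i + 1)))
  law s t x m := by
    have hFm : Measurable (truncFun p M) := (isShort_truncFun M).continuous.measurable
    have hstep := fun n => hZ.sum_gridIncr_transform hFm (fun u z hu => truncFun_mul M hu z) s t n n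
    set S : ℕ → Ω → ℚ_[p] := fun n ω => ∑ i ∈ Finset.range n,
      truncFun p M (gridIncr (fun t => Z t ω) s t n i) with hS
    set W : Ω → ℚ_[p] := fun ω =>
      truncProcess Z M (s + t) ω - truncProcess Z M s ω with hWdef
    have hlim : ∀ ω, Tendsto (fun n => S n ω) atTop (𝓝 (W ω)) := hZ.tendsto_truncProcess M s t
    have hSm : ∀ n, Measurable (S n) := fun n => (hstep n).1.mono (𝓕.le _) le_rfl
    have hW : Measurable W := measurable_of_tendsto_metrizable hSm (tendsto_pi_nhds.2 hlim)
    have := Measure.isProbabilityMeasure_map (μ := P) hW.aemeasurable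
    have htr : ∀ k, sphTransform (P.map W) k =
        Real.exp (-t * rateExp p (truncSeq a M) k) := fun k => by
      have h1 := tendsto_integral_comp (P := P) hSm hlim (continuous_sphKernel k)
        (abs_sphKernel_le k)
      have h2 : ∀ V : Ω → ℚ_[p], Measurable V → ∫ ω, sphKernel p k (V ω) ∂P =
          sphTransform (P.map V) k := fun V hV => by
        rw [sphTransform,
          integral_map hV.aemeasurable (measurable_sphKernel k).aestronglyMeasurable]
      simp_rw [h2 W hW, fun n => h2 (S n) (hSm n)] at h1
      refine tendsto_nhds_unique h1 ((ha.tendsto_transform_pow (p := p) M k t.2).congr fun n => ?_)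
      rw [(hstep n).2.2 k, hZ.sphTransform_truncFun]
      push_cast
      rfl
    rw [← (rotInvariant_of_tendsto hSm hlim fun n => (hstep n).2.1).closedBall_eq_ballMass htr,
      map_measureReal_apply hW measurableSet_closedBall]
    rfl

end Levy

/-! ### The `γ`-variation of a path and its mean -/

section Variation

variable {p : ℕ} [hp : Fact p.Prime] {γ : ℝ}

/-- In an ultrametric group, the `γ`-th power of the norm is subadditive for every `γ > 0`, even
over infinite sums. -/
theorem enorm_tsum_rpow_le {ι : Type*} (hγ : 0 < γ) (g : ι → ℚ_[p]) :
    ‖∑' s, g s‖ₑ ^ γ ≤ ∑' s, ‖g s‖ₑ ^ γ := by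
  set R := ∑' s, ‖g s‖ₑ ^ γ with hR
  rcases eq_or_ne R ∞ with h | h
  · rw [h]; exact le_top
  have h1 : ∀ s, ‖g s‖ₑ ≤ R ^ γ⁻¹ := fun s => by
    rw [ENNReal.le_rpow_inv_iff hγ]
    exact ENNReal.le_tsum s
  have h2 : R ^ γ⁻¹ ≠ ∞ := ENNReal.rpow_ne_top_of_nonneg (by positivity) h
  rw [← ENNReal.le_rpow_inv_iff hγ, ← ofReal_norm, ENNReal.ofReal_le_iff_le_toReal h2]
  refine IsUltrametricDist.norm_tsum_le_of_forall_le_of_nonneg ENNReal.toReal_nonneg fun s => ?_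
  rw [← ENNReal.ofReal_le_iff_le_toReal h2, ofReal_norm]
  exact h1 s

theorem enorm_add_rpow_le (hγ : 0 < γ) (x y : ℚ_[p]) :
    ‖x + y‖ₑ ^ γ ≤ ‖x‖ₑ ^ γ + ‖y‖ₑ ^ γ := by
  have h : ‖x + y‖ₑ ≤ max ‖x‖ₑ ‖y‖ₑ := by
    have := IsUltrametricDist.norm_add_le_max x y
    simp only [← ofReal_norm]
    rw [← ENNReal.ofReal_max]
    exact ENNReal.ofReal_le_ofReal this
  refine (ENNReal.rpow_le_rpow h hγ.le).trans ?_
  rcases le_total ‖x‖ₑ ‖y‖ₑ with h | h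
  · rw [max_eq_right h]; exact le_add_self
  · rw [max_eq_left h]; exact le_self_add

theorem enorm_sub_rpow_le (hγ : 0 < γ) (x y z : ℚ_[p]) :
    ‖x - z‖ₑ ^ γ ≤ ‖x - y‖ₑ ^ γ + ‖y - z‖ₑ ^ γ := by
  simpa using enorm_add_rpow_le hγ (x - y) (y - z)

/-- The sum `∑ ‖Δζ(s)‖^γ` over the times `s` in `(u, v]`. -/
def jumpPow (γ : ℝ) (ζ : ℝ≥0 → ℚ_[p]) (u v : ℝ≥0) : ℝ≥0∞ :=
  ∑' s, (Set.Ioc u v).indicator (fun s => ‖jump ζ s‖ₑ ^ γ) s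

theorem jumpPow_add (ζ : ℝ≥0 → ℚ_[p]) {u v w : ℝ≥0} (huv : u ≤ v) (hvw : v ≤ w) :
    jumpPow γ ζ u v + jumpPow γ ζ v w = jumpPow γ ζ u w := by
  rw [jumpPow, jumpPow, jumpPow, ← ENNReal.tsum_add]
  congr 1
  ext s
  rw [← Set.Ioc_union_Ioc_eq_Ioc huv hvw, Set.indicator_union_of_disjoint]
  rw [Set.disjoint_left]
  exact fun s h1 h2 => absurd h1.2 (not_le.2 h2.1)

theorem IsCadlag.enorm_sub_rpow_le_jumpPow {ζ : ℝ≥0 → ℚ_[p]} (hζ : IsCadlag ζ) (hγ : 0 < γ)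
    {u v : ℝ≥0} (huv : u ≤ v) : ‖ζ v - ζ u‖ₑ ^ γ ≤ jumpPow γ ζ u v := by
  rw [hζ.sub_eq_cumSum_sub huv, hζ.sparse_jump.cumSum_sub huv]
  refine (enorm_tsum_rpow_le hγ _).trans (ENNReal.tsum_le_tsum fun s => ?_)
  by_cases hs : s ∈ Set.Ioc u v
  · simp [hs]
  · simp [hs, hγ]

/-- The sum of the `γ`-th powers of the norms of the increments along a partition. -/
def gridPow (γ : ℝ) (ζ : ℝ≥0 → ℚ_[p]) (u h : ℝ≥0) (n : ℕ) : ℝ≥0∞ :=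
  ∑ i ∈ Finset.range n, ‖gridIncr ζ u h n i‖ₑ ^ γ

theorem IsCadlag.gridPow_le {ζ : ℝ≥0 → ℚ_[p]} (hζ : IsCadlag ζ) (hγ : 0 < γ) (u h : ℝ≥0) (n : ℕ) :
    gridPow γ ζ u h n ≤ jumpPow γ ζ u (u + h) := by
  have key : ∀ j, ∑ i ∈ Finset.range j, ‖gridIncr ζ u h n i‖ₑ ^ γ ≤
      jumpPow γ ζ u (grid u h n j) := by
    intro j
    induction j with
    | zero => simp
    | succ j ih =>
      have hle := grid_mono u h n (Nat.le_succ j)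
      rw [Finset.sum_range_succ, ← jumpPow_add ζ (le_grid u h n j) hle]
      exact add_le_add ih (hζ.enorm_sub_rpow_le_jumpPow hγ hle)
  refine (key n).trans ?_
  rw [← jumpPow_add ζ (le_grid u h n n) (grid_le u h le_rfl)]
  exact le_self_add

theorem exists_cell {τ : ℕ → ℝ≥0} {s : ℝ≥0} {j : ℕ} (hs : s ∈ Set.Ioc (τ 0) (τ j)) :
    ∃ i < j, s ∈ Set.Ioc (τ i) (τ (i + 1)) := by
  induction j with
  | zero => rw [Set.Ioc_self] at hs; exact absurd hs (Set.notMem_empty s)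
  | succ j ih =>
    rcases le_or_gt s (τ j) with h1 | h1
    · obtain ⟨i, hi, h2⟩ := ih ⟨hs.1, h1⟩
      exact ⟨i, by omega, h2⟩
    · exact ⟨j, by omega, h1, hs.2⟩

theorem dist_lt_of_mem_grid_cell {u h s r : ℝ≥0} {n i : ℕ} {δ : ℝ} (hn : (h / n : ℝ) < δ)
    (hs : s ∈ Set.Icc (grid u h n i) (grid u h n (i + 1)))
    (hr : r ∈ Set.Icc (grid u h n i) (grid u h n (i + 1))) : dist s r < δ := by
  rw [grid_succ] at hs hr
  have h1 : (grid u h n i : ℝ) ≤ s := hs.1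
  have h2 : (s : ℝ) ≤ grid u h n i + h / n := by exact_mod_cast hs.2
  have h3 : (grid u h n i : ℝ) ≤ r := hr.1
  have h4 : (r : ℝ) ≤ grid u h n i + h / n := by exact_mod_cast hr.2
  rw [NNReal.dist_eq, abs_lt]
  constructor <;> linarith

/-- The sums of the `γ`-th powers of the increments along finer and finer partitions converge to
the sum over the jumps. -/
theorem IsCadlag.tendsto_gridPow {ζ : ℝ≥0 → ℚ_[p]} (hζ : IsCadlag ζ) (hγ : 0 < γ) (u h : ℝ≥0) :
    Tendsto (gridPow γ ζ u h) atTop (𝓝 (jumpPow γ ζ u (u + h))) := by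
  rw [tendsto_order]
  refine ⟨fun c hc => ?_, fun c hc =>
    Eventually.of_forall fun n => (hζ.gridPow_le hγ u h n).trans_lt hc⟩
  rw [jumpPow, ENNReal.tsum_eq_iSup_sum, lt_iSup_iff] at hc
  obtain ⟨A, hA⟩ := hc
  classical
  set B := A.filter fun s => s ∈ Set.Ioc u (u + h) ∧ jump ζ s ≠ 0 with hB
  have hAB : ∑ s ∈ A, (Set.Ioc u (u + h)).indicator (fun s => ‖jump ζ s‖ₑ ^ γ) s =
      ∑ s ∈ B, ‖jump ζ s‖ₑ ^ γ := by
    rw [hB, Finset.sum_filter]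
    refine Finset.sum_congr rfl fun s _ => ?_
    by_cases h1 : s ∈ Set.Ioc u (u + h)
    · by_cases h2 : jump ζ s = 0
      · simp [h2, hγ, Set.indicator]
      · simp only [Set.indicator_of_mem h1, h1, h2, ne_eq, not_false_eq_true, and_self, if_true]
    · simp only [Set.indicator_of_notMem h1, h1, false_and, if_false]
  rw [hAB] at hA
  -- a large jump is visible in the increment of a short cell containing it
  have hmesh : ∀ δ > (0 : ℝ), ∀ᶠ n : ℕ in atTop, (h / n : ℝ) < δ := fun δ hδ =>
    (tendsto_const_div_atTop_nhds_zero_nat (h : ℝ)).eventually_lt_const hδ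
  have hcell : ∀ᶠ n : ℕ in atTop, ∀ s ∈ B, ∀ i, s ∈ Set.Ioc (grid u h n i) (grid u h n (i + 1)) →
      ‖gridIncr ζ u h n i‖ = ‖jump ζ s‖ := by
    rw [Filter.eventually_all_finset]
    intro s hs
    have hj : jump ζ s ≠ 0 := (Finset.mem_filter.1 hs).2.2
    obtain ⟨δ, hδ, H⟩ := hζ.exists_nhds s (half_pos (norm_pos_iff.2 hj))
    filter_upwards [hmesh δ hδ] with n hn i hi
    have h1 := (H _ (Metric.mem_ball.2 (dist_lt_of_mem_grid_cell hn ⟨le_rfl, hi.1.le.trans hi.2⟩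
      ⟨hi.1.le, hi.2⟩)) _ (Metric.mem_ball.2 (dist_lt_of_mem_grid_cell hn
        ⟨hi.1.le.trans hi.2, le_rfl⟩ ⟨hi.1.le, hi.2⟩)) (hi.1.le.trans hi.2)).2 hi
    have h2 : ‖gridIncr ζ u h n i - jump ζ s‖ < ‖jump ζ s‖ :=
      h1.trans_lt (half_lt_self (norm_pos_iff.2 hj))
    have h3 := IsUltrametricDist.norm_add_eq_max_of_norm_ne_norm h2.ne
    rwa [sub_add_cancel, max_eq_right h2.le] at h3
  have hsep : ∀ᶠ n : ℕ in atTop, ∀ s ∈ B, ∀ r ∈ B, ∀ i,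
      s ∈ Set.Ioc (grid u h n i) (grid u h n (i + 1)) →
      r ∈ Set.Ioc (grid u h n i) (grid u h n (i + 1)) → s = r := by
    rw [Filter.eventually_all_finset]
    intro s _
    rw [Filter.eventually_all_finset]
    intro r _
    by_cases hsr : s = r
    · exact Eventually.of_forall fun _ _ _ _ => hsr
    · filter_upwards [hmesh _ (dist_pos.2 hsr)] with n hn i h1 h2
      exact absurd (dist_lt_of_mem_grid_cell hn ⟨h1.1.le, h1.2⟩ ⟨h2.1.le, h2.2⟩) (lt_irrefl _)
  filter_upwards [hcell, hsep, eventually_ne_atTop 0] with n h1 h2 hn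
  refine hA.trans_le ?_
  have hex : ∀ s ∈ B, ∃ i < n, s ∈ Set.Ioc (grid u h n i) (grid u h n (i + 1)) := fun s hs => by
    apply exists_cell
    rw [grid_self u h hn, grid_zero]
    exact (Finset.mem_filter.1 hs).2.1
  choose! i hi hi' using hex
  calc ∑ s ∈ B, ‖jump ζ s‖ₑ ^ γ = ∑ s ∈ B, ‖gridIncr ζ u h n (i s)‖ₑ ^ γ :=
        Finset.sum_congr rfl fun s hs => by
          rw [← ofReal_norm, ← h1 s hs _ (hi' s hs), ofReal_norm]
    _ = ∑ j ∈ B.image i, ‖gridIncr ζ u h n j‖ₑ ^ γ := by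
        rw [Finset.sum_image]
        intro s hs r hr hsr
        exact h2 s hs r hr (i s) (hi' s hs) (hsr ▸ hi' r hr)
    _ ≤ gridPow γ ζ u h n := by
        refine Finset.sum_le_sum_of_subset fun j hj => ?_
        obtain ⟨s, hs, rfl⟩ := Finset.mem_image.1 hj
        exact Finset.mem_range.2 (hi s hs)

/-- A bound for the mean `γ`-variation per unit time: the sphere of radius `p^m` is reached at rate
at most `a(m-1)`. -/
def momentConst (p : ℕ) (γ : ℝ) (a : ℤ → ℝ) : ℝ≥0∞ :=
  ∑' m : ℤ, ENNReal.ofReal (a (m - 1)) * ENNReal.ofReal ((p : ℝ) ^ (γ * (m : ℝ)))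

theorem momentConst_ne_top {a : ℤ → ℝ} (ha : IsRateSequence a) (h : SummableMoment p γ a) :
    momentConst p γ a ≠ ∞ := by
  have h1 : Summable fun m : ℤ => a (m - 1) * (p : ℝ) ^ (γ * (m : ℝ)) := by
    have h2 := ((Equiv.subRight (1 : ℤ)).summable_iff.2 h).mul_left ((p : ℝ) ^ γ)
    refine h2.congr fun m => ?_
    simp only [Function.comp_apply, Equiv.subRight_apply]
    rw [mul_left_comm, ← Real.rpow_add prime_pos]
    congr 2
    push_cast
    ring
  have h3 := h1.tsum_ofReal_ne_top
  rw [momentConst]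
  convert h3 using 3 with m
  rw [ENNReal.ofReal_mul (ha.nonneg _)]

variable {Ω : Type*} {mΩ : MeasurableSpace Ω} {P : Measure Ω}
  {𝓕 : Filtration ℝ≥0 mΩ} {X : ℝ≥0 → Ω → ℚ_[p]} {a : ℤ → ℝ}

theorem enorm_rpow_le_tsum (hγ : 0 < γ) (x : ℚ_[p]) :
    ‖x‖ₑ ^ γ ≤ ∑' m : ℤ, {y : ℚ_[p] | (p : ℝ) ^ (m - 1) < ‖y‖}.indicator
      (fun _ => ENNReal.ofReal ((p : ℝ) ^ (γ * (m : ℝ)))) x := by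
  rcases eq_or_ne x 0 with rfl | hx
  · simp [hγ]
  · have hn := Padic.norm_eq_zpow_neg_valuation hx
    refine le_trans ?_ (ENNReal.le_tsum (-x.valuation))
    rw [Set.indicator_of_mem]
    · rw [← ofReal_norm, hn, ENNReal.ofReal_rpow_of_pos (zpow_pos prime_pos _),
        ← Real.rpow_intCast, ← Real.rpow_mul (prime_pos (p := p)).le, mul_comm]
    · rw [Set.mem_ofPred_eq, hn]
      exact (zpow_lt_zpow_iff_right₀ one_lt_prime).2 (by omega)

theorem measurable_enorm_rpow : Measurable fun x : ℚ_[p] => ‖x‖ₑ ^ γ := measurable_enorm.pow_const γ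

theorem measurable_gridPow_future (u h : ℝ≥0) (n : ℕ) :
    Measurable[future X u] fun ω => gridPow γ (fun t => X t ω) u h n :=
  Finset.measurable_fun_sum _ fun i _ => measurable_enorm_rpow.comp
    (measurable_future (le_grid u h n i) (le_grid u h n (i + 1)))

theorem IsLevyProcess.measurable_jumpPow_future (hX : IsLevyProcess a 𝓕 P X) (hγ : 0 < γ)
    (u h : ℝ≥0) : Measurable[future X u] fun ω => jumpPow γ (fun t => X t ω) u (u + h) :=
  @measurable_of_tendsto_metrizable _ _ (future X u) _ _ _ _
    (fun n ω => gridPow γ (fun t => X t ω) u h n) _ (fun n => measurable_gridPow_future u h n)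
    (tendsto_pi_nhds.2 fun ω => (hX.cadlag ω).tendsto_gridPow hγ u h)

theorem IsLevyProcess.measurable_jumpPow (hX : IsLevyProcess a 𝓕 P X) (hγ : 0 < γ)
    (u h : ℝ≥0) : Measurable fun ω => jumpPow γ (fun t => X t ω) u (u + h) :=
  (hX.measurable_jumpPow_future hγ u h).mono (hX.future_le u) le_rfl

variable [IsProbabilityMeasure P]

theorem IsLevyProcess.lintegral_enorm_rpow_le (hX : IsLevyProcess a 𝓕 P X) (ha : IsRateSequence a)
    (hγ : 0 < γ) (s t : ℝ≥0) :
    ∫⁻ ω, ‖X (s + t) ω - X s ω‖ₑ ^ γ ∂P ≤ momentConst p γ a * t := by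
  have hm : Measurable fun ω => X (s + t) ω - X s ω := (hX.measurable _).sub (hX.measurable _)
  have hset : ∀ m : ℤ, MeasurableSet {y : ℚ_[p] | (p : ℝ) ^ (m - 1) < ‖y‖} := fun m =>
    measurableSet_lt measurable_const measurable_norm
  refine (lintegral_mono fun ω => enorm_rpow_le_tsum hγ _).trans ?_
  have hind : ∀ m : ℤ, Measurable fun ω => {y : ℚ_[p] | (p : ℝ) ^ (m - 1) < ‖y‖}.indicator
      (fun _ => ENNReal.ofReal ((p : ℝ) ^ (γ * (m : ℝ)))) (X (s + t) ω - X s ω) := fun m =>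
    (measurable_const.indicator (hset m)).comp hm
  rw [lintegral_tsum fun m => (hind m).aemeasurable,
    momentConst, ← ENNReal.tsum_mul_right]
  refine ENNReal.tsum_le_tsum fun m => ?_
  have h1 : (fun ω => {y : ℚ_[p] | (p : ℝ) ^ (m - 1) < ‖y‖}.indicator
      (fun _ => ENNReal.ofReal ((p : ℝ) ^ (γ * (m : ℝ)))) (X (s + t) ω - X s ω)) =
      {ω | (p : ℝ) ^ (m - 1) < ‖X (s + t) ω - X s ω‖}.indicator
        (fun _ => ENNReal.ofReal ((p : ℝ) ^ (γ * (m : ℝ)))) := by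
    ext ω; simp [Set.indicator]
  have hms : MeasurableSet {ω | (p : ℝ) ^ (m - 1) < ‖X (s + t) ω - X s ω‖} := hm (hset m)
  rw [h1, lintegral_indicator_const hms, mul_comm (ENNReal.ofReal (a (m - 1))), mul_assoc]
  gcongr
  refine (hX.measure_lt_norm_le ha s t (m - 1)).trans ?_
  rw [ENNReal.ofReal_mul t.coe_nonneg, mul_comm]
  simp

theorem IsLevyProcess.lintegral_gridPow (hX : IsLevyProcess a 𝓕 P X) (u h : ℝ≥0) (n : ℕ) :
    ∫⁻ ω, gridPow γ (fun t => X t ω) u h n ∂P =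
      n * ∫⁻ ω, ‖X (0 + h / n) ω - X 0 ω‖ₑ ^ γ ∂P := by
  have hF : Measurable fun x : ℚ_[p] => ‖x‖ₑ ^ γ := measurable_enorm_rpow
  have hm : ∀ i, Measurable fun ω => gridIncr (fun t => X t ω) u h n i := fun i =>
    (hX.measurable_gridIncr u h n i).mono (𝓕.le _) le_rfl
  have h0 : Measurable fun ω => X (0 + h / n) ω - X 0 ω := (hX.measurable _).sub (hX.measurable _)
  have hFm : ∀ i, Measurable fun ω => ‖gridIncr (fun t => X t ω) u h n i‖ₑ ^ γ := fun i =>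
    hF.comp (hm i)
  simp only [gridPow]
  rw [lintegral_finsetSum _ fun i _ => hFm i]
  rw [Finset.sum_congr rfl fun i _ => show ∫⁻ ω, ‖gridIncr (fun t => X t ω) u h n i‖ₑ ^ γ ∂P =
    ∫⁻ ω, ‖X (0 + h / n) ω - X 0 ω‖ₑ ^ γ ∂P by
      rw [← lintegral_map hF (hm i), hX.map_gridIncr, lintegral_map hF h0]]
  simp

theorem IsLevyProcess.lintegral_jumpPow_le (hX : IsLevyProcess a 𝓕 P X) (ha : IsRateSequence a)
    (hγ : 0 < γ) (u h : ℝ≥0) :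
    ∫⁻ ω, jumpPow γ (fun t => X t ω) u (u + h) ∂P ≤ momentConst p γ a * h := by
  have h1 : ∀ n : ℕ, ∫⁻ ω, gridPow γ (fun t => X t ω) u h n ∂P ≤ momentConst p γ a * h := by
    intro n
    rw [hX.lintegral_gridPow]
    rcases eq_or_ne n 0 with rfl | hn
    · simp
    have hn' : (n : ℝ≥0) ≠ 0 := by exact_mod_cast hn
    calc (n : ℝ≥0∞) * ∫⁻ ω, ‖X (0 + h / n) ω - X 0 ω‖ₑ ^ γ ∂P
        ≤ n * (momentConst p γ a * (h / n : ℝ≥0)) := by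
          gcongr; exact hX.lintegral_enorm_rpow_le ha hγ 0 _
      _ = momentConst p γ a * ((n * (h / n) : ℝ≥0)) := by push_cast; ring
      _ = momentConst p γ a * h := by rw [mul_div_cancel₀ _ hn']
  have h2 : ∀ ω, jumpPow γ (fun t => X t ω) u (u + h) =
      liminf (fun n => gridPow γ (fun t => X t ω) u h n) atTop := fun ω =>
    ((hX.cadlag ω).tendsto_gridPow hγ u h).liminf_eq.symm
  simp_rw [h2]
  refine (lintegral_liminf_le fun n =>
    (measurable_gridPow_future u h n).mono (hX.future_le u) le_rfl).trans ?_
  exact liminf_le_of_le (by isBoundedDefault) fun b hb => by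
    obtain ⟨n, hn⟩ := hb.exists
    exact hn.trans (h1 n)

/-- Cauchy's functional equation on `[0, ∞)`, for solutions of at most linear growth. -/
theorem additive_eq_mul {f : ℝ≥0 → ℝ≥0∞} {C : ℝ≥0∞} (hC : C ≠ ∞)
    (hadd : ∀ x y, f (x + y) = f x + f y) (hle : ∀ x, f x ≤ C * x) (x : ℝ≥0) : f x = f 1 * x := by
  have hfin : ∀ x, f x ≠ ∞ := fun x => ne_top_of_le_ne_top (ENNReal.mul_ne_top hC (by simp)) (hle x)
  set g : ℝ≥0 → ℝ := fun x => (f x).toReal with hg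
  have gadd : ∀ x y, g (x + y) = g x + g y := fun x y => by
    simp only [hg, hadd]; exact ENNReal.toReal_add (hfin x) (hfin y)
  have gnn : ∀ x, 0 ≤ g x := fun x => ENNReal.toReal_nonneg
  have gle : ∀ x, g x ≤ C.toReal * x := fun x => by
    have := ENNReal.toReal_mono (ENNReal.mul_ne_top hC (by simp)) (hle x)
    simpa using this
  have g0 : g 0 = 0 := le_antisymm (by simpa using gle 0) (gnn 0)
  have gnat : ∀ (n : ℕ) y, g (n * y) = n * g y := fun n y => by
    induction n with
    | zero => simp [g0]
    | succ n ih => push_cast; rw [add_mul, gadd, ih, one_mul]; ring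
  have hbound : ∀ n : ℕ, |n * (g x - g 1 * x)| ≤ C.toReal + g 1 := fun n => by
    obtain ⟨r, hr⟩ := exists_add_of_le (Nat.floor_le (zero_le : 0 ≤ (n : ℝ≥0) * x))
    have hr1 : (r : ℝ) ≤ 1 := by
      have h1 : (n : ℝ≥0) * x < ⌊(n : ℝ≥0) * x⌋₊ + 1 := Nat.lt_floor_add_one _
      rw [hr] at h1
      have h2 : r < 1 := by
        have := h1
        rw [← hr] at this
        exact lt_of_add_lt_add_left (a := (⌊(n : ℝ≥0) * x⌋₊ : ℝ≥0)) (hr ▸ this)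
      exact_mod_cast h2.le
    have e1 : n * g x = ⌊(n : ℝ≥0) * x⌋₊ * g 1 + g r := by
      rw [← gnat, ← gnat, mul_one, ← gadd, ← hr]
    have e2 : (n : ℝ) * x = ⌊(n : ℝ≥0) * x⌋₊ + r := by exact_mod_cast hr
    have e3 : n * (g x - g 1 * x) = g r - g 1 * r := by
      rw [mul_sub, e1, mul_left_comm, e2]; ring
    rw [e3, abs_le]
    have h3 := gle r
    have h4 := gnn r
    have h5 := gnn 1
    have h6 : (0 : ℝ) ≤ r := r.2
    have h7 : (0 : ℝ) ≤ C.toReal := ENNReal.toReal_nonneg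
    constructor <;> nlinarith
  have hz : g x - g 1 * x = 0 := by
    by_contra hne
    obtain ⟨n, hn⟩ := exists_nat_gt ((C.toReal + g 1) / |g x - g 1 * x|)
    rw [div_lt_iff₀ (abs_pos.2 hne)] at hn
    have := hbound n
    rw [abs_mul, Nat.abs_cast] at this
    linarith
  rw [← ENNReal.toReal_eq_toReal_iff' (hfin x) (ENNReal.mul_ne_top (hfin 1) (by simp)),
    ENNReal.toReal_mul]
  simp only [ENNReal.coe_toReal]
  linarith

/-- The mean of the `γ`-variation over a time interval of length one. -/
def variationRate (γ : ℝ) (P : Measure Ω) (X : ℝ≥0 → Ω → ℚ_[p]) : ℝ≥0∞ :=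
  ∫⁻ ω, jumpPow γ (fun t => X t ω) 0 (0 + 1) ∂P

theorem IsLevyProcess.variationRate_ne_top (hX : IsLevyProcess a 𝓕 P X) (ha : IsRateSequence a)
    (hγ : 0 < γ) (hs : SummableMoment p γ a) : variationRate γ P X ≠ ∞ :=
  ne_top_of_le_ne_top (ENNReal.mul_ne_top (momentConst_ne_top ha hs) (by simp))
    (hX.lintegral_jumpPow_le ha hγ 0 1)

/-- By stationarity and additivity, the mean `γ`-variation over `(u, u + h]` is proportional to
`h`. -/
theorem IsLevyProcess.lintegral_jumpPow (hX : IsLevyProcess a 𝓕 P X) (ha : IsRateSequence a)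
    (hγ : 0 < γ) (hs : SummableMoment p γ a) (u h : ℝ≥0) :
    ∫⁻ ω, jumpPow γ (fun t => X t ω) u (u + h) ∂P = variationRate γ P X * h := by
  have hC := momentConst_ne_top ha hs
  have hlim : ∀ u h, Tendsto (fun n => ∫⁻ ω, gridPow γ (fun t => X t ω) u h n ∂P) atTop
      (𝓝 (∫⁻ ω, jumpPow γ (fun t => X t ω) u (u + h) ∂P)) := fun u h =>
    tendsto_lintegral_of_dominated_convergence (fun ω => jumpPow γ (fun t => X t ω) u (u + h))
      (fun n => (measurable_gridPow_future u h n).mono (hX.future_le u) le_rfl)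
      (fun n => Eventually.of_forall fun ω => (hX.cadlag ω).gridPow_le hγ u h n)
      (ne_top_of_le_ne_top (ENNReal.mul_ne_top hC (by simp)) (hX.lintegral_jumpPow_le ha hγ u h))
      (Eventually.of_forall fun ω => (hX.cadlag ω).tendsto_gridPow hγ u h)
  have hstat : ∀ u h, ∫⁻ ω, jumpPow γ (fun t => X t ω) u (u + h) ∂P =
      ∫⁻ ω, jumpPow γ (fun t => X t ω) 0 (0 + h) ∂P := fun u h => by
    refine tendsto_nhds_unique (hlim u h) ((hlim 0 h).congr fun n => ?_)
    rw [hX.lintegral_gridPow, hX.lintegral_gridPow]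
  rw [hstat]
  refine additive_eq_mul (f := fun h => ∫⁻ ω, jumpPow γ (fun t => X t ω) 0 (0 + h) ∂P) hC
    (fun x y => ?_) (fun x => hX.lintegral_jumpPow_le ha hγ 0 x) h
  rw [← hstat (0 + x) y, ← lintegral_add_left (hX.measurable_jumpPow hγ 0 x)]
  congr 1
  ext ω
  rw [jumpPow_add _ le_self_add le_self_add, add_assoc]

end Variation

/-! ### The compensation formula -/

section Compensation

variable {p : ℕ} [hp : Fact p.Prime] {γ : ℝ}

/-- Lebesgue measure on `(0, T]`, as a measure on `ℝ≥0`. -/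
def timeMeasure (T : ℝ≥0) : Measure ℝ≥0 :=
  (volume.restrict (Set.Ioc (0 : ℝ) T)).map Real.toNNReal

instance isFiniteMeasure_timeMeasure (T : ℝ≥0) : IsFiniteMeasure (timeMeasure T) := by
  unfold timeMeasure
  infer_instance

theorem timeMeasure_Ioi (T u : ℝ≥0) : timeMeasure T (Set.Ioi u) = ((T - u : ℝ≥0) : ℝ≥0∞) := by
  rw [timeMeasure, Measure.map_apply measurable_real_toNNReal measurableSet_Ioi,
    Measure.restrict_apply (measurable_real_toNNReal measurableSet_Ioi)]
  have : Real.toNNReal ⁻¹' Set.Ioi u ∩ Set.Ioc 0 (T : ℝ) = Set.Ioc (u : ℝ) T := by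
    ext t
    simp only [Set.mem_inter_iff, Set.mem_preimage, Set.mem_Ioi, Set.mem_Ioc,
      Real.lt_toNNReal_iff_coe_lt]
    exact ⟨fun h => ⟨h.1, h.2.2⟩, fun h => ⟨h.1, u.2.trans_lt h.1, h.2⟩⟩
  rw [this, Real.volume_Ioc, ENNReal.ofReal, ← NNReal.sub_def]

theorem timeMeasure_singleton (T s : ℝ≥0) : timeMeasure T {s} = 0 := by
  rw [timeMeasure, Measure.map_apply measurable_real_toNNReal (measurableSet_singleton s),
    Measure.restrict_apply (measurable_real_toNNReal (measurableSet_singleton s))]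
  refine measure_mono_null (t := {(s : ℝ)}) ?_ Real.volume_singleton
  rintro t ⟨h1, h2⟩
  rw [Set.mem_preimage, Set.mem_singleton_iff] at h1
  rw [Set.mem_singleton_iff, ← h1, Real.coe_toNNReal _ h2.1.le]

theorem timeMeasure_Iic_compl (T : ℝ≥0) : timeMeasure T (Set.Iic T)ᶜ = 0 := by
  rw [Set.compl_Iic, timeMeasure_Ioi, tsub_self, ENNReal.coe_zero]

theorem timeMeasure_univ (T : ℝ≥0) : timeMeasure T Set.univ = T := by
  have h : (Set.univ : Set ℝ≥0) = {0} ∪ Set.Ioi 0 := by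
    ext s; simp
  refine le_antisymm ?_ ?_
  · rw [h]
    refine (measure_union_le _ _).trans ?_
    rw [timeMeasure_singleton, timeMeasure_Ioi, zero_add, tsub_zero]
  · have := measure_mono (μ := timeMeasure T) (Set.subset_univ (Set.Ioi 0))
    rwa [timeMeasure_Ioi, tsub_zero] at this

variable {Ω : Type*} {mΩ : MeasurableSpace Ω} {P : Measure Ω} {𝓕 : Filtration ℝ≥0 mΩ}
  {X : ℝ≥0 → Ω → ℚ_[p]} {a : ℤ → ℝ}

theorem predictable_le (𝓕 : Filtration ℝ≥0 mΩ) :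
    𝓕.predictable ≤ (inferInstance : MeasurableSpace (ℝ≥0 × Ω)) :=
  measurableSpace_le_predictable_of_measurableSet
    (fun _ hA => (measurableSet_singleton _).prod (𝓕.le _ _ hA))
    fun _ _ hA => measurableSet_Ioi.prod (𝓕.le _ _ hA)

theorem isPiSystem_predictable (𝓕 : Filtration ℝ≥0 mΩ) :
    IsPiSystem ({s | ∃ A, MeasurableSet[𝓕 ⊥] A ∧ s = {⊥} ×ˢ A} ∪
      {s | ∃ i A, MeasurableSet[𝓕 i] A ∧ s = Set.Ioi i ×ˢ A} : Set (Set (ℝ≥0 × Ω))) := by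
  rintro _ (⟨A, hA, rfl⟩ | ⟨i, A, hA, rfl⟩) _ (⟨B, hB, rfl⟩ | ⟨j, B, hB, rfl⟩) hne
  · exact Or.inl ⟨A ∩ B, hA.inter hB, by rw [Set.prod_inter_prod, Set.inter_self]⟩
  · obtain ⟨x, hx⟩ := hne
    have h1 : x.1 = ⊥ := hx.1.1
    have h2 : j < x.1 := hx.2.1
    rw [h1] at h2
    exact absurd h2 not_lt_bot
  · obtain ⟨x, hx⟩ := hne
    have h1 : x.1 = ⊥ := hx.2.1
    have h2 : i < x.1 := hx.1.1
    rw [h1] at h2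
    exact absurd h2 not_lt_bot
  · refine Or.inr ⟨max i j, A ∩ B, ?_, ?_⟩
    · exact (𝓕.mono (le_max_left i j) _ hA).inter (𝓕.mono (le_max_right i j) _ hB)
    · rw [Set.prod_inter_prod, Set.Ioi_inter_Ioi]

theorem energy_eq [SFinite P] (T : ℝ≥0) {φ : ℝ≥0 → Ω → ℚ_[p]}
    (hφ : Measurable fun x : ℝ≥0 × Ω => φ x.1 x.2) :
    energy P γ T φ = ∫⁻ x : ℝ≥0 × Ω, ‖φ x.1 x.2‖ₑ ^ γ ∂((timeMeasure T).prod P) := by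
  have h : Measurable fun x : ℝ≥0 × Ω => ‖φ x.1 x.2‖ₑ ^ γ := hφ.enorm.pow_const γ
  rw [lintegral_prod_symm _ h.aemeasurable, energy]
  congr 1
  ext ω
  have h' : Measurable fun s => ‖φ s ω‖ₑ ^ γ := h.comp measurable_prodMk_right
  rw [timeMeasure, lintegral_map h' measurable_real_toNNReal]

/-- The sum `∑ h(s) ‖Δζ(s)‖^γ` over the times `s` in `(0, T]`. -/
def jumpSum (γ : ℝ) (T : ℝ≥0) (ζ : ℝ≥0 → ℚ_[p]) (h : ℝ≥0 → ℝ≥0∞) : ℝ≥0∞ :=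
  ∑' s, (Set.Ioc 0 T).indicator (fun s => h s * ‖jump ζ s‖ₑ ^ γ) s

theorem jumpSum_add (T : ℝ≥0) (ζ : ℝ≥0 → ℚ_[p]) (h k : ℝ≥0 → ℝ≥0∞) :
    jumpSum γ T ζ (fun s => h s + k s) = jumpSum γ T ζ h + jumpSum γ T ζ k := by
  rw [jumpSum, jumpSum, jumpSum, ← ENNReal.tsum_add]
  congr 1
  ext s
  by_cases hs : s ∈ Set.Ioc 0 T
  · simp [hs, add_mul]
  · simp [hs]

theorem jumpSum_const_mul (T : ℝ≥0) (ζ : ℝ≥0 → ℚ_[p]) (c : ℝ≥0∞) (h : ℝ≥0 → ℝ≥0∞) :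
    jumpSum γ T ζ (fun s => c * h s) = c * jumpSum γ T ζ h := by
  rw [jumpSum, jumpSum, ← ENNReal.tsum_mul_left]
  congr 1
  ext s
  by_cases hs : s ∈ Set.Ioc 0 T
  · simp [hs, mul_assoc]
  · simp [hs]

theorem jumpSum_tsum (T : ℝ≥0) (ζ : ℝ≥0 → ℚ_[p]) (h : ℕ → ℝ≥0 → ℝ≥0∞) :
    jumpSum γ T ζ (fun s => ∑' n, h n s) = ∑' n, jumpSum γ T ζ (h n) := by
  simp only [jumpSum]
  rw [ENNReal.tsum_comm]
  congr 1
  ext s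
  by_cases hs : s ∈ Set.Ioc 0 T
  · simp [hs, ENNReal.tsum_mul_right]
  · simp [hs]

theorem jumpSum_mono (T : ℝ≥0) (ζ : ℝ≥0 → ℚ_[p]) {h k : ℝ≥0 → ℝ≥0∞} (hk : ∀ s, h s ≤ k s) :
    jumpSum γ T ζ h ≤ jumpSum γ T ζ k := by
  refine ENNReal.tsum_le_tsum fun s => Set.indicator_le_indicator ?_
  exact mul_le_mul_left (hk s) _

theorem jumpSum_iSup (T : ℝ≥0) (ζ : ℝ≥0 → ℚ_[p]) {h : ℕ → ℝ≥0 → ℝ≥0∞}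
    (hmono : ∀ s, Monotone fun n => h n s) :
    jumpSum γ T ζ (fun s => ⨆ n, h n s) = ⨆ n, jumpSum γ T ζ (h n) := by
  have h1 : ∀ s, (Set.Ioc 0 T).indicator (fun s => (⨆ n, h n s) * ‖jump ζ s‖ₑ ^ γ) s =
      ⨆ n, (Set.Ioc 0 T).indicator (fun s => h n s * ‖jump ζ s‖ₑ ^ γ) s := fun s => by
    by_cases hs : s ∈ Set.Ioc 0 T
    · simp [hs, ENNReal.iSup_mul]
    · simp [hs]
  simp only [jumpSum, h1, ENNReal.tsum_eq_iSup_sum]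
  rw [iSup_comm]
  congr 1
  ext F
  refine ENNReal.finsetSum_iSup_of_monotone fun s m n hmn => ?_
  exact Set.indicator_le_indicator (mul_le_mul_left (hmono s hmn) _)

theorem jumpSum_one (T : ℝ≥0) (ζ : ℝ≥0 → ℚ_[p]) : jumpSum γ T ζ (fun _ => 1) = jumpPow γ ζ 0 T := by
  simp [jumpSum, jumpPow]

variable [IsProbabilityMeasure P]

/-- The compensation formula for a predictable set: by independence of the increments for the
generating rectangles, and by a Dynkin argument in general. -/
theorem IsLevyProcess.compensation_set (hX : IsLevyProcess a 𝓕 P X) (ha : IsRateSequence a)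
    (hγ : 0 < γ) (hs : SummableMoment p γ a) (T : ℝ≥0) {S : Set (ℝ≥0 × Ω)}
    (hS : MeasurableSet[𝓕.predictable] S) :
    AEMeasurable (fun ω => jumpSum γ T (fun t => X t ω) fun s => S.indicator 1 (s, ω)) P ∧
    ∫⁻ ω, jumpSum γ T (fun t => X t ω) (fun s => S.indicator 1 (s, ω)) ∂P =
      variationRate γ P X * ((timeMeasure T).prod P) S := by
  have htot : ∀ ω, jumpSum γ T (fun t => X t ω) (fun _ => 1) =
      jumpPow γ (fun t => X t ω) 0 (0 + T) := fun ω => by rw [jumpSum_one, zero_add]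
  have htotm : Measurable fun ω => jumpSum γ T (fun t => X t ω) (fun _ => 1) := by
    simp_rw [htot]; exact hX.measurable_jumpPow hγ 0 T
  have htoti : ∫⁻ ω, jumpSum γ T (fun t => X t ω) (fun _ => 1) ∂P = variationRate γ P X * T := by
    simp_rw [htot]; exact hX.lintegral_jumpPow ha hγ hs 0 T
  have hc := hX.variationRate_ne_top ha hγ hs
  induction S, hS using MeasurableSpace.induction_on_inter (m := 𝓕.predictable)
      (h_eq := rfl) (isPiSystem_predictable 𝓕) with
  | empty => simp [jumpSum]
  | basic S hS =>
    rcases hS with ⟨A, hA, rfl⟩ | ⟨u, A, hA, rfl⟩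
    · have h0 : ∀ ω, jumpSum γ T (fun t => X t ω)
          (fun s => (({⊥} : Set ℝ≥0) ×ˢ A).indicator (1 : ℝ≥0 × Ω → ℝ≥0∞) (s, ω)) = 0 := fun ω => by
        refine ENNReal.tsum_eq_zero.2 fun s => ?_
        by_cases hs : s ∈ Set.Ioc 0 T
        · have : s ≠ ⊥ := hs.1.ne'
          have h : (s, ω) ∉ ({⊥} : Set ℝ≥0) ×ˢ A := fun h => this h.1
          rw [Set.indicator_of_mem hs]
          simp only [Set.indicator_of_notMem h, zero_mul]
        · simp [hs]
      simp_rw [h0]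
      refine ⟨aemeasurable_const, ?_⟩
      rw [Measure.prod_prod, timeMeasure_singleton]
      simp
    · rcases le_or_gt T u with hTu | huT
      · have h0 : ∀ ω, jumpSum γ T (fun t => X t ω)
            (fun s => (Set.Ioi u ×ˢ A).indicator (1 : ℝ≥0 × Ω → ℝ≥0∞) (s, ω)) = 0 := fun ω => by
          refine ENNReal.tsum_eq_zero.2 fun s => ?_
          by_cases hs : s ∈ Set.Ioc 0 T
          · simp [Set.indicator, hs.2.trans hTu]
          · simp [hs]
        simp_rw [h0]
        refine ⟨aemeasurable_const, ?_⟩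
        rw [Measure.prod_prod, timeMeasure_Ioi, tsub_eq_zero_of_le hTu]
        simp
      · have h0 : ∀ ω, jumpSum γ T (fun t => X t ω)
            (fun s => (Set.Ioi u ×ˢ A).indicator (1 : ℝ≥0 × Ω → ℝ≥0∞) (s, ω)) =
            A.indicator 1 ω * jumpPow γ (fun t => X t ω) u (u + (T - u)) := fun ω => by
          rw [jumpSum, jumpPow, ← ENNReal.tsum_mul_left, add_tsub_cancel_of_le huT.le]
          congr 1
          ext s
          by_cases hs : s ∈ Set.Ioc u T
          · have hs' : s ∈ Set.Ioc 0 T := ⟨zero_le.trans_lt hs.1, hs.2⟩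
            have h1 : u < s := hs.1
            rw [Set.indicator_of_mem hs, Set.indicator_of_mem hs']
            congr 1
            by_cases hω : ω ∈ A <;> simp [hω, Set.indicator, h1]
          · by_cases hs' : s ∈ Set.Ioc 0 T
            · have h1 : ¬ u < s := fun h => hs ⟨h, hs'.2⟩
              simp [Set.indicator, h1]
            · simp [hs, hs']
        have hAm : Measurable[𝓕 u] (A.indicator (1 : Ω → ℝ≥0∞)) := by
          change Measurable[𝓕 u] (A.indicator fun _ => (1 : ℝ≥0∞))
          exact Measurable.indicator (m := 𝓕 u) measurable_const hA
        have hJ := hX.measurable_jumpPow_future hγ u (T - u)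
        have hJ' := hX.measurable_jumpPow hγ u (T - u)
        simp_rw [h0]
        refine ⟨((hAm.mono (𝓕.le u) le_rfl).mul hJ').aemeasurable, ?_⟩
        rw [lintegral_mul_eq_lintegral_mul_lintegral_of_independent_measurableSpace (𝓕.le u)
          (hX.future_le u) (hX.indep u) hAm hJ, hX.lintegral_jumpPow ha hγ hs,
          lintegral_indicator_one (𝓕.le u _ hA), Measure.prod_prod, timeMeasure_Ioi]
        ring
  | compl S hS ih =>
    obtain ⟨ihm, ihi⟩ := ih
    have hadd : ∀ ω, jumpSum γ T (fun t => X t ω) (fun s => S.indicator 1 (s, ω)) +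
        jumpSum γ T (fun t => X t ω) (fun s => Sᶜ.indicator 1 (s, ω)) =
        jumpSum γ T (fun t => X t ω) (fun _ => 1) := fun ω => by
      rw [← jumpSum_add]
      congr 1
      ext s
      by_cases h : (s, ω) ∈ S <;> simp [h]
    have hfin : ∫⁻ ω, jumpSum γ T (fun t => X t ω) (fun s => S.indicator 1 (s, ω)) ∂P ≠ ∞ := by
      rw [ihi]; exact ENNReal.mul_ne_top hc (measure_ne_top _ _)
    have hae : (fun ω => jumpSum γ T (fun t => X t ω) (fun s => Sᶜ.indicator 1 (s, ω))) =ᵐ[P]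
        fun ω => jumpSum γ T (fun t => X t ω) (fun _ => 1) -
          jumpSum γ T (fun t => X t ω) (fun s => S.indicator 1 (s, ω)) := by
      filter_upwards [ae_lt_top' ihm hfin] with ω hω
      rw [← hadd ω, ENNReal.add_sub_cancel_left hω.ne]
    refine ⟨(htotm.aemeasurable.sub ihm).congr hae.symm, ?_⟩
    rw [lintegral_congr_ae hae, lintegral_sub' ihm hfin (Eventually.of_forall fun ω => by
      rw [← hadd ω]; exact le_self_add), htoti, ihi, measure_compl (predictable_le 𝓕 _ hS)
      (measure_ne_top _ _), ← Set.univ_prod_univ, Measure.prod_prod, timeMeasure_univ, measure_univ,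
      mul_one, ENNReal.mul_sub fun _ _ => hc]
  | iUnion f hd hf ih =>
    have hsum : ∀ ω, jumpSum γ T (fun t => X t ω) (fun s => (⋃ i, f i).indicator 1 (s, ω)) =
        ∑' i, jumpSum γ T (fun t => X t ω) (fun s => (f i).indicator 1 (s, ω)) := fun ω => by
      rw [← jumpSum_tsum]
      congr 1
      ext s
      by_cases h : ∃ i, (s, ω) ∈ f i
      · obtain ⟨i, hi⟩ := h
        rw [Set.indicator_of_mem (Set.mem_iUnion.2 ⟨i, hi⟩), tsum_eq_single i,
          Set.indicator_of_mem hi]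
        intro j hj
        exact Set.indicator_of_notMem (fun h => Set.disjoint_left.1 (hd hj) h hi) _
      · push Not at h
        rw [Set.indicator_of_notMem (by simpa using h)]
        exact (ENNReal.tsum_eq_zero.2 fun i => Set.indicator_of_notMem (h i) _).symm
    simp_rw [hsum]
    refine ⟨AEMeasurable.tsum fun i => (ih i).1, ?_⟩
    rw [lintegral_tsum fun i => (ih i).1, measure_iUnion hd fun i => predictable_le 𝓕 _ (hf i),
      ← ENNReal.tsum_mul_left]
    exact tsum_congr fun i => (ih i).2

/-- The compensation formula: `E ∑_{s ≤ T} h(s) ‖ΔX(s)‖^γ = c E ∫_0^T h(s) ds` for every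
predictable `h ≥ 0`. -/
theorem IsLevyProcess.compensation (hX : IsLevyProcess a 𝓕 P X) (ha : IsRateSequence a)
    (hγ : 0 < γ) (hs : SummableMoment p γ a) (T : ℝ≥0) {h : ℝ≥0 × Ω → ℝ≥0∞}
    (hh : Measurable[𝓕.predictable] h) :
    AEMeasurable (fun ω => jumpSum γ T (fun t => X t ω) fun s => h (s, ω)) P ∧
    ∫⁻ ω, jumpSum γ T (fun t => X t ω) (fun s => h (s, ω)) ∂P =
      variationRate γ P X * ∫⁻ x, h x ∂((timeMeasure T).prod P) := by
  refine @Measurable.ennreal_induction _ 𝓕.predictable (fun h =>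
    AEMeasurable (fun ω => jumpSum γ T (fun t => X t ω) fun s => h (s, ω)) P ∧
    ∫⁻ ω, jumpSum γ T (fun t => X t ω) (fun s => h (s, ω)) ∂P =
      variationRate γ P X * ∫⁻ x, h x ∂((timeMeasure T).prod P)) ?_ ?_ ?_ h hh
  · intro c S hS
    obtain ⟨h1, h2⟩ := hX.compensation_set ha hγ hs T hS
    have hrw : ∀ x, S.indicator (fun _ => c) x = c * S.indicator (1 : ℝ≥0 × Ω → ℝ≥0∞) x :=
      fun x => by by_cases hx : x ∈ S <;> simp [hx]
    simp_rw [hrw, jumpSum_const_mul]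
    have hSm := predictable_le 𝓕 _ hS
    refine ⟨h1.const_mul c, ?_⟩
    rw [lintegral_const_mul'' c h1, h2, lintegral_const_mul c (measurable_one.indicator hSm),
      lintegral_indicator_one hSm]
    ring
  · intro f g _ hf hg ihf ihg
    have hf' : Measurable f := hf.mono (predictable_le 𝓕) le_rfl
    simp only [Pi.add_apply, jumpSum_add]
    refine ⟨ihf.1.add ihg.1, ?_⟩
    rw [lintegral_add_left' ihf.1, lintegral_add_left hf', ihf.2, ihg.2, mul_add]
  · intro f hf hmono ih
    have hsup : ∀ ω, jumpSum γ T (fun t => X t ω) (fun s => ⨆ n, f n (s, ω)) =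
        ⨆ n, jumpSum γ T (fun t => X t ω) (fun s => f n (s, ω)) := fun ω =>
      jumpSum_iSup T _ fun s m n hmn => hmono hmn (s, ω)
    simp_rw [hsup]
    refine ⟨AEMeasurable.iSup fun n => (ih n).1, ?_⟩
    rw [lintegral_iSup' (fun n => (ih n).1) (Eventually.of_forall fun ω m n hmn =>
        jumpSum_mono T _ fun s => hmono hmn (s, ω)),
      lintegral_iSup (fun n => (hf n).mono (predictable_le 𝓕) le_rfl) hmono, ENNReal.mul_iSup]
    exact iSup_congr fun n => (ih n).2

end Compensation

/-! ### Density of the simple processes -/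

/-- A class of functions closed under sums and negation and containing the constant multiples of
the indicators of a generating π-system is dense in `L^q` of a finite measure. -/
theorem exists_approx_of_piSystem {α E : Type*} [m0 : MeasurableSpace α] [NormedAddCommGroup E]
    {μ : Measure α} [IsFiniteMeasure μ] {q : ℝ≥0∞} (hq1 : 1 ≤ q) (hq : q ≠ ∞) {C : Set (Set α)}
    (hgen : m0 = MeasurableSpace.generateFrom C) (hpi : IsPiSystem C) (D : (α → E) → Prop)
    (hadd : ∀ f g, D f → D g → D (f + g)) (hneg : ∀ f, D f → D (-f))
    (hm : ∀ f, D f → AEStronglyMeasurable f μ) (hconst : ∀ c, D fun _ => c)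
    (hind : ∀ c, ∀ S ∈ C, D (S.indicator fun _ => c)) {f : α → E} (hf : MemLp f q μ) {ε : ℝ≥0∞}
    (hε : ε ≠ 0) : ∃ g, eLpNorm (f - g) q μ ≤ ε ∧ D g := by
  refine MemLp.induction_dense hq D ?_ hadd hm hf hε
  intro c S hS _ ε hε
  induction S, hS using MeasurableSpace.induction_on_inter (h_eq := hgen) hpi generalizing ε with
  | empty => exact ⟨fun _ => 0, by simp, hconst 0⟩
  | basic S hS => exact ⟨S.indicator fun _ => c, by simp, hind c S hS⟩
  | compl S hS ih =>
    obtain ⟨g, hg, hgD⟩ := ih (measure_lt_top _ _) hε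
    refine ⟨(fun _ => c) + -g, ?_, hadd _ _ (hconst c) (hneg _ hgD)⟩
    have : (fun _ => c) + -g - Sᶜ.indicator (fun _ => c) = -(g - S.indicator fun _ => c) := by
      ext x
      by_cases hx : x ∈ S <;> simp [hx, sub_eq_add_neg, add_comm]
    rwa [this, eLpNorm_neg]
  | iUnion s hd hs ih =>
    have hε2 : ε / 2 ≠ 0 := (ENNReal.half_pos hε).ne'
    obtain ⟨η, hη, hηs⟩ := exists_eLpNorm_indicator_le (μ := μ) hq c hε2
    obtain ⟨n, hn⟩ := ((tendsto_measure_biUnion_Ici_zero_of_pairwise_disjoint (μ := μ)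
      (fun i => (hs i).nullMeasurableSet) hd).eventually_le_const
        (ENNReal.coe_pos.2 hη)).exists
    -- finite unions are handled by adding up approximations
    have hfin : ∀ n : ℕ, ∀ δ : ℝ≥0∞, δ ≠ 0 → ∃ g,
        eLpNorm (g - (⋃ i ∈ Set.Iio n, s i).indicator fun _ => c) q μ ≤ δ ∧ D g := by
      intro n
      induction n with
      | zero => exact fun δ _ => ⟨fun _ => 0, by simp, hconst 0⟩
      | succ n ihn =>
        intro δ hδ
        have hδ2 : δ / 2 ≠ 0 := (ENNReal.half_pos hδ).ne'
        obtain ⟨g, hg, hgD⟩ := ihn _ hδ2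
        obtain ⟨g', hg', hgD'⟩ := ih n (measure_lt_top _ _) hδ2
        refine ⟨g + g', ?_, hadd _ _ hgD hgD'⟩
        have h1 : g + g' - (⋃ i ∈ Set.Iio (n + 1), s i).indicator (fun _ => c) =
            (g - (⋃ i ∈ Set.Iio n, s i).indicator fun _ => c) +
              (g' - (s n).indicator fun _ => c) := by
          have hu : (⋃ i ∈ Set.Iio (n + 1), s i) = (⋃ i ∈ Set.Iio n, s i) ∪ s n := by
            ext x
            simp only [Set.mem_iUnion, Set.mem_Iio, Set.mem_union, Nat.lt_succ_iff_lt_or_eq,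
              exists_prop, or_and_right, exists_or, exists_eq_left]
          have hdis : Disjoint (⋃ i ∈ Set.Iio n, s i) (s n) := by
            rw [Set.disjoint_iUnion₂_left]
            exact fun i hi => hd (ne_of_lt hi)
          rw [hu, Set.indicator_union_of_disjoint hdis]
          ext x
          simp only [Pi.sub_apply, Pi.add_apply]
          abel
        rw [h1]
        refine (eLpNorm_add_le ?_ ?_ hq1).trans
          ((add_le_add hg hg').trans_eq (ENNReal.add_halves _))
        · exact (hm _ hgD).sub (aestronglyMeasurable_const.indicator
            (MeasurableSet.biUnion (Set.to_countable _) fun i _ => hs i))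
        · exact (hm _ hgD').sub (aestronglyMeasurable_const.indicator (hs n))
    obtain ⟨g, hg, hgD⟩ := hfin n _ hε2
    refine ⟨g, ?_, hgD⟩
    have h1 : g - (⋃ i, s i).indicator (fun _ => c) =
        (g - (⋃ i ∈ Set.Iio n, s i).indicator fun _ => c) +
          -((⋃ i ≥ n, s i).indicator fun _ => c) := by
      have hu : (⋃ i, s i) = (⋃ i ∈ Set.Iio n, s i) ∪ ⋃ i ≥ n, s i := by
        ext x
        simp only [Set.mem_iUnion, Set.mem_Iio, Set.mem_union, exists_prop, ← exists_or,
          ← or_and_right, ge_iff_le, lt_or_ge, true_and]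
      have hdis : Disjoint (⋃ i ∈ Set.Iio n, s i) (⋃ i ≥ n, s i) := by
        simp only [Set.disjoint_iUnion_left, Set.disjoint_iUnion_right]
        exact fun i hi j hj => hd (ne_of_lt (lt_of_lt_of_le hj hi))
      rw [hu, Set.indicator_union_of_disjoint hdis]
      ext x
      simp only [Pi.sub_apply, Pi.add_apply, Pi.neg_apply]
      abel
    rw [h1]
    refine (eLpNorm_add_le ?_ ?_ hq1).trans ?_
    · exact (hm _ hgD).sub (aestronglyMeasurable_const.indicator
        (MeasurableSet.biUnion (Set.to_countable _) fun i _ => hs i))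
    · exact (aestronglyMeasurable_const.indicator
        (MeasurableSet.biUnion (Set.to_countable _) fun i _ => hs i)).neg
    · rw [eLpNorm_neg]
      exact (add_le_add hg (hηs _ hn)).trans_eq (ENNReal.add_halves _)

/-- A finite set of times cuts `(0, T]` into finitely many intervals. -/
theorem exists_subdivision (A : Finset ℝ≥0) {T : ℝ≥0} (hT : 0 < T) :
    ∃ (n : ℕ) (τ : ℕ → ℝ≥0), τ 0 = 0 ∧ τ n = T ∧ (∀ i < n, τ i < τ (i + 1)) ∧
      ∀ i < n, ∀ a ∈ A, a ∉ Set.Ioo (τ i) (τ (i + 1)) := by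
  classical
  set B : Finset ℝ≥0 := insert 0 (insert T (A.filter (· ≤ T))) with hB
  have h0B : (0 : ℝ≥0) ∈ B := by simp [hB]
  have hTB : T ∈ B := by simp [hB]
  have hBT : ∀ b ∈ B, b ≤ T := by
    intro b hb
    simp only [hB, Finset.mem_insert, Finset.mem_filter] at hb
    rcases hb with rfl | rfl | hb
    · exact hT.le
    · exact le_rfl
    · exact hb.2
  obtain ⟨n, hn⟩ : ∃ n, B.card = n + 1 :=
    Nat.exists_eq_succ_of_ne_zero (Finset.card_ne_zero_of_mem h0B)
  set e := B.orderEmbOfFin hn with he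
  have hlt : ∀ i, min i n < n + 1 := fun i => Nat.lt_succ_of_le (min_le_right i n)
  have hsurj : ∀ b ∈ B, ∃ k : Fin (n + 1), e k = b := fun b hb => by
    have : b ∈ Set.range e := by rw [he, Finset.range_orderEmbOfFin]; exact hb
    exact this
  refine ⟨n, fun i => e ⟨min i n, hlt i⟩, ?_, ?_, ?_, ?_⟩
  · obtain ⟨k, hk⟩ := hsurj 0 h0B
    refine le_antisymm ?_ zero_le
    rw [← hk]
    exact e.monotone (by simp)
  · refine le_antisymm (hBT _ (Finset.orderEmbOfFin_mem B hn _)) ?_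
    obtain ⟨k, hk⟩ := hsurj T hTB
    rw [← hk]
    exact e.monotone (by simp only [Fin.le_def, min_self]; omega)
  · intro i hi
    refine e.strictMono ?_
    simp only [Fin.lt_def]
    omega
  · rintro i hi a ha ⟨h1, h2⟩
    have haB : a ∈ B := by
      simp only [hB, Finset.mem_insert, Finset.mem_filter]
      exact Or.inr (Or.inr ⟨ha, h2.le.trans (hBT _ (Finset.orderEmbOfFin_mem B hn _))⟩)
    obtain ⟨k, rfl⟩ := hsurj a haB
    have h3 := e.lt_iff_lt.1 h1
    have h4 := e.lt_iff_lt.1 h2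
    simp only [Fin.lt_def] at h3 h4
    omega

section Simple

variable {p : ℕ} [hp : Fact p.Prime] {Ω : Type*} {mΩ : MeasurableSpace Ω} {P : Measure Ω}
  {𝓕 : Filtration ℝ≥0 mΩ} {T : ℝ≥0}

theorem measurable_indicator_rect {m' : MeasurableSpace Ω} {I : Set ℝ≥0} {f : Ω → ℚ_[p]}
    (hI : ∀ A, MeasurableSet[m'] A → MeasurableSet[𝓕.predictable] (I ×ˢ A))
    (hf : Measurable[m'] f) :
    Measurable[𝓕.predictable] fun x : ℝ≥0 × Ω => I.indicator (fun _ => f x.2) x.1 := by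
  classical
  intro S hS
  have hu : MeasurableSet[𝓕.predictable] (I ×ˢ (Set.univ : Set Ω)) :=
    hI _ (@MeasurableSet.univ Ω m')
  have h : (fun x : ℝ≥0 × Ω => I.indicator (fun _ => f x.2) x.1) ⁻¹' S =
      (I ×ˢ (f ⁻¹' S)) ∪ ((I ×ˢ Set.univ)ᶜ ∩ {_x | (0 : ℚ_[p]) ∈ S}) := by
    ext x
    by_cases hx : x.1 ∈ I <;> simp [hx]
  rw [h]
  refine @MeasurableSet.union _ 𝓕.predictable _ _ (hI _ (hf hS)) ?_
  refine @MeasurableSet.inter _ 𝓕.predictable _ _ (@MeasurableSet.compl _ _ 𝓕.predictable hu) ?_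
  exact @MeasurableSet.const _ 𝓕.predictable _

theorem SimpleIntegrand.measurable_process (φ : SimpleIntegrand p 𝓕 P T) :
    Measurable[𝓕.predictable] fun x : ℝ≥0 × Ω => φ.process x.1 x.2 := by
  refine Measurable.add (m := 𝓕.predictable) ?_ ?_
  · exact measurable_indicator_rect (fun A hA => measurableSet_predictable_singleton_bot_prod hA)
      φ.measurable_g
  · refine Finset.measurable_fun_sum (m := 𝓕.predictable) _ fun i hi => ?_
    exact measurable_indicator_rect (fun A hA => measurableSet_predictable_Ioc_prod _ _ hA)
      (φ.measurable_f i (Finset.mem_range.1 hi))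

/-- Off the finitely many times of `A`, the function `h` on `(0, T] × Ω` is constant in time, with
bounded and adapted values: these are the functions that simple processes represent. -/
def IsStep (𝓕 : Filtration ℝ≥0 mΩ) (T : ℝ≥0) (h : ℝ≥0 × Ω → ℚ_[p]) : Prop :=
  Measurable[𝓕.predictable] h ∧ ∃ A : Finset ℝ≥0, ∀ u v, u < v → v ≤ T →
    (∀ a ∈ A, a ∉ Set.Ioo u v) → ∃ f : Ω → ℚ_[p], Measurable[𝓕 u] f ∧ (∃ C : ℝ, ∀ ω, ‖f ω‖ ≤ C) ∧
      ∀ s ∈ Set.Ioc u v, ∀ ω, h (s, ω) = f ω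

theorem IsStep.add {h k : ℝ≥0 × Ω → ℚ_[p]} (hh : IsStep 𝓕 T h) (hk : IsStep 𝓕 T k) :
    IsStep 𝓕 T (h + k) := by
  classical
  obtain ⟨hm, A, hA⟩ := hh
  obtain ⟨hm', A', hA'⟩ := hk
  refine ⟨hm.add hm', A ∪ A', fun u v huv hv h => ?_⟩
  obtain ⟨f, hf, ⟨C, hC⟩, hfh⟩ := hA u v huv hv fun a ha => h a (Finset.mem_union_left _ ha)
  obtain ⟨f', hf', ⟨C', hC'⟩, hfh'⟩ := hA' u v huv hv fun a ha => h a (Finset.mem_union_right _ ha)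
  refine ⟨fun ω => f ω + f' ω, hf.add hf',
    ⟨C + C', fun ω => (norm_add_le _ _).trans (add_le_add (hC ω) (hC' ω))⟩, fun s hs ω => ?_⟩
  rw [Pi.add_apply, hfh s hs, hfh' s hs]

theorem IsStep.neg {h : ℝ≥0 × Ω → ℚ_[p]} (hh : IsStep 𝓕 T h) : IsStep 𝓕 T (-h) := by
  obtain ⟨hm, A, hA⟩ := hh
  refine ⟨hm.neg, A, fun u v huv hv h => ?_⟩
  obtain ⟨f, hf, ⟨C, hC⟩, hfh⟩ := hA u v huv hv h
  refine ⟨fun ω => -f ω, hf.neg, ⟨C, fun ω => ?_⟩, fun s hs ω => ?_⟩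
  · rw [norm_neg]; exact hC ω
  · rw [Pi.neg_apply, hfh s hs]

theorem isStep_const (c : ℚ_[p]) : IsStep 𝓕 T fun _ => c :=
  ⟨@measurable_const _ _ _ 𝓕.predictable c, ∅, fun u _ _ _ _ =>
    ⟨fun _ => c, @measurable_const _ _ _ (𝓕 u) c, ⟨‖c‖, fun _ => le_rfl⟩, fun _ _ _ => rfl⟩⟩

theorem isStep_indicator_Ioi (c : ℚ_[p]) {w : ℝ≥0} {A : Set Ω} (hA : MeasurableSet[𝓕 w] A) :
    IsStep 𝓕 T ((Set.Ioi w ×ˢ A).indicator fun _ => c) := by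
  refine ⟨Measurable.indicator (m := 𝓕.predictable) (@measurable_const _ _ _ 𝓕.predictable c)
    (measurableSet_predictable_Ioi_prod hA), {w}, fun u v huv _ h => ?_⟩
  rcases le_or_gt w u with hwu | hwu
  · refine ⟨A.indicator fun _ => c, Measurable.indicator (m := 𝓕 u)
      (@measurable_const _ _ _ (𝓕 u) c) (𝓕.mono hwu _ hA), ⟨‖c‖, fun ω => ?_⟩, fun s hs ω => ?_⟩
    · by_cases hω : ω ∈ A <;> simp [hω]
    · have hs' : w < s := hwu.trans_lt hs.1
      by_cases hω : ω ∈ A <;> simp [hω, hs', Set.indicator]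
  · have hvw : v ≤ w := by
      by_contra hlt
      exact h w (Finset.mem_singleton_self w) ⟨hwu, not_le.1 hlt⟩
    refine ⟨fun _ => 0, @measurable_const _ _ _ (𝓕 u) 0, ⟨0, fun _ => by simp⟩, fun s hs ω => ?_⟩
    have hs' : ¬ w < s := not_lt.2 (hs.2.trans hvw)
    simp [Set.indicator, hs']

theorem isStep_indicator_bot (c : ℚ_[p]) {A : Set Ω} (hA : MeasurableSet[𝓕 ⊥] A) :
    IsStep 𝓕 T ((({⊥} : Set ℝ≥0) ×ˢ A).indicator fun _ => c) := by
  refine ⟨Measurable.indicator (m := 𝓕.predictable) (@measurable_const _ _ _ 𝓕.predictable c)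
    (measurableSet_predictable_singleton_bot_prod hA), ∅, fun u v _ _ _ => ?_⟩
  refine ⟨fun _ => 0, @measurable_const _ _ _ (𝓕 u) 0, ⟨0, fun _ => by simp⟩, fun s hs ω => ?_⟩
  have hs' : (s, ω) ∉ ({⊥} : Set ℝ≥0) ×ˢ A := fun h => (not_lt_bot (a := u)) (h.1 ▸ hs.1)
  rw [Set.indicator_of_notMem hs']

theorem IsStep.exists_simple (P : Measure Ω) (hT : 0 < T) {h : ℝ≥0 × Ω → ℚ_[p]}
    (hh : IsStep 𝓕 T h) :
    ∃ ψ : SimpleIntegrand p 𝓕 P T, ∀ s ∈ Set.Ioc 0 T, ∀ ω, ψ.process s ω = h (s, ω) := by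
  obtain ⟨_, A, hA⟩ := hh
  obtain ⟨n, τ, h0, hn, hlt, hcell⟩ := exists_subdivision A hT
  have hmono : ∀ i ≤ n, ∀ j ≤ i, τ j ≤ τ i := by
    intro i
    induction i with
    | zero => intro _ j hj; rw [Nat.le_zero.1 hj]
    | succ i ih =>
      intro hi j hj
      rcases Nat.le_succ_iff.1 hj with h | h
      · exact (ih (by omega) j h).trans (hlt i (by omega)).le
      · rw [h]
  have hex : ∀ i, ∃ f : Ω → ℚ_[p], i < n → Measurable[𝓕 (τ i)] f ∧ (∃ C : ℝ, ∀ ω, ‖f ω‖ ≤ C) ∧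
      ∀ s ∈ Set.Ioc (τ i) (τ (i + 1)), ∀ ω, h (s, ω) = f ω := by
    intro i
    by_cases hi : i < n
    · obtain ⟨f, hf⟩ := hA (τ i) (τ (i + 1)) (hlt i hi)
        ((hmono n le_rfl _ hi).trans_eq hn) (hcell i hi)
      exact ⟨f, fun _ => hf⟩
    · exact ⟨fun _ => 0, fun h => absurd h hi⟩
  choose f hf using hex
  refine ⟨⟨n, τ, h0, hn, hlt, fun _ => 0, f, @measurable_const _ _ _ (𝓕 0) 0,
    fun i hi => (hf i hi).1, ⟨0, by simp⟩, fun i hi => ?_⟩, fun s hs ω => ?_⟩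
  · obtain ⟨C, hC⟩ := (hf i hi).2.1
    exact ⟨C, Eventually.of_forall hC⟩
  · obtain ⟨i, hi, hsi⟩ := exists_cell (τ := τ) (s := s) (j := n) (by rwa [h0, hn])
    simp only [SimpleIntegrand.process]
    rw [Finset.sum_eq_single i, Set.indicator_of_mem hsi, (hf i hi).2.2 s hsi]
    · simp
    · intro j hj hji
      refine Set.indicator_of_notMem (fun hsj => ?_) _
      rcases lt_or_gt_of_ne hji with h | h
      · exact absurd (hsj.2.trans (hmono i hi.le (j + 1) h)) (not_le.2 hsi.1)
      · exact absurd (hsi.2.trans (hmono j (Finset.mem_range.1 hj).le (i + 1) h)) (not_le.2 hsj.1)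
    · exact fun h => absurd (Finset.mem_range.2 hi) h

theorem ae_mem_Ioc_timeMeasure (T : ℝ≥0) : ∀ᵐ s ∂(timeMeasure T), s ∈ Set.Ioc 0 T := by
  refine measure_mono_null (t := {0} ∪ (Set.Iic T)ᶜ) ?_
    (measure_union_null (timeMeasure_singleton T 0) (timeMeasure_Iic_compl T))
  intro s hs
  by_contra h
  simp only [Set.mem_union, Set.mem_singleton_iff, Set.mem_compl_iff, Set.mem_Iic, not_or,
    not_not] at h
  exact hs ⟨pos_iff_ne_zero.2 h.1, h.2⟩

theorem MemL.measurable {γ : ℝ} {φ : ℝ≥0 → Ω → ℚ_[p]} (hφ : MemL 𝓕 P γ T φ) :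
    Measurable[𝓕.predictable] fun x : ℝ≥0 × Ω => φ x.1 x.2 :=
  StronglyMeasurable.measurable hφ.1

/-- The simple processes are dense in `𝓛^γ`. -/
theorem MemL.exists_simple [IsFiniteMeasure P] {γ : ℝ} (hγ : 1 ≤ γ) (hT : 0 < T)
    {φ : ℝ≥0 → Ω → ℚ_[p]} (hφ : MemL 𝓕 P γ T φ) {δ : ℝ≥0∞} (hδ : δ ≠ 0) :
    ∃ ψ : SimpleIntegrand p 𝓕 P T, energy P γ T (fun t ω => ψ.process t ω - φ t ω) ≤ δ := by
  have hγ0 : 0 < γ := zero_lt_one.trans_le hγ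
  have hqr : (ENNReal.ofReal γ).toReal = γ := ENNReal.toReal_ofReal hγ0.le
  have hq0 : ENNReal.ofReal γ ≠ 0 := (ENNReal.ofReal_pos.2 hγ0).ne'
  have hle := predictable_le 𝓕
  have hφm := hφ.measurable.mono hle le_rfl
  have hmem : MemLp (fun x : ℝ≥0 × Ω => φ x.1 x.2) (ENNReal.ofReal γ)
      (((timeMeasure T).prod P).trim hle) := by
    refine ⟨StronglyMeasurable.aestronglyMeasurable hφ.1, ?_⟩
    rw [eLpNorm_trim hle (show StronglyMeasurable[𝓕.predictable] fun x : ℝ≥0 × Ω => φ x.1 x.2 from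
      hφ.1), eLpNorm_eq_lintegral_rpow_enorm_toReal hq0 ENNReal.ofReal_ne_top,
      hqr, ← energy_eq T hφm]
    exact ENNReal.rpow_lt_top_of_nonneg (by positivity) hφ.2.ne
  have hδ' : δ ^ (1 / γ) ≠ 0 := by
    rw [Ne, ENNReal.rpow_eq_zero_iff]
    rintro (h | h)
    · exact hδ h.1
    · have := h.2; have : 0 < 1 / γ := by positivity
      linarith
  obtain ⟨g, hg, hgD⟩ := exists_approx_of_piSystem (m0 := 𝓕.predictable)
    (q := ENNReal.ofReal γ) (by simpa using ENNReal.ofReal_le_ofReal hγ) ENNReal.ofReal_ne_top rfl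
    (isPiSystem_predictable 𝓕) (IsStep 𝓕 T) (fun _ _ => IsStep.add) (fun _ => IsStep.neg)
    (fun f hf => (Measurable.stronglyMeasurable hf.1).aestronglyMeasurable) isStep_const (by
      rintro c S (⟨A, hA, rfl⟩ | ⟨u, A, hA, rfl⟩)
      · exact isStep_indicator_bot c hA
      · exact isStep_indicator_Ioi c hA) hmem hδ'
  obtain ⟨ψ, hψ⟩ := hgD.exists_simple P hT
  refine ⟨ψ, ?_⟩
  have hd : Measurable fun x : ℝ≥0 × Ω => ψ.process x.1 x.2 - φ x.1 x.2 :=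
    (ψ.measurable_process.mono hle le_rfl).sub hφm
  have hsm : StronglyMeasurable[𝓕.predictable] ((fun x : ℝ≥0 × Ω => φ x.1 x.2) - g) :=
    StronglyMeasurable.sub hφ.1 (Measurable.stronglyMeasurable hgD.1)
  rw [eLpNorm_trim hle hsm, eLpNorm_eq_lintegral_rpow_enorm_toReal hq0 ENNReal.ofReal_ne_top, hqr,
    ENNReal.rpow_le_rpow_iff (by positivity)] at hg
  rw [energy_eq T hd]
  refine (lintegral_mono_ae ?_).trans hg
  filter_upwards [Measure.quasiMeasurePreserving_fst.ae (ae_mem_Ioc_timeMeasure T)] with x hx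
  rw [hψ x.1 hx, Pi.sub_apply, enorm_sub_rev]

theorem SimpleIntegrand.sparse (φ : SimpleIntegrand p 𝓕 P T) {g : ℝ≥0 → ℚ_[p]} (hg : Sparse g)
    (ω : Ω) : Sparse fun s => φ.process s ω * g s := by
  have hC : ∃ C : ℝ, 0 < C ∧ ∀ s, ‖φ.process s ω‖ ≤ C := by
    refine ⟨‖φ.g ω‖ + ∑ i ∈ Finset.range φ.n, ‖φ.f i ω‖ + 1, by positivity, fun s => ?_⟩
    have h1 : ‖Set.indicator {0} (fun _ => φ.g ω) s‖ ≤ ‖φ.g ω‖ := norm_indicator_le_norm_self _ _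
    have h2 : ‖∑ i ∈ Finset.range φ.n, Set.indicator (Set.Ioc (φ.time i) (φ.time (i + 1)))
        (fun _ => φ.f i ω) s‖ ≤ ∑ i ∈ Finset.range φ.n, ‖φ.f i ω‖ :=
      norm_sum_le_of_le _ fun i _ => norm_indicator_le_norm_self _ _
    have h3 := norm_add_le (Set.indicator {0} (fun _ => φ.g ω) s)
      (∑ i ∈ Finset.range φ.n, Set.indicator (Set.Ioc (φ.time i) (φ.time (i + 1)))
        (fun _ => φ.f i ω) s)
    rw [SimpleIntegrand.process]
    linarith
  obtain ⟨C, hC0, hC⟩ := hC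
  refine fun t ε hε => (hg t (ε / C) (by positivity)).subset fun s hs => ⟨hs.1, ?_⟩
  have h1 := hs.2
  rw [norm_mul] at h1
  rw [div_lt_iff₀ hC0, mul_comm]
  exact h1.trans_le (mul_le_mul_of_nonneg_right (hC s) (norm_nonneg _))

/-- The integral of a simple process is the sum of its values times the jumps. -/
theorem SimpleIntegrand.integral_eq_cumSum (φ : SimpleIntegrand p 𝓕 P T) {X : ℝ≥0 → Ω → ℚ_[p]}
    {ω : Ω} (hX : IsCadlag fun t => X t ω) (t : ℝ≥0) :
    φ.integral X t ω = cumSum (fun s => φ.process s ω * jump (fun t => X t ω) s) t := by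
  have hsp := hX.sparse_jump
  have hcell : ∀ i ∈ Finset.range φ.n,
      φ.f i ω * (X (min (φ.time (i + 1)) t) ω - X (min (φ.time i) t) ω) =
      ∑' s, φ.f i ω * (Set.Ioc (min (φ.time i) t) (min (φ.time (i + 1)) t)).indicator
        (jump fun t => X t ω) s := by
    intro i hi
    have hle : min (φ.time i) t ≤ min (φ.time (i + 1)) t :=
      min_le_min_right t (φ.time_lt i (Finset.mem_range.1 hi)).le
    rw [tsum_mul_left, ← hsp.cumSum_sub hle, ← hX.sub_eq_cumSum_sub hle]
  have hsum : ∀ i ∈ Finset.range φ.n, Summable fun s =>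
      φ.f i ω * (Set.Ioc (min (φ.time i) t) (min (φ.time (i + 1)) t)).indicator
        (jump fun t => X t ω) s := fun i _ =>
    (hsp.summable (t := t) fun s hs => hs.2.trans (min_le_right _ _)).mul_left _
  rw [SimpleIntegrand.integral, Finset.sum_congr rfl hcell, ← Summable.tsum_finsetSum hsum, cumSum]
  congr 1
  ext s
  by_cases hst : s ≤ t
  · rw [Set.indicator_of_mem (show s ∈ Set.Iic t from hst), SimpleIntegrand.process, add_mul,
      Finset.sum_mul]
    have h0 : Set.indicator {0} (fun _ => φ.g ω) s * jump (fun t => X t ω) s = 0 := by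
      rcases eq_or_ne s 0 with rfl | hs
      · rw [jump_zero, mul_zero]
      · rw [Set.indicator_of_notMem (by simpa using hs), zero_mul]
    rw [h0, zero_add]
    refine Finset.sum_congr rfl fun i _ => ?_
    by_cases hs : s ∈ Set.Ioc (φ.time i) (φ.time (i + 1))
    · rw [Set.indicator_of_mem hs, Set.indicator_of_mem]
      exact ⟨(min_le_left _ _).trans_lt hs.1, le_min hs.2 hst⟩
    · rw [Set.indicator_of_notMem hs, Set.indicator_of_notMem, mul_zero, zero_mul]
      rintro ⟨h1, h2⟩
      refine hs ⟨?_, h2.trans (min_le_left _ _)⟩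
      rcases min_lt_iff.1 h1 with h | h
      · exact h
      · exact absurd hst (not_le.2 h)
  · rw [Set.indicator_of_notMem (show s ∉ Set.Iic t from hst)]
    refine Finset.sum_eq_zero fun i _ => ?_
    rw [Set.indicator_of_notMem, mul_zero]
    exact fun h => hst (h.2.trans (min_le_right _ _))

end Simple

/-! ### The stochastic integral as a sum over jumps -/

section StochIntegral

variable {p : ℕ} [hp : Fact p.Prime] {γ : ℝ}

/-- Right-continuous functions agreeing on a dense set agree. -/
theorem IsCadlag.eq_of_dense {ζ ξ : ℝ≥0 → ℚ_[p]} (hζ : IsCadlag ζ) (hξ : IsCadlag ξ)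
    {D : Set ℝ≥0} (hD : Dense D) (h : ∀ q ∈ D, ζ q = ξ q) : ζ = ξ := by
  ext1 t
  have hne : (𝓝[Set.Ioi t ∩ D] t).NeBot := by
    rw [← mem_closure_iff_nhdsWithin_neBot]
    have h1 : t ∈ closure (Set.Ioi t) := by
      rw [closure_Ioi' ⟨t + 1, by simp⟩]; exact Set.self_mem_Ici
    exact closure_minimal (hD.open_subset_closure_inter isOpen_Ioi) isClosed_closure h1
  have hsub : Set.Ioi t ∩ D ⊆ Set.Ici t := fun s hs => Set.Ioi_subset_Ici_self hs.1
  refine tendsto_nhds_unique_of_eventuallyEq (((hζ t).1.mono hsub).tendsto)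
    (((hξ t).1.mono hsub).tendsto) ?_
  filter_upwards [self_mem_nhdsWithin] with s hs using h s hs.2

theorem sparse_indicator_mul_jump {T : ℝ≥0} {ζ f : ℝ≥0 → ℚ_[p]} (hγ : 0 < γ)
    (h : jumpSum γ T ζ (fun s => ‖f s‖ₑ ^ γ) ≠ ∞) :
    Sparse ((Set.Ioc 0 T).indicator fun s => f s * jump ζ s) := by
  intro t ε hε
  have hε' : ENNReal.ofReal ε ^ γ ≠ 0 :=
    (ENNReal.rpow_pos (ENNReal.ofReal_pos.2 hε) ENNReal.ofReal_ne_top).ne'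
  refine (ENNReal.finite_const_le_of_tsum_ne_top h hε').subset fun s hs => ?_
  have h2 := hs.2
  by_cases hsT : s ∈ Set.Ioc 0 T
  · rw [Set.indicator_of_mem hsT] at h2
    rw [Set.mem_ofPred_eq, Set.indicator_of_mem hsT, ← ENNReal.mul_rpow_of_nonneg _ _ hγ.le,
      ← enorm_mul, ← ofReal_norm]
    exact ENNReal.rpow_le_rpow (ENNReal.ofReal_le_ofReal h2.le) hγ.le
  · rw [Set.indicator_of_notMem hsT, norm_zero] at h2
    exact absurd h2 (not_lt.2 hε.le)

theorem enorm_cumSum_sub_rpow_le {T : ℝ≥0} {ζ f g : ℝ≥0 → ℚ_[p]} (hγ : 0 < γ)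
    (hf : Sparse ((Set.Ioc 0 T).indicator fun s => f s * jump ζ s))
    (hg : Sparse ((Set.Ioc 0 T).indicator fun s => g s * jump ζ s)) (t : ℝ≥0) :
    ‖cumSum ((Set.Ioc 0 T).indicator fun s => f s * jump ζ s) t -
      cumSum ((Set.Ioc 0 T).indicator fun s => g s * jump ζ s) t‖ₑ ^ γ ≤
      jumpSum γ T ζ fun s => ‖f s - g s‖ₑ ^ γ := by
  rw [cumSum, cumSum, ← (hf.summable subset_rfl).tsum_sub (hg.summable subset_rfl)]
  refine (enorm_tsum_rpow_le hγ _).trans (ENNReal.tsum_le_tsum fun s => ?_)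
  by_cases hs : s ∈ Set.Ioc 0 T
  · by_cases hst : s ∈ Set.Iic t
    · rw [Set.indicator_of_mem hst, Set.indicator_of_mem hst, Set.indicator_of_mem hs,
        Set.indicator_of_mem hs, Set.indicator_of_mem hs, ← sub_mul, enorm_mul,
        ENNReal.mul_rpow_of_nonneg _ _ hγ.le]
    · rw [Set.indicator_of_notMem hst, Set.indicator_of_notMem hst]
      simp [hγ]
  · rw [Set.indicator_of_notMem hs]
    by_cases hst : s ∈ Set.Iic t
    · rw [Set.indicator_of_mem hst, Set.indicator_of_mem hst, Set.indicator_of_notMem hs,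
        Set.indicator_of_notMem hs]
      simp [hγ]
    · rw [Set.indicator_of_notMem hst, Set.indicator_of_notMem hst]
      simp [hγ]

theorem cumSum_indicator_min (g : ℝ≥0 → ℚ_[p]) (T t : ℝ≥0) :
    cumSum ((Set.Ioc 0 T).indicator g) (min t T) = cumSum ((Set.Ioc 0 T).indicator g) t := by
  rw [cumSum, cumSum]
  congr 1
  ext s
  by_cases hs : s ∈ Set.Ioc 0 T
  · have : s ∈ Set.Iic (min t T) ↔ s ∈ Set.Iic t := by simp [hs.2]
    by_cases h : s ∈ Set.Iic t
    · rw [Set.indicator_of_mem h, Set.indicator_of_mem (this.2 h)]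
    · rw [Set.indicator_of_notMem h, Set.indicator_of_notMem (this.not.2 h)]
  · simp [Set.indicator, hs]

variable {Ω : Type*}

theorem aestronglyMeasurable_of_tendsto {m mΩ : MeasurableSpace Ω} {P : Measure Ω}
    {f : ℕ → Ω → ℚ_[p]} {g : Ω → ℚ_[p]} (hf : ∀ n, AEStronglyMeasurable[m] (f n) P)
    (h : ∀ᵐ ω ∂P, Tendsto (fun n => f n ω) atTop (𝓝 (g ω))) : AEStronglyMeasurable[m] g P := by
  choose k hk hke using hf
  refine ⟨fun ω => limUnder atTop fun n => k n ω,
    @StronglyMeasurable.limUnder _ _ _ m _ _ _ _ _ _ _ hk, ?_⟩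
  filter_upwards [h, ae_all_iff.2 hke] with ω h1 h2
  refine (Tendsto.limUnder_eq ?_).symm
  simpa only [← h2] using h1

variable {mΩ : MeasurableSpace Ω} {P : Measure Ω} {𝓕 : Filtration ℝ≥0 mΩ}
  {X : ℝ≥0 → Ω → ℚ_[p]} {a : ℤ → ℝ} {T : ℝ≥0}

/-- The sum `∑_{0 < s ≤ t ∧ T} φ(s) ΔX(s)`. -/
def jumpInt (T : ℝ≥0) (X φ : ℝ≥0 → Ω → ℚ_[p]) (t : ℝ≥0) (ω : Ω) : ℚ_[p] :=
  cumSum ((Set.Ioc 0 T).indicator fun s => φ s ω * jump (fun t => X t ω) s) t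

theorem SimpleIntegrand.integral_eq_jumpInt (φ : SimpleIntegrand p 𝓕 P T) {ω : Ω}
    (hX : IsCadlag fun t => X t ω) {t : ℝ≥0} (ht : t ≤ T) :
    φ.integral X t ω = jumpInt T X φ.process t ω := by
  rw [φ.integral_eq_cumSum hX, jumpInt, cumSum, cumSum]
  congr 1
  ext s
  by_cases hst : s ∈ Set.Iic t
  · rw [Set.indicator_of_mem hst, Set.indicator_of_mem hst]
    rcases eq_or_ne s 0 with rfl | hs
    · simp [jump_zero]
    · rw [Set.indicator_of_mem]
      exact ⟨pos_iff_ne_zero.2 hs, le_trans hst ht⟩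
  · rw [Set.indicator_of_notMem hst, Set.indicator_of_notMem hst]

theorem SimpleIntegrand.sparse_jump (φ : SimpleIntegrand p 𝓕 P T) {ω : Ω}
    (hX : IsCadlag fun t => X t ω) :
    Sparse ((Set.Ioc 0 T).indicator fun s => φ.process s ω * jump (fun t => X t ω) s) :=
  (φ.sparse hX.sparse_jump ω).mono fun _ => norm_indicator_le_norm_self _ _

theorem SimpleIntegrand.measurable_integral (φ : SimpleIntegrand p 𝓕 P T)
    (hX : ∀ t, Measurable[𝓕 t] (X t)) (t : ℝ≥0) : Measurable[𝓕 t] (φ.integral X t) := by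
  refine Finset.measurable_fun_sum (m := 𝓕 t) _ fun i hi => ?_
  rcases le_or_gt (φ.time i) t with h | h
  · have h1 : Measurable[𝓕 t] (φ.f i) :=
      (φ.measurable_f i (Finset.mem_range.1 hi)).mono (𝓕.mono h) le_rfl
    have h2 : Measurable[𝓕 t] fun ω => X (min (φ.time (i + 1)) t) ω :=
      (hX _).mono (𝓕.mono (min_le_right _ _)) le_rfl
    have h3 : Measurable[𝓕 t] fun ω => X (min (φ.time i) t) ω :=
      (hX _).mono (𝓕.mono (min_le_right _ _)) le_rfl
    have h4 : Measurable[𝓕 t] fun ω =>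
      X (min (φ.time (i + 1)) t) ω - X (min (φ.time i) t) ω := h2.sub h3
    exact h1.mul h4
  · have h1 : min (φ.time i) t = t := min_eq_right h.le
    have h2 : min (φ.time (i + 1)) t = t :=
      min_eq_right (h.le.trans (φ.time_lt i (Finset.mem_range.1 hi)).le)
    simp only [h1, h2, sub_self, mul_zero]
    exact @measurable_const _ _ _ (𝓕 t) 0

variable [IsProbabilityMeasure P]

theorem IsLevyProcess.lintegral_jumpSum_enorm (hX : IsLevyProcess a 𝓕 P X) (ha : IsRateSequence a)
    (hγ : 0 < γ) (hs : SummableMoment p γ a) {φ : ℝ≥0 → Ω → ℚ_[p]}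
    (hφ : Measurable[𝓕.predictable] fun x : ℝ≥0 × Ω => φ x.1 x.2) :
    AEMeasurable (fun ω => jumpSum γ T (fun t => X t ω) fun s => ‖φ s ω‖ₑ ^ γ) P ∧
    ∫⁻ ω, jumpSum γ T (fun t => X t ω) (fun s => ‖φ s ω‖ₑ ^ γ) ∂P =
      variationRate γ P X * energy P γ T φ := by
  rw [energy_eq T (hφ.mono (predictable_le 𝓕) le_rfl)]
  exact hX.compensation ha hγ hs T (h := fun x => ‖φ x.1 x.2‖ₑ ^ γ) (measurable_enorm_rpow.comp hφ)

/-- Almost surely, the sum over the jumps converges. -/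
theorem IsLevyProcess.ae_sparse (hX : IsLevyProcess a 𝓕 P X) (ha : IsRateSequence a)
    (hγ : 0 < γ) (hs : SummableMoment p γ a) {φ : ℝ≥0 → Ω → ℚ_[p]} (hφ : MemL 𝓕 P γ T φ) :
    ∀ᵐ ω ∂P, Sparse ((Set.Ioc 0 T).indicator fun s => φ s ω * jump (fun t => X t ω) s) := by
  obtain ⟨h1, h2⟩ := hX.lintegral_jumpSum_enorm (T := T) ha hγ hs hφ.measurable
  filter_upwards [ae_lt_top' h1 (by
    rw [h2]; exact ENNReal.mul_ne_top (hX.variationRate_ne_top ha hγ hs) hφ.2.ne)] with ω hω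
  exact sparse_indicator_mul_jump hγ hω.ne

/-- The distance of the integral of a simple process to the sum over the jumps. -/
theorem IsLevyProcess.tendsto_lintegral_iSup (hX : IsLevyProcess a 𝓕 P X) (ha : IsRateSequence a)
    (hγ : 0 < γ) (hs : SummableMoment p γ a) {φ : ℝ≥0 → Ω → ℚ_[p]} (hφ : MemL 𝓕 P γ T φ)
    {φn : ℕ → SimpleIntegrand p 𝓕 P T}
    (hn : Tendsto (fun n => energy P γ T fun t ω => (φn n).process t ω - φ t ω) atTop (𝓝 0))
    {Y : ℝ≥0 → Ω → ℚ_[p]} (hY : ∀ᵐ ω ∂P, ∀ t ≤ T, Y t ω = jumpInt T X φ t ω) :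
    Tendsto (fun n => ∫⁻ ω, ⨆ t ∈ Set.Iic T, ‖Y t ω - (φn n).integral X t ω‖ₑ ^ γ ∂P)
      atTop (𝓝 0) := by
  have hc := hX.variationRate_ne_top ha hγ hs
  have hlim : Tendsto (fun n => variationRate γ P X *
      energy P γ T fun t ω => (φn n).process t ω - φ t ω) atTop (𝓝 0) := by
    simpa using ENNReal.Tendsto.const_mul hn (Or.inr hc)
  refine tendsto_of_tendsto_of_tendsto_of_le_of_le tendsto_const_nhds hlim (fun _ => zero_le)
    fun n => ?_
  have hm : Measurable[𝓕.predictable] fun x : ℝ≥0 × Ω => (φn n).process x.1 x.2 - φ x.1 x.2 :=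
    (φn n).measurable_process.sub hφ.measurable
  rw [← (hX.lintegral_jumpSum_enorm (T := T) ha hγ hs hm).2]
  refine lintegral_mono_ae ?_
  filter_upwards [hY, hX.ae_sparse ha hγ hs hφ] with ω hω hsp
  refine iSup₂_le fun t ht => ?_
  rw [hω t ht, (φn n).integral_eq_jumpInt (hX.cadlag ω) ht, enorm_sub_rev]
  exact enorm_cumSum_sub_rpow_le hγ ((φn n).sparse_jump (hX.cadlag ω)) hsp t

/-- The stochastic integral exists: it is the sum of `φ(s) ΔX(s)` over the jumps of `X`. -/
theorem IsLevyProcess.exists_stochIntegral (hX : IsLevyProcess a 𝓕 P X) (ha : IsRateSequence a)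
    (hγ : 1 ≤ γ) (hs : SummableMoment p γ a) (hT : 0 < T) {φ : ℝ≥0 → Ω → ℚ_[p]}
    (hφ : MemL 𝓕 P γ T φ) :
    ∃ Y, IsStochIntegral 𝓕 P γ T X φ Y ∧ (∀ t ≤ T, AEStronglyMeasurable[𝓕 t] (Y t) P) ∧
      ∀ᵐ ω ∂P, ∀ t ≤ T, Y t ω = jumpInt T X φ t ω := by
  have hγ0 : 0 < γ := zero_lt_one.trans_le hγ
  have hc := hX.variationRate_ne_top ha hγ0 hs
  have hδ : ∀ n : ℕ, (2⁻¹ : ℝ≥0∞) ^ n ≠ 0 := fun n => by simp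
  choose φn hφn using fun n : ℕ => hφ.exists_simple hγ hT (hδ n)
  have hsmall : Tendsto (fun n : ℕ => (2⁻¹ : ℝ≥0∞) ^ n) atTop (𝓝 0) :=
    ENNReal.tendsto_pow_atTop_nhds_zero_of_lt_one (by simp)
  have hen : Tendsto (fun n => energy P γ T fun t ω => (φn n).process t ω - φ t ω) atTop (𝓝 0) :=
    tendsto_of_tendsto_of_tendsto_of_le_of_le tendsto_const_nhds hsmall (fun _ => zero_le) hφn
  have hm : ∀ n, Measurable[𝓕.predictable] fun x : ℝ≥0 × Ω =>
      (φn n).process x.1 x.2 - φ x.1 x.2 := fun n => (φn n).measurable_process.sub hφ.measurable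
  have hJ := fun n => hX.lintegral_jumpSum_enorm (T := T) ha hγ0 hs
    (φ := fun s ω => (φn n).process s ω - φ s ω) (hm n)
  -- the speed of convergence turns convergence in mean into almost sure convergence
  have hconv : ∀ᵐ ω ∂P, ∀ t ≤ T,
      Tendsto (fun n => (φn n).integral X t ω) atTop (𝓝 (jumpInt T X φ t ω)) := by
    have hfin : ∫⁻ ω, ∑' n, jumpSum γ T (fun t => X t ω)
        (fun s => ‖(φn n).process s ω - φ s ω‖ₑ ^ γ) ∂P ≠ ∞ := by
      rw [lintegral_tsum fun n => (hJ n).1]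
      simp_rw [fun n => (hJ n).2]
      rw [ENNReal.tsum_mul_left]
      refine ENNReal.mul_ne_top hc (ne_top_of_le_ne_top ?_ (ENNReal.tsum_le_tsum hφn))
      rw [ENNReal.tsum_geometric]
      simp
    filter_upwards [ae_lt_top' (AEMeasurable.tsum fun n => (hJ n).1) hfin,
      hX.ae_sparse ha hγ0 hs hφ] with ω hω hsp t ht
    have h0 := ENNReal.tendsto_atTop_zero_of_tsum_ne_top hω.ne
    have h1 : Tendsto (fun n => ‖(φn n).integral X t ω - jumpInt T X φ t ω‖ₑ ^ γ) atTop (𝓝 0) := by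
      refine tendsto_of_tendsto_of_tendsto_of_le_of_le tendsto_const_nhds h0 (fun _ => zero_le)
        fun n => ?_
      rw [(φn n).integral_eq_jumpInt (hX.cadlag ω) ht]
      exact enorm_cumSum_sub_rpow_le hγ0 ((φn n).sparse_jump (hX.cadlag ω)) hsp t
    have h2 : Tendsto (fun n => (‖(φn n).integral X t ω - jumpInt T X φ t ω‖ₑ ^ γ) ^ γ⁻¹) atTop
        (𝓝 0) := by
      have := ((ENNReal.continuous_rpow_const (y := γ⁻¹)).tendsto 0).comp h1
      rwa [ENNReal.zero_rpow_of_pos (by positivity)] at this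
    simp_rw [ENNReal.rpow_rpow_inv hγ0.ne'] at h2
    rw [tendsto_iff_edist_tendsto_0]
    simpa only [edist_eq_enorm_sub] using h2
  -- a measurable set of full measure on which the sum over the jumps is as it should be
  obtain ⟨G, hG, hGm, hG1⟩ : ∃ G : Set Ω, (∀ ω ∈ G,
      (∀ t ≤ T, Tendsto (fun n => (φn n).integral X t ω) atTop (𝓝 (jumpInt T X φ t ω))) ∧
      Sparse ((Set.Ioc 0 T).indicator fun s => φ s ω * jump (fun t => X t ω) s)) ∧
      MeasurableSet G ∧ ∀ᵐ ω ∂P, ω ∈ G := by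
    have hae := hconv.and (hX.ae_sparse ha hγ0 hs hφ)
    obtain ⟨N, hN, hNm, hN0⟩ := exists_measurable_superset_of_null (ae_iff.1 hae)
    refine ⟨Nᶜ, fun ω hω => ?_, hNm.compl, compl_mem_ae_iff.2 hN0⟩
    by_contra h
    exact hω (hN h)
  have hlim : ∀ t ≤ T, ∀ ω, Tendsto (fun n => G.indicator (fun ω => (φn n).integral X t ω) ω) atTop
      (𝓝 (G.indicator (fun ω => jumpInt T X φ t ω) ω)) := by
    intro t ht ω
    by_cases hω : ω ∈ G
    · simp only [Set.indicator_of_mem hω]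
      exact (hG ω hω).1 t ht
    · simp only [Set.indicator_of_notMem hω]
      exact tendsto_const_nhds
  have hY : ∀ᵐ ω ∂P, ∀ t ≤ T, G.indicator (fun ω => jumpInt T X φ t ω) ω = jumpInt T X φ t ω := by
    filter_upwards [hG1] with ω hω t _
    rw [Set.indicator_of_mem hω]
  refine ⟨fun t ω => G.indicator (fun ω => jumpInt T X φ t ω) ω, ⟨?_, ?_, φn, hen,
    hX.tendsto_lintegral_iSup ha hγ0 hs hφ hen hY⟩, ?_, hY⟩
  · intro t ht
    refine measurable_of_tendsto_metrizable (fun n => ?_) (tendsto_pi_nhds.2 (hlim t ht))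
    exact (((φn n).measurable_integral hX.adapted t).mono (𝓕.le t) le_rfl).indicator hGm
  · intro ω
    by_cases hω : ω ∈ G
    · simp only [Set.indicator_of_mem hω, jumpInt, cumSum_indicator_min]
      exact (hG ω hω).2.isCadlag
    · simp only [Set.indicator_of_notMem hω]
      exact fun t => ⟨continuousWithinAt_const, 0, tendsto_const_nhds⟩
  · intro t ht
    refine aestronglyMeasurable_of_tendsto (f := fun n => (φn n).integral X t) (fun n => ?_) ?_
    · exact (Measurable.stronglyMeasurable
        ((φn n).measurable_integral hX.adapted t)).aestronglyMeasurable
    · filter_upwards [hG1] with ω hω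
      rw [Set.indicator_of_mem hω]
      exact (hG ω hω).1 t ht

/-- Every version of the stochastic integral is given by the sum over the jumps. -/
theorem IsLevyProcess.stochIntegral_eq (hX : IsLevyProcess a 𝓕 P X) (ha : IsRateSequence a)
    (hγ : 1 ≤ γ) (hs : SummableMoment p γ a) (hT : 0 < T) {φ Y' : ℝ≥0 → Ω → ℚ_[p]}
    (hφ : MemL 𝓕 P γ T φ) (hY' : IsStochIntegral 𝓕 P γ T X φ Y') :
    ∀ᵐ ω ∂P, ∀ t ≤ T, Y' t ω = jumpInt T X φ t ω := by
  have hγ0 : 0 < γ := zero_lt_one.trans_le hγ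
  obtain ⟨Y, ⟨hYm, hYc, -⟩, -, hYe⟩ := hX.exists_stochIntegral ha hγ hs hT hφ
  obtain ⟨hYm', hYc', φn, hen, hsup⟩ := hY'
  have hsup' := hX.tendsto_lintegral_iSup ha hγ0 hs hφ hen hYe
  have hfix : ∀ t ≤ T, ∀ᵐ ω ∂P, Y' t ω = Y t ω := by
    intro t ht
    have hmeas : Measurable fun ω => Y' t ω - Y t ω := (hYm' t ht).sub (hYm t ht)
    have h0 : ∫⁻ ω, ‖Y' t ω - Y t ω‖ₑ ^ γ ∂P ≤ 0 := by
      refine ge_of_tendsto' (by simpa using hsup.add hsup') fun n => ?_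
      have hIm : Measurable ((φn n).integral X t) :=
        ((φn n).measurable_integral hX.adapted t).mono (𝓕.le t) le_rfl
      have h1 : Measurable fun ω => ‖Y t ω - (φn n).integral X t ω‖ₑ ^ γ :=
        measurable_enorm_rpow.comp ((hYm t ht).sub hIm)
      calc ∫⁻ ω, ‖Y' t ω - Y t ω‖ₑ ^ γ ∂P
          ≤ ∫⁻ ω, (‖Y' t ω - (φn n).integral X t ω‖ₑ ^ γ +
              ‖Y t ω - (φn n).integral X t ω‖ₑ ^ γ) ∂P := by
            refine lintegral_mono fun ω => ?_
            have := enorm_sub_rpow_le hγ0 (Y' t ω) ((φn n).integral X t ω) (Y t ω)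
            rwa [enorm_sub_rev ((φn n).integral X t ω) (Y t ω)] at this
        _ ≤ _ := by
            rw [lintegral_add_right _ h1]
            refine add_le_add (lintegral_mono fun ω => ?_) (lintegral_mono fun ω => ?_)
            · exact le_iSup₂ (f := fun t (_ : t ∈ Set.Iic T) =>
                ‖Y' t ω - (φn n).integral X t ω‖ₑ ^ γ) t ht
            · exact le_iSup₂ (f := fun t (_ : t ∈ Set.Iic T) =>
                ‖Y t ω - (φn n).integral X t ω‖ₑ ^ γ) t ht
    have h2 := (lintegral_eq_zero_iff (measurable_enorm_rpow.comp hmeas)).1 (le_antisymm h0 zero_le)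
    filter_upwards [h2] with ω hω
    have h3 : ‖Y' t ω - Y t ω‖ₑ ^ γ = 0 := hω
    rw [ENNReal.rpow_eq_zero_iff_of_pos hγ0, enorm_eq_zero, sub_eq_zero] at h3
    exact h3
  obtain ⟨D, hDc, hD⟩ := TopologicalSpace.exists_countable_dense ℝ≥0
  have hall : ∀ᵐ ω ∂P, ∀ q ∈ D, Y' (min q T) ω = Y (min q T) ω :=
    (ae_ball_iff hDc).2 fun q _ => hfix _ (min_le_right _ _)
  filter_upwards [hall, hYe] with ω h1 h2 t ht
  have h3 := congrFun ((hYc' ω).eq_of_dense (hYc ω) hD h1) t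
  simp only [min_eq_left ht] at h3
  rw [h3, h2 t ht]

end StochIntegral

/-! ### Localization -/

section Localization

variable {p : ℕ} [hp : Fact p.Prime] {ζ : ℝ≥0 → ℚ_[p]}

/-- A bound on a right-continuous path over `[0, T]` can be checked at countably many times. -/
theorem exists_countable_test (T : ℝ≥0) : ∃ D : Set ℝ≥0, D.Countable ∧ D ⊆ Set.Iic T ∧
    ∀ {ζ : ℝ≥0 → ℚ_[p]} (_ : ∀ t, ContinuousWithinAt ζ (Set.Ici t) t) (c : ℝ),
      (∀ q ∈ D, ‖ζ q‖ ≤ c) → ∀ t ≤ T, ‖ζ t‖ ≤ c := by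
  obtain ⟨D, hDc, hD⟩ := TopologicalSpace.exists_countable_dense ℝ≥0
  refine ⟨insert T (D ∩ Set.Iic T), (hDc.mono Set.inter_subset_left).insert T, ?_, ?_⟩
  · rintro q (rfl | hq)
    · exact Set.self_mem_Iic
    · exact hq.2
  intro ζ hζ c h t ht
  rcases eq_or_lt_of_le ht with rfl | htT
  · exact h t (Set.mem_insert _ _)
  have hne : (𝓝[Set.Ioo t T ∩ D] t).NeBot := by
    rw [← mem_closure_iff_nhdsWithin_neBot]
    have h1 : t ∈ closure (Set.Ioo t T) := by
      rw [closure_Ioo htT.ne]; exact ⟨le_rfl, ht⟩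
    exact closure_minimal (hD.open_subset_closure_inter isOpen_Ioo) isClosed_closure h1
  have hsub : Set.Ioo t T ∩ D ⊆ Set.Ici t := fun s hs => Set.Ioi_subset_Ici_self hs.1.1
  refine le_of_tendsto ((hζ t).mono hsub).tendsto.norm ?_
  filter_upwards [self_mem_nhdsWithin] with s hs
  exact h s (Set.mem_insert_of_mem _ ⟨hs.2, hs.1.2.le⟩)

theorem measurableSet_forall_norm_le {Ω : Type*} {m : MeasurableSpace Ω} {W : ℝ≥0 → Ω → ℚ_[p]}
    (T : ℝ≥0) (hc : ∀ ω t, ContinuousWithinAt (fun t => W t ω) (Set.Ici t) t)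
    (hm : ∀ t ≤ T, Measurable (W t)) (c : ℝ) : MeasurableSet {ω | ∀ t ≤ T, ‖W t ω‖ ≤ c} := by
  obtain ⟨D, hDc, hDT, hD⟩ := exists_countable_test (p := p) T
  have h : {ω | ∀ t ≤ T, ‖W t ω‖ ≤ c} = ⋂ q ∈ D, {ω | ‖W q ω‖ ≤ c} := by
    ext ω
    simp only [Set.mem_ofPred_eq, Set.mem_iInter]
    exact ⟨fun h q hq => h q (hDT hq), hD (hc ω) c⟩
  rw [h]
  exact MeasurableSet.biInter hDc fun q hq => measurableSet_le (hm q (hDT hq)).norm measurable_const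

theorem IsCadlag.exists_norm_le (hζ : IsCadlag ζ) (h0 : ζ 0 = 0) (T : ℝ≥0) :
    ∃ M : ℕ, ∀ t ≤ T, ‖ζ t‖ ≤ (p : ℝ) ^ (M : ℤ) := by
  have hsp := hζ.sparse_jump
  obtain ⟨C, hC⟩ := ((hsp T 1 one_pos).image fun s => ‖jump ζ s‖).bddAbove
  obtain ⟨M, hM⟩ := pow_unbounded_of_one_lt (max C 1) (one_lt_prime (p := p))
  have hM' : max C 1 ≤ (p : ℝ) ^ (M : ℤ) := by rw [zpow_natCast]; exact hM.le
  refine ⟨M, fun t ht => ?_⟩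
  have h1 := hζ.sub_eq_cumSum_sub (zero_le : 0 ≤ t)
  rw [h0, sub_zero] at h1
  rw [h1]
  refine hsp.norm_cumSum_sub_le zero_le (zpow_pos prime_pos _).le fun s hs => ?_
  refine le_trans ?_ hM'
  by_cases h : 1 < ‖jump ζ s‖
  · exact (hC ⟨s, ⟨hs.2.trans ht, h⟩, rfl⟩).trans (le_max_left _ _)
  · exact (not_lt.1 h).trans (le_max_right _ _)

theorem IsCadlag.norm_jump_le_of_forall (hζ : IsCadlag ζ) {T s : ℝ≥0} {c : ℝ}
    (h : ∀ t ≤ T, ‖ζ t‖ ≤ c) (hs : s ≤ T) : ‖jump ζ s‖ ≤ c := by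
  refine norm_jump_le hζ ((norm_nonneg _).trans (h s hs)) ?_
  filter_upwards [self_mem_nhdsWithin] with u hu
  exact (norm_sub_le_max _ _).trans (max_le (h s hs) (h u ((le_of_lt hu).trans hs)))

/-- A path stays in a ball about its starting point if its increments along arbitrarily fine
partitions are in that ball. -/
theorem IsCadlag.norm_sub_le_of_frequently (hζ : IsCadlag ζ) {u h : ℝ≥0} {c : ℝ} (hc : 0 ≤ c)
    (hfr : ∃ᶠ n in atTop, ∀ i < n, ‖gridIncr ζ u h n i‖ ≤ c) {r : ℝ≥0} (hur : u ≤ r)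
    (hr : r ≤ u + h) : ‖ζ r - ζ u‖ ≤ c := by
  rcases eq_or_lt_of_le hur with rfl | hur
  · rwa [sub_self, norm_zero]
  by_contra hlt
  have hev : ∀ᶠ v in 𝓝[≥] r, c < ‖ζ v - ζ u‖ :=
    ((hζ r).1.tendsto.sub_const (ζ u)).norm.eventually_const_lt (not_le.1 hlt)
  obtain ⟨δ, hδ, hball⟩ := Metric.mem_nhdsWithin_iff.1 hev
  have hsmall : ∀ᶠ n : ℕ in atTop, (h / n : ℝ) < δ :=
    (tendsto_const_div_atTop_nhds_zero_nat (h : ℝ)).eventually_lt_const hδ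
  obtain ⟨n, hn, hnδ, hn0⟩ := (hfr.and_eventually (hsmall.and (eventually_ne_atTop 0))).exists
  have hgrid : ∀ i ≤ n, ‖ζ (grid u h n i) - ζ u‖ ≤ c := by
    intro i
    induction i with
    | zero => intro _; rwa [grid_zero, sub_self, norm_zero]
    | succ i ih =>
      intro hi
      rw [show ζ (grid u h n (i + 1)) - ζ u = gridIncr ζ u h n i + (ζ (grid u h n i) - ζ u) by
        rw [gridIncr]; ring]
      exact (IsUltrametricDist.norm_add_le_max _ _).trans
        (max_le (hn i (by omega)) (ih (by omega)))
  obtain ⟨i, hi, hir⟩ := exists_cell (τ := grid u h n) (s := r) (j := n)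
    ⟨by rwa [grid_zero], by rwa [grid_self u h hn0]⟩
  refine absurd (hgrid (i + 1) hi) (not_le.2 (hball ⟨?_, hir.2⟩))
  have h1 : (grid u h n i : ℝ) < r := hir.1
  have h2 : (r : ℝ) ≤ grid u h n (i + 1) := hir.2
  have h3 : (grid u h n (i + 1) : ℝ) = grid u h n i + h / n := by
    rw [grid_succ]; push_cast; rfl
  rw [Metric.mem_ball, NNReal.dist_eq, abs_lt]
  constructor <;> linarith

variable {Ω : Type*} {mΩ : MeasurableSpace Ω} {P : Measure Ω} {𝓕 : Filtration ℝ≥0 mΩ}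
  {Z : ℝ≥0 → Ω → ℚ_[p]} {a : ℤ → ℝ} {γ : ℝ} {T : ℝ≥0}

/-- The event that `Z` stays in the ball of radius `p^M` during `[0, T]`; equivalently, no jump in
`[0, T]` is larger than `p^M`. -/
def ballEvent (Z : ℝ≥0 → Ω → ℚ_[p]) (T : ℝ≥0) (M : ℕ) : Set Ω :=
  {ω | ∀ t ≤ T, ‖Z t ω‖ ≤ (p : ℝ) ^ (M : ℤ)}

theorem IsLevyProcess.measurableSet_ballEvent (hZ : IsLevyProcess a 𝓕 P Z) (M : ℕ) :
    MeasurableSet[𝓕 T] (ballEvent Z T M) :=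
  measurableSet_forall_norm_le (m := 𝓕 T) T (fun ω t => (hZ.cadlag ω t).1)
    (fun _ ht => hZ.measurable_le ht) _

theorem ballEvent_mono : Monotone (ballEvent Z T) := fun _ _ hMN _ hω t ht =>
  (hω t ht).trans (zpow_le_zpow_right₀ one_lt_prime.le (by exact_mod_cast hMN))

theorem IsLevyProcess.exists_mem_ballEvent (hZ : IsLevyProcess a 𝓕 P Z) (ω : Ω) :
    ∃ M, ω ∈ ballEvent Z T M :=
  (hZ.cadlag ω).exists_norm_le (hZ.zero ω) T

theorem IsLevyProcess.jump_truncProcess_of_mem (hZ : IsLevyProcess a 𝓕 P Z) {M N : ℕ} (hMN : M ≤ N)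
    {ω : Ω} (hω : ω ∈ ballEvent Z T M) {s : ℝ≥0} (hs : s ≤ T) :
    jump (fun t => truncProcess Z N t ω) s = jump (fun t => Z t ω) s := by
  rw [hZ.jump_truncProcess, truncFun_eq_self]
  exact (hZ.cadlag ω).norm_jump_le_of_forall (ballEvent_mono hMN hω) hs

theorem IsLevyProcess.measurableSet_predictable_norm_le (hZ : IsLevyProcess a 𝓕 P Z) (c : ℝ) :
    MeasurableSet[𝓕.predictable] {x : ℝ≥0 × Ω | ∀ r < x.1, ‖Z r x.2‖ ≤ c} := by
  obtain ⟨D, hDc, hD⟩ := TopologicalSpace.exists_countable_dense ℝ≥0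
  have h : {x : ℝ≥0 × Ω | ∀ r < x.1, ‖Z r x.2‖ ≤ c} =
      (⋃ q ∈ D, Set.Ioi q ×ˢ {ω | ‖Z q ω‖ ≤ c}ᶜ)ᶜ := by
    ext ⟨s, ω⟩
    simp only [Set.mem_ofPred_eq, Set.mem_compl_iff, Set.mem_iUnion, Set.mem_prod, Set.mem_Ioi,
      not_exists, not_and, not_not]
    refine ⟨fun h q _ hq => h q hq, fun h r hr => ?_⟩
    have hne : (𝓝[Set.Ioo r s ∩ D] r).NeBot := by
      rw [← mem_closure_iff_nhdsWithin_neBot]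
      have h1 : r ∈ closure (Set.Ioo r s) := by
        rw [closure_Ioo hr.ne]; exact ⟨le_rfl, hr.le⟩
      exact closure_minimal (hD.open_subset_closure_inter isOpen_Ioo) isClosed_closure h1
    have hsub : Set.Ioo r s ∩ D ⊆ Set.Ici r := fun s hs => Set.Ioi_subset_Ici_self hs.1.1
    refine le_of_tendsto ((hZ.cadlag ω r).1.mono hsub).tendsto.norm ?_
    filter_upwards [self_mem_nhdsWithin] with q hq
    exact h q hq.2 hq.1.2
  rw [h]
  refine @MeasurableSet.compl _ _ 𝓕.predictable (@MeasurableSet.biUnion _ _ 𝓕.predictable _ _ hDc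
    fun q _ => measurableSet_predictable_Ioi_prod ?_)
  refine @MeasurableSet.compl _ _ (𝓕 q) ?_
  have hball : {ω | ‖Z q ω‖ ≤ c} = Z q ⁻¹' Metric.closedBall 0 c := by
    ext ω; simp
  rw [hball]
  exact hZ.adapted q measurableSet_closedBall

variable [IsProbabilityMeasure P]

theorem IsLevyProcess.tendsto_ballEvent (hZ : IsLevyProcess a 𝓕 P Z) :
    Tendsto (fun M => P (ballEvent Z T M)) atTop (𝓝 1) := by
  have h : ⋃ M, ballEvent Z T M = Set.univ :=
    Set.eq_univ_of_forall fun ω => Set.mem_iUnion.2 (hZ.exists_mem_ballEvent ω)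
  have := tendsto_measure_iUnion_atTop (μ := P) (ballEvent_mono (Z := Z) (T := T))
  rwa [h, measure_univ] at this

/-- With positive probability, the process does not leave a given ball in a given time. -/
theorem IsLevyProcess.measure_forall_norm_sub_le_ne_zero (hZ : IsLevyProcess a 𝓕 P Z)
    (ha : IsRateSequence a) (s h : ℝ≥0) (m : ℤ) :
    P {ω | ∀ r ≤ h, ‖Z (s + r) ω - Z s ω‖ ≤ (p : ℝ) ^ m} ≠ 0 := by
  set κ := Real.exp (-h * (p * a m / (p - 1))) with hκ
  set S : ℕ → Set Ω := fun n => {ω | ∀ i < n, ‖gridIncr (fun t => Z t ω) s h n i‖ ≤ (p : ℝ) ^ m}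
    with hS
  have hSm : ∀ n, MeasurableSet (S n) := fun n => by
    have : S n = ⋂ i ∈ Set.Iio n, {ω | ‖gridIncr (fun t => Z t ω) s h n i‖ ≤ (p : ℝ) ^ m} := by
      ext ω; simp [hS]
    rw [this]
    refine MeasurableSet.biInter (Set.to_countable _) fun i _ =>
      measurableSet_le ?_ measurable_const
    exact ((hZ.measurable_gridIncr s h n i).mono (𝓕.le _) le_rfl).norm
  have hlim : ENNReal.ofReal κ ≤ P (⋂ N, ⋃ n ≥ N, S n) := by
    have hanti : Antitone fun N => ⋃ n ≥ N, S n := fun N N' hN =>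
      Set.biUnion_subset_biUnion_left fun n hn => hN.trans hn
    refine ge_of_tendsto (tendsto_measure_iInter_atTop (μ := P) (fun N =>
      (MeasurableSet.biUnion (Set.to_countable _) fun n _ => hSm n).nullMeasurableSet) hanti
      ⟨0, measure_ne_top _ _⟩) ?_
    filter_upwards [eventually_ne_atTop 0] with N hN
    calc ENNReal.ofReal κ ≤ P (S N) :=
          ENNReal.ofReal_le_of_le_toReal (hZ.exp_le_measureReal_gridIncr_le ha s h m hN)
      _ ≤ _ := measure_mono (Set.subset_biUnion_of_mem (u := S) (le_refl N))
  have hpos : 0 < ENNReal.ofReal κ := ENNReal.ofReal_pos.2 (Real.exp_pos _)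
  have hsub : ⋂ N, ⋃ n ≥ N, S n ⊆ {ω | ∀ r ≤ h, ‖Z (s + r) ω - Z s ω‖ ≤ (p : ℝ) ^ m} := ?_
  · exact ((hpos.trans_le hlim).trans_le (measure_mono hsub)).ne'
  intro ω hω r hr
  refine (hZ.cadlag ω).norm_sub_le_of_frequently (h := h) (zpow_pos prime_pos _).le ?_
    le_self_add (add_le_add_right hr s)
  rw [frequently_atTop]
  intro N
  simpa [hS] using Set.mem_iInter.1 hω N

/-- If an event prior to `s` excludes, up to a null set, that the process remains in the ball of
radius `p^m` until `T`, then up to a null set it excludes that the process remains there until `s`: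
the future after `s` is independent and the process may remain where it is. -/
theorem IsLevyProcess.measure_inter_eq_zero (hZ : IsLevyProcess a 𝓕 P Z) (ha : IsRateSequence a)
    {s : ℝ≥0} (m : ℤ) {N : Set Ω} (hN : MeasurableSet[𝓕 s] N)
    (h : P (N ∩ {ω | ∀ t ≤ T, ‖Z t ω‖ ≤ (p : ℝ) ^ m}) = 0) :
    P (N ∩ {ω | ∀ t ≤ s, ‖Z t ω‖ ≤ (p : ℝ) ^ m}) = 0 := by
  set B := {ω | ∀ r ≤ T - s, ‖Z (s + r) ω - Z s ω‖ ≤ (p : ℝ) ^ m} with hB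
  have hBm : MeasurableSet[future Z s] B := by
    refine measurableSet_forall_norm_le (m := future Z s) (W := fun r ω => Z (s + r) ω - Z s ω)
      (T - s) (fun ω r => ?_) (fun r _ => measurable_future le_rfl le_self_add) _
    refine ContinuousWithinAt.sub ?_ continuousWithinAt_const
    exact (hZ.cadlag ω (s + r)).1.comp (f := fun r => s + r) (by fun_prop)
      fun q hq => add_le_add_right hq s
  have hA : MeasurableSet[𝓕 s] (N ∩ {ω | ∀ t ≤ s, ‖Z t ω‖ ≤ (p : ℝ) ^ m}) :=
    hN.inter (measurableSet_forall_norm_le (m := 𝓕 s) s (fun ω t => (hZ.cadlag ω t).1)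
      (fun _ ht => hZ.measurable_le ht) _)
  have hind := (Indep_iff _ _ _).1 (hZ.indep s) _ _ hA hBm
  have h0 : P ((N ∩ {ω | ∀ t ≤ s, ‖Z t ω‖ ≤ (p : ℝ) ^ m}) ∩ B) = 0 := by
    refine measure_mono_null ?_ h
    rintro ω ⟨⟨h1, h2⟩, h3⟩
    refine ⟨h1, fun t ht => ?_⟩
    rcases le_total t s with hts | hst
    · exact h2 t hts
    · have h4 := h3 (t - s) (tsub_le_tsub_right ht s)
      rw [add_tsub_cancel_of_le hst] at h4
      rw [show Z t ω = (Z t ω - Z s ω) + Z s ω by ring]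
      exact (IsUltrametricDist.norm_add_le_max _ _).trans (max_le h4 (h2 s le_rfl))
  rw [h0] at hind
  exact (mul_eq_zero.1 hind.symm).resolve_right
    (hZ.measure_forall_norm_sub_le_ne_zero ha s (T - s) m)

/-- At a fixed time, almost surely the process does not jump out of a ball. -/
theorem IsLevyProcess.ae_norm_le (hZ : IsLevyProcess a 𝓕 P Z) (ha : IsRateSequence a) {s : ℝ≥0}
    (hs : 0 < s) (m : ℤ) :
    ∀ᵐ ω ∂P, (∀ r < s, ‖Z r ω‖ ≤ (p : ℝ) ^ m) → ∀ r ≤ s, ‖Z r ω‖ ≤ (p : ℝ) ^ m := by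
  rw [ae_iff]
  have hlim : Tendsto (fun n : ℕ => ENNReal.ofReal (s / (n + 1) * a m)) atTop (𝓝 0) := by
    have h1 : Tendsto (fun n : ℕ => (s : ℝ) / (n + 1) * a m) atTop (𝓝 0) := by
      have := (tendsto_one_div_add_atTop_nhds_zero_nat (𝕜 := ℝ)).const_mul (s * a m : ℝ)
      rw [mul_zero] at this
      refine this.congr fun n => ?_
      ring
    have h2 := (ENNReal.continuous_ofReal.tendsto 0).comp h1
    rwa [ENNReal.ofReal_zero] at h2
  refine le_antisymm (ge_of_tendsto' hlim fun n => ?_) zero_le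
  have hle : s / (n + 1) ≤ s := div_le_self zero_le (by simp)
  have h1 := hZ.measure_lt_norm_le ha (s - s / (n + 1)) (s / (n + 1)) m
  rw [tsub_add_cancel_of_le hle] at h1
  push_cast at h1
  refine (measure_mono fun ω hω => ?_).trans h1
  rw [Set.mem_ofPred_eq, Classical.not_imp] at hω
  obtain ⟨h2, h3⟩ := hω
  by_contra h4
  refine h3 fun r hr => ?_
  rcases eq_or_lt_of_le hr with rfl | hr
  · have h5 := h2 (r - r / (n + 1)) (tsub_lt_self hs (by positivity))
    rw [show Z r ω = (Z r ω - Z (r - r / (n + 1)) ω) + Z (r - r / (n + 1)) ω by ring]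
    exact (IsUltrametricDist.norm_add_le_max _ _).trans (max_le (not_lt.1 h4) h5)
  · exact h2 r hr

/-- Predictable processes agreeing at every fixed time almost surely on the event that `Z` stays in
a ball agree there, almost surely, at all jump times. -/
theorem IsLevyProcess.ae_eq_of_jump_ne_zero (hZ : IsLevyProcess a 𝓕 P Z) (ha : IsRateSequence a)
    (hγ : 0 < γ) (hs : SummableSmallMoment p γ a) (M : ℕ) {φ φ' : ℝ≥0 → Ω → ℚ_[p]}
    (hφ : IsStronglyPredictable 𝓕 φ) (hφ' : IsStronglyPredictable 𝓕 φ')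
    (h : ∀ t ≤ T, ∀ᵐ ω ∂P, ω ∈ ballEvent Z T M → φ t ω = φ' t ω) :
    ∀ᵐ ω ∂P, ω ∈ ballEvent Z T M → ∀ s ∈ Set.Ioc 0 T, jump (fun t => Z t ω) s ≠ 0 →
      φ s ω = φ' s ω := by
  set A : Set (ℝ≥0 × Ω) := {x | φ x.1 x.2 ≠ φ' x.1 x.2} ∩
    {x | ∀ r < x.1, ‖Z r x.2‖ ≤ (p : ℝ) ^ (M : ℤ)} with hA
  have hd : Measurable[𝓕.predictable] fun x : ℝ≥0 × Ω => φ x.1 x.2 - φ' x.1 x.2 :=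
    (StronglyMeasurable.measurable hφ).sub (StronglyMeasurable.measurable hφ')
  have hAm : MeasurableSet[𝓕.predictable] A := by
    refine @MeasurableSet.inter _ 𝓕.predictable _ _ ?_ (hZ.measurableSet_predictable_norm_le _)
    have h1 : {x : ℝ≥0 × Ω | φ x.1 x.2 ≠ φ' x.1 x.2} =
        ((fun x : ℝ≥0 × Ω => φ x.1 x.2 - φ' x.1 x.2) ⁻¹' {0})ᶜ := by
      ext x; simp [sub_eq_zero]
    rw [h1]
    exact @MeasurableSet.compl _ _ 𝓕.predictable (hd (measurableSet_singleton 0))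
  have hA0 : ((timeMeasure T).prod P) A = 0 := by
    rw [Measure.measure_prod_null (predictable_le 𝓕 _ hAm)]
    have hT : ∀ᵐ s ∂(timeMeasure T), s ∈ Set.Ioc 0 T := ae_mem_Ioc_timeMeasure T
    filter_upwards [hT] with s hsT
    have hN : MeasurableSet[𝓕 s] {ω | φ s ω ≠ φ' s ω} := by
      have h1 : {ω | φ s ω ≠ φ' s ω} = ((fun ω => φ s ω - φ' s ω) ⁻¹' {0})ᶜ := by
        ext ω; simp [sub_eq_zero]
      have h2 : Measurable[𝓕 s] fun ω => φ s ω - φ' s ω :=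
        (StronglyMeasurable.measurable (hφ.stronglyAdapted s)).sub
          (StronglyMeasurable.measurable (hφ'.stronglyAdapted s))
      rw [h1]
      exact @MeasurableSet.compl _ _ (𝓕 s) (h2 (measurableSet_singleton 0))
    have h1 := hZ.measure_inter_eq_zero ha M hN (by
      refine measure_mono_null ?_ (ae_iff.1 (h s hsT.2))
      rintro ω ⟨h1, h2⟩ h3
      exact h1 (h3 h2))
    rw [Pi.zero_apply]
    refine measure_mono_null ?_ (measure_union_null h1 (ae_iff.1 (hZ.ae_norm_le ha hsT.1 M)))
    rintro ω ⟨h2, h3⟩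
    by_cases h4 : ∀ r ≤ s, ‖Z r ω‖ ≤ (p : ℝ) ^ (M : ℤ)
    · exact Or.inl ⟨h2, h4⟩
    · exact Or.inr fun h5 => h4 (h5 h3)
  have hX := hZ.trunc ha M
  obtain ⟨h1, h2⟩ := hX.compensation_set (ha.trunc M) hγ (hs.trunc M) T hAm
  rw [hA0, mul_zero, lintegral_eq_zero_iff' h1] at h2
  filter_upwards [h2] with ω hω hωE s hsT hj
  by_contra hne
  have hsA : (s, ω) ∈ A := ⟨hne, fun r hr => hωE r (hr.le.trans hsT.2)⟩
  have h3 := ENNReal.tsum_eq_zero.1 hω s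
  rw [Set.indicator_of_mem hsT] at h3
  beta_reduce at h3
  rw [Set.indicator_of_mem hsA, Pi.one_apply, one_mul,
    ENNReal.rpow_eq_zero_iff_of_pos hγ, enorm_eq_zero,
    hZ.jump_truncProcess_of_mem le_rfl hωE hsT.2] at h3
  exact hj h3

/-- On the event that `Z` stays in the ball of radius `p^M`, the integrals with respect to the
truncations at levels `M ≤ N` agree, as soon as the integrands do so at fixed times. -/
theorem IsLevyProcess.ae_jumpInt_eq (hZ : IsLevyProcess a 𝓕 P Z) (ha : IsRateSequence a)
    (hγ : 0 < γ) (hs : SummableSmallMoment p γ a) {M N : ℕ} (hMN : M ≤ N)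
    {φ φ' : ℝ≥0 → Ω → ℚ_[p]} (hφ : IsStronglyPredictable 𝓕 φ) (hφ' : IsStronglyPredictable 𝓕 φ')
    (h : ∀ t ≤ T, ∀ᵐ ω ∂P, ω ∈ ballEvent Z T M → φ t ω = φ' t ω) :
    ∀ᵐ ω ∂P, ω ∈ ballEvent Z T M → ∀ t,
      jumpInt T (truncProcess Z M) φ t ω = jumpInt T (truncProcess Z N) φ' t ω := by
  filter_upwards [hZ.ae_eq_of_jump_ne_zero ha hγ hs M hφ hφ' h] with ω hω hωE t
  rw [jumpInt, jumpInt]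
  congr 1
  ext s
  by_cases hsT : s ∈ Set.Ioc 0 T
  · rw [Set.indicator_of_mem hsT, Set.indicator_of_mem hsT,
      hZ.jump_truncProcess_of_mem le_rfl hωE hsT.2, hZ.jump_truncProcess_of_mem hMN hωE hsT.2]
    by_cases hj : jump (fun t => Z t ω) s = 0
    · rw [hj, mul_zero, mul_zero]
    · rw [hω hωE s hsT hj]
  · rw [Set.indicator_of_notMem hsT, Set.indicator_of_notMem hsT]

end Localization

section Localized

variable {p : ℕ} [hp : Fact p.Prime] {Ω : Type*} {mΩ : MeasurableSpace Ω} {P : Measure Ω}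
  [IsProbabilityMeasure P] {𝓕 : Filtration ℝ≥0 mΩ} {Z : ℝ≥0 → Ω → ℚ_[p]} {a : ℤ → ℝ} {γ : ℝ}
  {T : ℝ≥0}

/-- The integral with respect to `Z` itself: on the event that `Z` stays in the ball of radius
`p^M`, it is the integral with respect to the truncation at level `M`. -/
theorem IsLevyProcess.exists_localizedIntegral (hZ : IsLevyProcess a 𝓕 P Z)
    (ha : IsRateSequence a) (hγ : 1 ≤ γ) (hs : SummableSmallMoment p γ a) (hT : 0 < T)
    {φ : ℝ≥0 → Ω → ℚ_[p]} {φM : ℕ → ℝ≥0 → Ω → ℚ_[p]} (hφM : ∀ M, 1 ≤ M → MemL 𝓕 P γ T (φM M))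
    (h : ∀ M, 1 ≤ M → ∀ t ≤ T, ∀ᵐ ω ∂P, ω ∈ ballEvent Z T M → φ t ω = φM M t ω) :
    ∃ Y, IsLocalizedIntegral 𝓕 P γ T Z (ballEvent Z T) φM Y ∧
      ∀ Y', IsLocalizedIntegral 𝓕 P γ T Z (ballEvent Z T) φM Y' →
        ∀ᵐ ω ∂P, ∀ t ≤ T, Y' t ω = Y t ω := by
  classical
  have hγ0 : 0 < γ := zero_lt_one.trans_le hγ
  have hex : ∀ n : ℕ, ∃ Y, IsStochIntegral 𝓕 P γ T (truncProcess Z (n + 1 : ℕ)) (φM (n + 1)) Y ∧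
      (∀ t ≤ T, AEStronglyMeasurable[𝓕 t] (Y t) P) ∧
      ∀ᵐ ω ∂P, ∀ t ≤ T, Y t ω = jumpInt T (truncProcess Z (n + 1 : ℕ)) (φM (n + 1)) t ω := fun n =>
    (hZ.trunc ha _).exists_stochIntegral (ha.trunc _) hγ (hs.trunc _) hT (hφM _ n.succ_pos)
  choose I hI hIm hIe using hex
  have hmem : ∀ ω, ∃ n, ω ∈ ballEvent Z T (n + 1) := fun ω => by
    obtain ⟨M, hM⟩ := hZ.exists_mem_ballEvent (T := T) ω
    exact ⟨M, ballEvent_mono M.le_succ hM⟩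
  have hpair : ∀ᵐ ω ∂P, ∀ m n, m ≤ n → ω ∈ ballEvent Z T (m + 1) → ∀ t ≤ T, I m t ω = I n t ω := by
    refine ae_all_iff.2 fun m => ae_all_iff.2 fun n => ?_
    by_cases hmn : m ≤ n
    · have hag : ∀ t ≤ T, ∀ᵐ ω ∂P, ω ∈ ballEvent Z T (m + 1) → φM (m + 1) t ω = φM (n + 1) t ω := by
        intro t ht
        filter_upwards [h (m + 1) m.succ_pos t ht, h (n + 1) n.succ_pos t ht] with ω h1 h2 hω
        rw [← h1 hω, h2 (ballEvent_mono (Nat.succ_le_succ hmn) hω)]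
      filter_upwards [hIe m, hIe n, hZ.ae_jumpInt_eq ha hγ0 hs (Nat.succ_le_succ hmn)
        (hφM _ m.succ_pos).1 (hφM _ n.succ_pos).1 hag] with ω h1 h2 h3 _ hω t ht
      rw [h1 t ht, h2 t ht, h3 hω t]
    · exact Eventually.of_forall fun ω h => absurd h hmn
  have hY : ∀ᵐ ω ∂P, ∀ n, ω ∈ ballEvent Z T (n + 1) → ∀ t ≤ T,
      I (Nat.find (hmem ω)) t ω = I n t ω := by
    filter_upwards [hpair] with ω hω n hn t ht
    exact hω _ n (Nat.find_min' (hmem ω) hn) (Nat.find_spec (hmem ω)) t ht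
  refine ⟨fun t ω => I (Nat.find (hmem ω)) t ω, ⟨fun t ht => ?_, fun ω => ?_, fun M hM J hJ => ?_⟩,
    fun Y' hY' => ?_⟩
  · refine aestronglyMeasurable_of_tendsto (f := fun n => I n t) (fun n => hIm n t ht) ?_
    filter_upwards [hY] with ω hω
    refine tendsto_const_nhds.congr' ?_
    filter_upwards [eventually_ge_atTop (Nat.find (hmem ω))] with n hn
    exact hω n (ballEvent_mono (Nat.succ_le_succ hn) (Nat.find_spec (hmem ω))) t ht
  · exact (hI (Nat.find (hmem ω))).2.1 ω
  · obtain ⟨n, rfl⟩ : ∃ n, M = n + 1 := ⟨M - 1, by omega⟩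
    filter_upwards [hY, hIe n, (hZ.trunc ha _).stochIntegral_eq (ha.trunc _) hγ (hs.trunc _) hT
      (hφM _ hM) hJ] with ω h1 h2 h3 hω t ht
    rw [h1 n hω t ht, h2 t ht, h3 t ht]
  · have hY'' := ae_all_iff.2 fun n => hY'.2.2 (n + 1) n.succ_pos (I n) (hI n)
    filter_upwards [hY''] with ω hω t ht
    exact hω _ (Nat.find_spec (hmem ω)) t ht

end Localized

end

end PadicLevy

theorem proposition2 {p : ℕ} [Fact p.Prime] {Ω : Type*} {mΩ : MeasurableSpace Ω}
    (P : Measure Ω) [IsProbabilityMeasure P] (γ : ℝ) (hγ : 1 ≤ γ)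
    (a : ℤ → ℝ) (ha : PadicLevy.IsRateSequence a) (ha' : PadicLevy.SummableSmallMoment p γ a)
    (𝓕 : Filtration ℝ≥0 mΩ) (Z : ℝ≥0 → Ω → ℚ_[p]) (hZ : PadicLevy.IsLevyProcess a 𝓕 P Z) :
    -- (i) the truncated processes are random walks corresponding to `A(M)`
    (∀ M : ℤ,
      PadicLevy.IsRateSequence (PadicLevy.truncSeq a M) ∧
      PadicLevy.SummableMoment p γ (PadicLevy.truncSeq a M) ∧
      (∀ t ω, PadicLevy.JumpIntegrable (PadicLevy.jumpMeasure fun s => Z s ω)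
        (PadicLevy.truncFun p M) t) ∧
      PadicLevy.IsLevyProcess (PadicLevy.truncSeq a M) 𝓕 P (PadicLevy.truncProcess Z M)) ∧
    (∀ T : ℝ≥0, 0 < T →
      -- the stochastic integrals with respect to the truncated processes exist and are unique
      (∀ (M : ℤ) (φ : ℝ≥0 → Ω → ℚ_[p]), PadicLevy.MemL 𝓕 P γ T φ →
        ∃ Y, PadicLevy.IsStochIntegral 𝓕 P γ T (PadicLevy.truncProcess Z M) φ Y ∧
          ∀ Y', PadicLevy.IsStochIntegral 𝓕 P γ T (PadicLevy.truncProcess Z M) φ Y' →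
            ∀ᵐ ω ∂P, ∀ t ≤ T, Y' t ω = Y t ω) ∧
      ∃ E : ℕ → Set Ω,
        (∀ M, MeasurableSet (E M)) ∧ Tendsto (fun M => P (E M)) atTop (𝓝 1) ∧
        -- (ii) one integrand
        (∀ φ : ℝ≥0 → Ω → ℚ_[p], PadicLevy.MemL 𝓕 P γ T φ →
          ∀ M k : ℕ, 1 ≤ k → ∀ Y Y',
            PadicLevy.IsStochIntegral 𝓕 P γ T (PadicLevy.truncProcess Z M) φ Y →
            PadicLevy.IsStochIntegral 𝓕 P γ T
              (PadicLevy.truncProcess Z ((M + k : ℕ) : ℤ)) φ Y' →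
            ∀ᵐ ω ∂P, ω ∈ E M → ∀ t ≤ T, Y t ω = Y' t ω) ∧
        -- (iii) consistent integrands
        (∀ φ : ℕ → ℝ≥0 → Ω → ℚ_[p], (∀ M, PadicLevy.MemL 𝓕 P γ T (φ M)) →
          (∀ M k : ℕ, 1 ≤ k → ∀ t ≤ T, ∀ᵐ ω ∂P, ω ∈ E M → φ M t ω = φ (M + k) t ω) →
          ∀ M k : ℕ, 1 ≤ k → ∀ Y Y',
            PadicLevy.IsStochIntegral 𝓕 P γ T (PadicLevy.truncProcess Z M) (φ M) Y →
            PadicLevy.IsStochIntegral 𝓕 P γ T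
              (PadicLevy.truncProcess Z ((M + k : ℕ) : ℤ)) (φ (M + k)) Y' →
            ∀ᵐ ω ∂P, ω ∈ E M → ∀ t ≤ T, Y t ω = Y' t ω) ∧
        -- consequently the integral with respect to `Z` is defined
        (∀ (φ : ℝ≥0 → Ω → ℚ_[p]) (φM : ℕ → ℝ≥0 → Ω → ℚ_[p]),
          IsStronglyPredictable 𝓕 φ → (∀ M, 1 ≤ M → PadicLevy.MemL 𝓕 P γ T (φM M)) →
          (∀ M, 1 ≤ M → ∀ t ≤ T, ∀ᵐ ω ∂P, ω ∈ E M → φ t ω = φM M t ω) →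
          ∃ Y, PadicLevy.IsLocalizedIntegral 𝓕 P γ T Z E φM Y ∧
            ∀ Y', PadicLevy.IsLocalizedIntegral 𝓕 P γ T Z E φM Y' →
              ∀ᵐ ω ∂P, ∀ t ≤ T, Y' t ω = Y t ω)) ∧
    -- the sequence of the stable process is covered
    (∀ α : ℝ, 0 < α → α < γ →
      PadicLevy.IsRateSequence (PadicLevy.stableSeq p α) ∧
      PadicLevy.SummableSmallMoment p γ (PadicLevy.stableSeq p α)) := by
  have hγ0 : 0 < γ := zero_lt_one.trans_le hγ
  have key := fun (T : ℝ≥0) (φ φ' : ℝ≥0 → Ω → ℚ_[p]) (hT : 0 < T)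
      (hφ : PadicLevy.MemL 𝓕 P γ T φ) (hφ' : PadicLevy.MemL 𝓕 P γ T φ') (M k : ℕ)
      (h : ∀ t ≤ T, ∀ᵐ ω ∂P, ω ∈ PadicLevy.ballEvent Z T M → φ t ω = φ' t ω)
      (Y Y' : ℝ≥0 → Ω → ℚ_[p])
      (hY : PadicLevy.IsStochIntegral 𝓕 P γ T (PadicLevy.truncProcess Z M) φ Y)
      (hY' : PadicLevy.IsStochIntegral 𝓕 P γ T
        (PadicLevy.truncProcess Z ((M + k : ℕ) : ℤ)) φ' Y') =>
    show ∀ᵐ ω ∂P, ω ∈ PadicLevy.ballEvent Z T M → ∀ t ≤ T, Y t ω = Y' t ω by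
      filter_upwards [(hZ.trunc ha _).stochIntegral_eq (ha.trunc _) hγ (ha'.trunc _) hT hφ hY,
        (hZ.trunc ha _).stochIntegral_eq (ha.trunc _) hγ (ha'.trunc _) hT hφ' hY',
        hZ.ae_jumpInt_eq ha hγ0 ha' (Nat.le_add_right M k) hφ.1 hφ'.1 h] with ω h1 h2 h3 hω t ht
      rw [h1 t ht, h2 t ht, h3 hω t]
  refine ⟨fun M => ⟨ha.trunc M, ha'.trunc M, fun t ω => ?_, hZ.trunc ha M⟩, fun T hT => ⟨?_,
    PadicLevy.ballEvent Z T, fun M => 𝓕.le T _ (hZ.measurableSet_ballEvent M),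
    hZ.tendsto_ballEvent, ?_, ?_, ?_⟩, fun α hα hαγ => ⟨PadicLevy.isRateSequence_stableSeq hα,
      PadicLevy.summableSmallMoment_stableSeq hαγ⟩⟩
  · exact (hZ.cadlag ω).jumpIntegrable (PadicLevy.isShort_truncFun M) t
  · intro M φ hφ
    obtain ⟨Y, hY, -, hYe⟩ :=
      (hZ.trunc ha M).exists_stochIntegral (ha.trunc M) hγ (ha'.trunc M) hT hφ
    refine ⟨Y, hY, fun Y' hY' => ?_⟩
    filter_upwards [hYe, (hZ.trunc ha M).stochIntegral_eq (ha.trunc M) hγ (ha'.trunc M) hT hφ hY']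
      with ω h1 h2 t ht
    rw [h1 t ht, h2 t ht]
  · intro φ hφ M k _ Y Y' hY hY'
    exact key T φ φ hT hφ hφ M k (fun t _ => Eventually.of_forall fun ω _ => rfl) Y Y' hY hY'
  · intro φ hφ h M k hk Y Y' hY hY'
    exact key T _ _ hT (hφ M) (hφ (M + k)) M k (h M k hk) Y Y' hY hY'
  · intro φ φM _ hφM h
    exact hZ.exists_localizedIntegral ha hγ ha' hT hφM h
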